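/- Identify $\mathbb R^3$ with the purely imaginary quaternions $xe_1+ye_2+ze_3$, where $e_1=i$, $e_2=j$, $e_3=k=e_1e_2$, and put $\overline\sigma=e_3\sigma e_3$ and $K(\xi)=-\frac{2}{4\pi}\frac{\xi}{|\xi|^3}$. For a surface $\xi=\xi(\alpha,\beta)$ with normal $N=\xi_\alpha\times\xi_\beta$ the Clifford Hilbert transform is $$\mathfrak H f(\alpha,\beta)=\mathrm{p.v.}\iint K(\xi'-\xi)\,N'f'\,d\alpha'd\beta',$$ where primed quantities are taken at $(\alpha',\beta')$ and unprimed ones at $(\alpha,\beta)$; $N\times\nabla=\xi_\beta\partial_\alpha-\xi_\alpha\partial_\beta$; products are products of quaternions. Let $\kappa>0$ and $\Lambda\in\mathbb R$. Let $T>0$ and let $\xi(\alpha,\beta,t)=xe_1+ye_2+ze_3$, $(\alpha,\beta)\in\mathbb R^2$, $t\in[0,T]$, together with a real function $\mathfrak a$, be a classical solution, decaying at infinity, of the water wave system $$\xi_{tt}+e_3=\mathfrak aN,\qquad \xi_t=\mathfrak H\xi_t .$$ Precisely: $\xi\in C^2(\mathbb R^2\times[0,T])$ and $\xi_{tt}\in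 C^1(\mathbb R^2\times[0,T])$; $|\xi(p,t)-\xi(q,t)|\ge\kappa|p-q|$ for all $p,q\in\mathbb R^2$, and $|\xi_\alpha|,|\xi_\beta|\le\Lambda$; $\xi_t,\xi_{tt},\partial_\alpha\xi_t,\partial_\beta\xi_t,z_\alpha,z_\beta$ are bounded, and bounded in $L^2(\mathbb R^2)$, uniformly in $t$; and for some $r\in[1,\infty)$, $z(\cdot,t)\in L^r(\mathbb R^2)$ for every $t$. Let $$\pi=(I-\mathfrak H)(z e_3).$$ (i) The principal value in $\pi$ converges, the derivatives $\partial_t\pi,\partial_t^2\pi,\partial_\alpha\pi,\partial_\beta\pi$ exist, the three integrals below converge absolutely, and on $\mathbb R^2\times[0,T]$ $$(\partial_t^2-\mathfrak aN\times\nabla)\pi=I_1-I_2-I_3,$$ $$I_1=\iint K(\xi'-\xi)\,(\xi_t-\xi_t')\times(\xi'_{\beta'}\partial_{\alpha'}-\xi'_{\alpha'}\partial_{\beta'})\,\overline{\xi_t'}\,d\alpha'd\beta',$$ $$I_2=\iint K(\xi'-\xi)\,(\xi_t-\xi_t')\times(\xi'_{t\beta'}\partial_{\alpha'}-\xi'_{t\alpha'}\partial_{\beta'})\,z'\,d\alpha'd\beta'\,e_3,$$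 $$I_3=\iint \partial_tK(\xi'-\xi)\,(\xi_t-\xi_t')\times(\xi'_{\beta'}\partial_{\alpha'}-\xi'_{\alpha'}\partial_{\beta'})\,z'\,d\alpha'd\beta'\,e_3 .$$ (ii) $I_2$ and $I_3$ are of cubic and higher order, while $I_1$ is quadratic with $\overline{\xi_t}$ almost analytic in the air region, in the following sense. There is a constant $C$ depending only on $\kappa$ and $\Lambda$ such that, if at a time $t$ the number $M$ bounds the supremum norms of $\xi_t,\partial_\alpha\xi_t,\partial_\beta\xi_t,z_\alpha,z_\beta$ and the $L^2(\mathbb R^2)$ norms of $\partial_\alpha\xi_t,\partial_\beta\xi_t,z_\alpha,z_\beta$, then at this time, at every point, $$|I_1|\le CM^2,\qquad |I_2|\le CM^3,\qquad |I_3|\le CM^3,$$ the principal value $\mathfrak H\overline{\xi_t}$ converges, and $$(I+\mathfrak H)\overline{\xi_t}=\mathrm{p.v.}\iint\bigl(KN'-\overline{KN'}\bigr)\,\overline{\xi_t'}\,d\alpha'd\beta',\qquad K=K(\xi'-\xi),$$ where $|KN'-\overline{KN'}|\,|(\alpha',\beta')-(\alpha,\beta)|^{2}\le CM$. (Traces of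 decaying functions that are Clifford analytic in the air region are those $f$ with $(I+\mathfrak H)f=0$.) -/

import Mathlib

open MeasureTheory Filter Topology Set
open scoped Quaternion

noncomputable section

namespace WaterWave

/-! ### The Clifford algebra `𝒞(V₂)`, i.e. the quaternions, with `e₁ = i`, `e₂ = j`, `e₃ = k = e₁ e₂`

A point `(x, y, z)` of `ℝ³` is identified with the purely imaginary quaternion
`x e₁ + y e₂ + z e₃`; the quaternion norm is then the Euclidean norm. -/

/-- The basis vector `e₃`, the upward vertical direction. -/
def e3 : ℍ[ℝ] := ⟨0, 0, 0, 1⟩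

@[simp] theorem e3_re : e3.re = 0 := rfl
@[simp] theorem e3_imI : e3.imI = 0 := rfl
@[simp] theorem e3_imJ : e3.imJ = 0 := rfl
@[simp] theorem e3_imK : e3.imK = 1 := rfl

/-- The conjugation `σ ↦ σ̄ = e₃ σ e₃`; on vectors it is the reflection
`x e₁ + y e₂ + z e₃ ↦ x e₁ + y e₂ - z e₃`. -/
def cbar (σ : ℍ[ℝ]) : ℍ[ℝ] := e3 * σ * e3

/-- The cross product of (the vector parts of) two quaternions. -/
def cross (σ τ : ℍ[ℝ]) : ℍ[ℝ] :=
  ⟨0, σ.imJ * τ.imK - σ.imK * τ.imJ, σ.imK * τ.imI - σ.imI * τ.imK,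
    σ.imI * τ.imJ - σ.imJ * τ.imI⟩

@[simp] theorem cross_re (σ τ : ℍ[ℝ]) : (cross σ τ).re = 0 := rfl
@[simp] theorem cross_imI (σ τ : ℍ[ℝ]) :
    (cross σ τ).imI = σ.imJ * τ.imK - σ.imK * τ.imJ := rfl
@[simp] theorem cross_imJ (σ τ : ℍ[ℝ]) :
    (cross σ τ).imJ = σ.imK * τ.imI - σ.imI * τ.imK := rfl
@[simp] theorem cross_imK (σ τ : ℍ[ℝ]) :
    (cross σ τ).imK = σ.imI * τ.imJ - σ.imJ * τ.imI := rfl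

/-- The Clifford kernel `K(ξ) = -(2/ω₃) ξ / |ξ|³`, where `ω₃ = 4π` is the area of the unit sphere
of `ℝ³`. -/
def K (x : ℍ[ℝ]) : ℍ[ℝ] := (-(2 / (4 * Real.pi)) / ‖x‖ ^ 3) • x

/-! ### Functions on the parameter plane `ℝ²`, with coordinates `(α, β)` -/

/-- The partial derivative `∂_α`. -/
def dα {E : Type*} [NormedAddCommGroup E] [NormedSpace ℝ E] (f : ℝ × ℝ → E) (p : ℝ × ℝ) : E :=
  deriv (fun s => f (s, p.2)) p.1

/-- The partial derivative `∂_β`. -/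
def dβ {E : Type*} [NormedAddCommGroup E] [NormedSpace ℝ E] (f : ℝ × ℝ → E) (p : ℝ × ℝ) : E :=
  deriv (fun s => f (p.1, s)) p.2

/-- Euclidean distance in the parameter plane (Mathlib's distance on `ℝ × ℝ` is the sup distance). -/
def pdist (p q : ℝ × ℝ) : ℝ := Real.sqrt ((p.1 - q.1) ^ 2 + (p.2 - q.2) ^ 2)

/-- The truncated integral `∬_{|q - p| > ε} F(q) dq`. -/
def truncInt (F : ℝ × ℝ → ℍ[ℝ]) (p : ℝ × ℝ) (ε : ℝ) : ℍ[ℝ] :=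
  ∫ q in {q : ℝ × ℝ | ε < pdist q p}, F q

/-- The principal value integral `p.v. ∬ F(q) dq`, with singularity at `p`, converges to `L`: `F` is
integrable off every disc about `p`, and the truncated integrals tend to `L`. -/
def HasPV (F : ℝ × ℝ → ℍ[ℝ]) (p : ℝ × ℝ) (L : ℍ[ℝ]) : Prop :=
  (∀ ε : ℝ, 0 < ε → IntegrableOn F {q : ℝ × ℝ | ε < pdist q p}) ∧
    Tendsto (truncInt F p) (𝓝[>] 0) (𝓝 L)

/-- The normal `N = ξ_α × ξ_β` of the parametrized surface `ξ`. -/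
def normal (ξ : ℝ × ℝ → ℍ[ℝ]) (p : ℝ × ℝ) : ℍ[ℝ] := cross (dα ξ p) (dβ ξ p)

/-- The integrand `K(ξ' - ξ) N' f'` of the Hilbert transform; unprimed quantities are taken at `p`,
primed ones at `q`. -/
def hilbertIntegrand (ξ f : ℝ × ℝ → ℍ[ℝ]) (p q : ℝ × ℝ) : ℍ[ℝ] :=
  K (ξ q - ξ p) * normal ξ q * f q

/-- The Clifford Hilbert transform `𝔥 f(p) = p.v. ∬ K(ξ' - ξ) N' f' dα' dβ'` of the surface `ξ`
(meaningful where the principal value converges, see `HasPV`). -/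
def hilbert (ξ f : ℝ × ℝ → ℍ[ℝ]) (p : ℝ × ℝ) : ℍ[ℝ] :=
  limUnder (𝓝[>] 0) (truncInt (hilbertIntegrand ξ f p) p)

/-- The operator `N × ∇ = ξ_β ∂_α - ξ_α ∂_β`, acting by Clifford multiplication from the left. -/
def normalCrossGrad (ξ f : ℝ × ℝ → ℍ[ℝ]) (p : ℝ × ℝ) : ℍ[ℝ] :=
  dβ ξ p * dα f p - dα ξ p * dβ f p

/-- The expression `k (g - g') × (η'_{β'} ∂_{α'} - η'_{α'} ∂_{β'}) f'`; unprimed quantities are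
taken at `p`, primed ones at `q`. -/
def crossIntegrand (k : ℍ[ℝ]) (g η f : ℝ × ℝ → ℍ[ℝ]) (p q : ℝ × ℝ) : ℍ[ℝ] :=
  k * (cross (g p - g q) (dβ η q) * dα f q - cross (g p - g q) (dα η q) * dβ f q)

/-! ### The water wave system -/

/-- The height `z` of the surface, a real function. -/
def height (ξ : ℝ × ℝ → ℍ[ℝ]) (p : ℝ × ℝ) : ℝ := (ξ p).imK

/-- The height as a Clifford valued function. -/
def heightC (ξ : ℝ × ℝ → ℍ[ℝ]) (p : ℝ × ℝ) : ℍ[ℝ] := (height ξ p : ℍ[ℝ])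

/-- `M` bounds the velocity `v`, its derivatives, and the steepness of the surface `ξ`, at one
fixed time. -/
structure SizeBound (ξ v : ℝ × ℝ → ℍ[ℝ]) (M : ℝ) : Prop where
  vel : ∀ p, ‖v p‖ ≤ M
  vel_α : ∀ p, ‖dα v p‖ ≤ M
  vel_β : ∀ p, ‖dβ v p‖ ≤ M
  slope_α : ∀ p, |dα (height ξ) p| ≤ M
  slope_β : ∀ p, |dβ (height ξ) p| ≤ M
  vel_α_L2 : eLpNorm (dα v) 2 volume ≤ ENNReal.ofReal M
  vel_β_L2 : eLpNorm (dβ v) 2 volume ≤ ENNReal.ofReal M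
  slope_α_L2 : eLpNorm (dα (height ξ)) 2 volume ≤ ENNReal.ofReal M
  slope_β_L2 : eLpNorm (dβ (height ξ)) 2 volume ≤ ENNReal.ofReal M

/-- A classical solution on `[0, T]`, decaying at spatial infinity, of the water wave system
`ξ_tt + e₃ = 𝔞 N`, `ξ_t = 𝔥 ξ_t`, for the interface `ξ` in Lagrangian coordinates; `v = ξ_t` and
`w = ξ_tt`. The interfaces satisfy the chord-arc condition with constant `κ`, and `Λ` bounds their
tangent vectors. -/
structure IsSolution (T κ Λ : ℝ) (ξ v w : ℝ → ℝ × ℝ → ℍ[ℝ]) (a : ℝ → ℝ × ℝ → ℝ) : Prop where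
  /-- `ξ` takes values in `ℝ³`. -/
  isVector : ∀ t ∈ Icc 0 T, ∀ p, (ξ t p).re = 0
  hasDeriv_ξ : ∀ t ∈ Icc 0 T, ∀ p, HasDerivWithinAt (fun s => ξ s p) (v t p) (Icc 0 T) t
  hasDeriv_v : ∀ t ∈ Icc 0 T, ∀ p, HasDerivWithinAt (fun s => v s p) (w t p) (Icc 0 T) t
  /-- `ξ ∈ C²(ℝ² × [0, T])`. -/
  regular_ξ : ContDiffOn ℝ 2 (fun y : ℝ × (ℝ × ℝ) => ξ y.1 y.2) (Icc 0 T ×ˢ univ)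
  /-- `ξ_tt ∈ C¹(ℝ² × [0, T])`. -/
  regular_w : ContDiffOn ℝ 1 (fun y : ℝ × (ℝ × ℝ) => w y.1 y.2) (Icc 0 T ×ˢ univ)
  /-- The interface is uniformly non-self-intersecting. -/
  chordArc : ∀ t ∈ Icc 0 T, ∀ p q, κ * pdist p q ≤ ‖ξ t p - ξ t q‖
  tangent_α : ∀ t ∈ Icc 0 T, ∀ p, ‖dα (ξ t) p‖ ≤ Λ
  tangent_β : ∀ t ∈ Icc 0 T, ∀ p, ‖dβ (ξ t) p‖ ≤ Λ
  /-- Velocity, acceleration, velocity gradient and steepness are bounded in `L^∞` and in `L²`,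
  uniformly in time. -/
  decay : ∃ B : ℝ, ∀ t ∈ Icc 0 T, SizeBound (ξ t) (v t) B ∧
    eLpNorm (v t) 2 volume ≤ ENNReal.ofReal B ∧
    eLpNorm (w t) 2 volume ≤ ENNReal.ofReal B ∧ ∀ p, ‖w t p‖ ≤ B
  /-- The height lies in some `L^r`, `r < ∞`. -/
  height_decay : ∃ r : ENNReal, 1 ≤ r ∧ r ≠ ⊤ ∧ ∀ t ∈ Icc 0 T, MemLp (height (ξ t)) r volume
  /-- `ξ_tt + e₃ = 𝔞 N`. -/
  momentum : ∀ t ∈ Icc 0 T, ∀ p, w t p + e3 = a t p • normal (ξ t) p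
  /-- `ξ_t = 𝔥 ξ_t`. -/
  analytic : ∀ t ∈ Icc 0 T, ∀ p, HasPV (hilbertIntegrand (ξ t) (v t) p) p (v t p)

/-- The quantity `π = (I - 𝔥) z e₃`. -/
def piQ (ξ : ℝ × ℝ → ℍ[ℝ]) (p : ℝ × ℝ) : ℍ[ℝ] :=
  heightC ξ p * e3 - hilbert ξ (fun q => heightC ξ q * e3) p

/-- `∂_t K(ξ' - ξ)`, for a surface moving during `[0, T]`. -/
def dtK (T : ℝ) (ξ : ℝ → ℝ × ℝ → ℍ[ℝ]) (t : ℝ) (p q : ℝ × ℝ) : ℍ[ℝ] :=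
  derivWithin (fun s => K (ξ s q - ξ s p)) (Icc 0 T) t

/-- First integrand: `K(ξ' - ξ) (ξ_t - ξ'_t) × (ξ'_{β'} ∂_{α'} - ξ'_{α'} ∂_{β'}) ξ̄'_t`. -/
def integrand₁ (ξ v : ℝ → ℝ × ℝ → ℍ[ℝ]) (t : ℝ) (p q : ℝ × ℝ) : ℍ[ℝ] :=
  crossIntegrand (K (ξ t q - ξ t p)) (v t) (ξ t) (fun r => cbar (v t r)) p q

/-- Second integrand: `K(ξ' - ξ) (ξ_t - ξ'_t) × (ξ'_{tβ'} ∂_{α'} - ξ'_{tα'} ∂_{β'}) z'`. -/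
def integrand₂ (ξ v : ℝ → ℝ × ℝ → ℍ[ℝ]) (t : ℝ) (p q : ℝ × ℝ) : ℍ[ℝ] :=
  crossIntegrand (K (ξ t q - ξ t p)) (v t) (v t) (heightC (ξ t)) p q

/-- Third integrand: `∂_t K(ξ' - ξ) (ξ_t - ξ'_t) × (ξ'_{β'} ∂_{α'} - ξ'_{α'} ∂_{β'}) z'`. -/
def integrand₃ (T : ℝ) (ξ v : ℝ → ℝ × ℝ → ℍ[ℝ]) (t : ℝ) (p q : ℝ × ℝ) : ℍ[ℝ] :=
  crossIntegrand (dtK T ξ t p q) (v t) (ξ t) (heightC (ξ t)) p q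

/-- The kernel `K N' - (K N')‾ = -2 K·N' + 2 (K₁ N'₂ - K₂ N'₁) e₃` of the operator `𝔥 - 𝔥̄`, which
vanishes for a horizontal plane. -/
def defectKernel (ξ : ℝ × ℝ → ℍ[ℝ]) (p q : ℝ × ℝ) : ℍ[ℝ] :=
  K (ξ q - ξ p) * normal ξ q - cbar (K (ξ q - ξ p) * normal ξ q)

end WaterWave

end

open WaterWave

/-!
The equation for `π = (I - 𝔥)(z e₃)` comes from one commutator identity. For a surface `X` moving
with velocity `V = X_s`, and a density `f`,
`∂_s 𝔥 f = 𝔥 f_s + ∬ K(X' - X) (V - V') × (X'_β ∂_α - X'_α ∂_β) f'`.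
Formally it holds because the `s`-derivative of `K(X' - X) N'`, applied to `f'`, differs from the
integrand on the right by a divergence in `(α', β')`; this is the cyclic identity `DK_cross_cyclic` for the
derivative of `K`, which expresses that `K` is Clifford analytic away from the origin
(`deriv_integrand_eq`).

The analytic content is that the divergence contributes nothing. The kernel is of size `‖h‖⁻²`, so
that `𝔥 f` exists only because the leading part of its integrand is odd in the displacement `h`.
Principal values are therefore written as integrals of the even part of the integrand
(`symmIntegral`, `hasPV_symmIntegral`), and these are limits, uniformly in `s`, of integrals against
smooth even cutoffs (`tendstoUniformlyOn_cutoff`). Integration by parts against a cutoff produces its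
gradient, which is odd, of size `1/‖h‖`, and lives on two annuli; it pairs to zero in the limit with
the flux, which is even up to `o(1/‖h‖)` at the origin and integrable against `1/‖h‖` at infinity
(`tendstoUniformlyOn_cutoffGrad`). Uniform convergence of the derivatives then gives
`Motion.hasDerivWithinAt_hilbert`. Since the identity is proved for the base point `0` of a moving
surface, it applies equally to the time variable and to the translates `ξ(· + p + s e)` of one
fixed surface; the latter give the `α`- and `β`-derivatives of `𝔥(z e₃)`.

Differentiating `π` twice in time yields the integrals `I₂` and `I₃`, the commutator with density
`z_t e₃` twice, the commutator integral with `ξ_tt - ξ_tt'` in place of `ξ_t - ξ_t'`, and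
`𝔥(z_tt e₃)` (`Motion.hasDerivWithinAt_comm`). The last two are compared with `𝔞 N × ∇ 𝔥(z e₃)`. For
the latter the translation identity gives a principal value with kernel
`K(ξ' - ξ) (N × F')`, where `F = z_α ξ_β - z_β ξ_α`
(`FlatSurface.hasPV_normalCrossGrad_hilbert`); the scalar term which arises when `K` is moved past
`N` (`mul_K_cross`) is the integral of a divergence and vanishes (`symmIntegral_skewGrad_re`).
Multiplied by `𝔞`, the kernel involves `𝔞 N = ξ_tt + e₃`, which is split as
`(ξ_tt - ξ_tt') + 𝔞' N'`. The first part is the commutator integral with `ξ_tt - ξ_tt'`, and in the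
second `𝔞' F' e₃` is minus the horizontal part of `ξ_tt'` (`IsSolution.smul_field_mul_e3`), so that
these terms combine with `𝔥(z_tt e₃)` to `𝔥 ξ_tt` (`IsSolution.hilbert_accel_eq`). Differentiating
`ξ_t = 𝔥 ξ_t` in time expresses `𝔥 ξ_tt` through `ξ_tt` and the commutator integral with density
`ξ_t` (`IsSolution.accel_eq`). What is left over is the commutator integral with density
`ξ_t - 2 z_t e₃`, the conjugate of `ξ_t`, which is `I₁` (`IsSolution.piTT_eq`).

For the orders of the terms, a commutator integral is estimated near the diagonal by the gradient of
`ξ_t`, which cancels one power of the singularity, and away from it by the Cauchy–Schwarz inequality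
with the `L²` norm of the gradient of the density (`norm_integral_crossIntegrand_le`). The map
`σ ↦ σ̄ = e₃ σ e₃` turns `ξ_t = 𝔥 ξ_t` into `(I + 𝔥̄) ξ̄_t = 0`, where `𝔥̄` has the kernel `cbar (K N')`,
hence `(I + 𝔥) ξ̄_t = (𝔥 - 𝔥̄) ξ̄_t`. The difference `σ - σ̄` retains only the scalar part and the `e₃`
part of `σ`, and in `K N'` these pair the vertical part of the chord with the normal, or
the chord with the horizontal part of the normal; either factor is of the size of the slope
(`IsSolution.norm_defectKernel_le`).
-/

open WaterWave

noncomputable section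

namespace WaterWave

/-! ### Algebra of the cross product and of the Clifford kernel -/

/-- The cross product as half a commutator; continuity, derivatives and norm bounds of `cross`
are read off from this form. -/
theorem cross_eq (σ τ : ℍ[ℝ]) : cross σ τ = (1 / 2 : ℝ) • (σ * τ - τ * σ) := by
  ext <;> simp <;> ring

theorem norm_cross_le (σ τ : ℍ[ℝ]) : ‖cross σ τ‖ ≤ ‖σ‖ * ‖τ‖ := by
  rw [cross_eq, norm_smul]
  have h := norm_sub_le (σ * τ) (τ * σ)
  rw [norm_mul, norm_mul] at h
  rw [Real.norm_of_nonneg (by norm_num)]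
  nlinarith

theorem cross_add_left (σ σ' τ : ℍ[ℝ]) : cross (σ + σ') τ = cross σ τ + cross σ' τ := by
  ext <;> simp <;> ring

theorem cross_sub_left (σ σ' τ : ℍ[ℝ]) : cross (σ - σ') τ = cross σ τ - cross σ' τ := by
  ext <;> simp <;> ring

theorem cross_neg_left (σ τ : ℍ[ℝ]) : cross (-σ) τ = -cross σ τ := by
  ext <;> simp <;> ring

theorem cross_sub_right (σ τ τ' : ℍ[ℝ]) : cross σ (τ - τ') = cross σ τ - cross σ τ' := by
  ext <;> simp <;> ring

theorem cross_smul_left (r : ℝ) (σ τ : ℍ[ℝ]) : cross (r • σ) τ = r • cross σ τ := by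
  ext <;> simp <;> ring

theorem cross_smul_right (r : ℝ) (σ τ : ℍ[ℝ]) : cross σ (r • τ) = r • cross σ τ := by
  ext <;> simp <;> ring

theorem HasDerivWithinAt.cross {f g : ℝ → ℍ[ℝ]} {f' g' : ℍ[ℝ]} {s : Set ℝ} {t : ℝ}
    (hf : HasDerivWithinAt f f' s t) (hg : HasDerivWithinAt g g' s t) :
    HasDerivWithinAt (fun x => cross (f x) (g x)) (cross f' (g t) + cross (f t) g') s t := by
  simp only [cross_eq]
  have := ((hf.mul hg).sub (hg.mul hf)).const_smul (1 / 2 : ℝ)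
  refine this.congr_deriv ?_
  rw [← smul_add]; congr 1; abel

theorem continuousOn_cross {Y : Type*} [TopologicalSpace Y] {f g : Y → ℍ[ℝ]} {s : Set Y}
    (hf : ContinuousOn f s) (hg : ContinuousOn g s) :
    ContinuousOn (fun x => cross (f x) (g x)) s := by
  simp only [cross_eq]; fun_prop

theorem contDiffOn_cross {Y : Type*} [NormedAddCommGroup Y] [NormedSpace ℝ Y] {n : WithTop ℕ∞}
    {f g : Y → ℍ[ℝ]} {s : Set Y} (hf : ContDiffOn ℝ n f s) (hg : ContDiffOn ℝ n g s) :
    ContDiffOn ℝ n (fun x => cross (f x) (g x)) s := by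
  simp only [cross_eq]
  exact ((hf.mul hg).sub (hg.mul hf)).const_smul _

theorem norm_sq_eq (x : ℍ[ℝ]) :
    ‖x‖ ^ 2 = x.re ^ 2 + x.imI ^ 2 + x.imJ ^ 2 + x.imK ^ 2 := by
  rw [sq, ← Quaternion.normSq_eq_norm_mul_self, Quaternion.normSq_def']

theorem abs_imI_le (x : ℍ[ℝ]) : |x.imI| ≤ ‖x‖ := by
  refine abs_le_of_sq_le_sq ?_ (norm_nonneg _)
  rw [norm_sq_eq]
  nlinarith [sq_nonneg x.re, sq_nonneg x.imJ, sq_nonneg x.imK]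

theorem abs_imJ_le (x : ℍ[ℝ]) : |x.imJ| ≤ ‖x‖ := by
  refine abs_le_of_sq_le_sq ?_ (norm_nonneg _)
  rw [norm_sq_eq]
  nlinarith [sq_nonneg x.re, sq_nonneg x.imI, sq_nonneg x.imK]

theorem abs_imK_le (x : ℍ[ℝ]) : |x.imK| ≤ ‖x‖ := by
  refine abs_le_of_sq_le_sq ?_ (norm_nonneg _)
  rw [norm_sq_eq]
  nlinarith [sq_nonneg x.re, sq_nonneg x.imI, sq_nonneg x.imJ]

theorem inner_eq (x y : ℍ[ℝ]) :
    inner ℝ x y = x.re * y.re + x.imI * y.imI + x.imJ * y.imJ + x.imK * y.imK := by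
  rw [Quaternion.inner_def]; simp

@[simp] theorem norm_e3 : ‖e3‖ = 1 := by
  have := norm_sq_eq e3
  simp only [e3_re, e3_imI, e3_imJ, e3_imK] at this
  nlinarith [norm_nonneg e3]

/-- The normalizing constant of the kernel `K`. -/
def cK : ℝ := 2 / (4 * Real.pi)

theorem cK_pos : 0 < cK := by unfold cK; positivity

theorem K_eq (x : ℍ[ℝ]) : K x = (-cK / ‖x‖ ^ 3) • x := rfl

theorem norm_K (x : ℍ[ℝ]) : ‖K x‖ = cK / ‖x‖ ^ 2 := by
  rcases eq_or_ne x 0 with rfl | hx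
  · simp [K]
  · have : ‖x‖ ≠ 0 := norm_ne_zero_iff.2 hx
    have h := cK_pos
    rw [K_eq, norm_smul, norm_div, norm_neg, norm_pow, norm_norm, Real.norm_of_nonneg h.le]
    field_simp

theorem K_neg (x : ℍ[ℝ]) : K (-x) = -K x := by simp [K]

theorem norm_K_le {x : ℍ[ℝ]} {m : ℝ} (hm : 0 < m) (h : m ≤ ‖x‖) : ‖K x‖ ≤ cK / m ^ 2 := by
  rw [norm_K]
  have := cK_pos
  gcongr

theorem K_re (x : ℍ[ℝ]) (h : x.re = 0) : (K x).re = 0 := by simp [K, h]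

/-- Away from a ball of radius `m` the kernel is Lipschitz, with constant `O(m⁻³)`; no path between
the two points is needed, so they may lie on opposite sides of the ball. -/
theorem norm_K_sub_le {x y : ℍ[ℝ]} {m : ℝ} (hm : 0 < m) (hx : m ≤ ‖x‖) (hy : m ≤ ‖y‖) :
    ‖K x - K y‖ ≤ 4 * cK / m ^ 3 * ‖x - y‖ := by
  have hx0 : 0 < ‖x‖ := hm.trans_le hx
  have hy0 : 0 < ‖y‖ := hm.trans_le hy
  have hc := cK_pos
  have e : K x - K y = -((cK / ‖x‖ ^ 3) • (x - y))
      - (cK * (1 / ‖x‖ ^ 3 - 1 / ‖y‖ ^ 3)) • y := by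
    simp only [K_eq]
    module
  have hd : |‖y‖ - ‖x‖| ≤ ‖x - y‖ := by rw [norm_sub_rev]; exact abs_norm_sub_norm_le y x
  have h1 : |1 / ‖x‖ ^ 3 - 1 / ‖y‖ ^ 3| * ‖y‖ ≤ 3 / m ^ 3 * ‖x - y‖ := by
    have e2 : 1 / ‖x‖ ^ 3 - 1 / ‖y‖ ^ 3
        = (‖y‖ - ‖x‖) * ((1 / (‖x‖ ^ 3 * ‖y‖)) + 1 / (‖x‖ ^ 2 * ‖y‖ ^ 2) + 1 / (‖x‖ * ‖y‖ ^ 3)) := by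
      field_simp
      ring
    have e3' : ((1 / (‖x‖ ^ 3 * ‖y‖)) + 1 / (‖x‖ ^ 2 * ‖y‖ ^ 2) + 1 / (‖x‖ * ‖y‖ ^ 3)) * ‖y‖
        = 1 / (‖x‖ ^ 3) + 1 / (‖x‖ ^ 2 * ‖y‖) + 1 / (‖x‖ * ‖y‖ ^ 2) := by field_simp
    rw [e2, abs_mul, abs_of_pos (show 0 < 1 / (‖x‖ ^ 3 * ‖y‖) + 1 / (‖x‖ ^ 2 * ‖y‖ ^ 2)
      + 1 / (‖x‖ * ‖y‖ ^ 3) by positivity), mul_assoc, e3', mul_comm]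
    have i1 : 1 / (‖x‖ ^ 3) ≤ 1 / m ^ 3 := by gcongr
    have i2 : 1 / (‖x‖ ^ 2 * ‖y‖) ≤ 1 / m ^ 3 := by
      rw [show m ^ 3 = m ^ 2 * m by ring]; gcongr
    have i3 : 1 / (‖x‖ * ‖y‖ ^ 2) ≤ 1 / m ^ 3 := by
      rw [show m ^ 3 = m * m ^ 2 by ring]; gcongr
    have : 3 / m ^ 3 = 1 / m ^ 3 + 1 / m ^ 3 + 1 / m ^ 3 := by ring
    rw [this]
    gcongr
  rw [e]
  refine (norm_sub_le _ _).trans ?_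
  rw [norm_neg, norm_smul, norm_smul, norm_mul, Real.norm_of_nonneg hc.le,
    Real.norm_of_nonneg (show 0 ≤ cK / ‖x‖ ^ 3 by positivity), Real.norm_eq_abs, mul_assoc cK]
  have h2 : cK / ‖x‖ ^ 3 * ‖x - y‖ ≤ cK / m ^ 3 * ‖x - y‖ := by gcongr
  have h3 := mul_le_mul_of_nonneg_left h1 hc.le
  calc _ ≤ cK / m ^ 3 * ‖x - y‖ + cK * (3 / m ^ 3 * ‖x - y‖) := by linarith
    _ = _ := by ring

/-- The derivative of the kernel `K` at `x` in the direction `h`. -/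
def DK (x h : ℍ[ℝ]) : ℍ[ℝ] :=
  (-cK / ‖x‖ ^ 3) • h + (3 * cK * inner ℝ x h / ‖x‖ ^ 5) • x

theorem norm_DK_le (x h : ℍ[ℝ]) : ‖DK x h‖ ≤ 4 * cK / ‖x‖ ^ 3 * ‖h‖ := by
  have hc := cK_pos
  rcases eq_or_ne x 0 with rfl | hx
  · simp [DK]
  have hx0 : 0 < ‖x‖ := norm_pos_iff.2 hx
  refine (norm_add_le _ _).trans ?_
  rw [norm_smul, norm_smul, norm_div, norm_div, norm_neg, Real.norm_of_nonneg hc.le, norm_mul,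
    Real.norm_of_nonneg (by positivity : 0 ≤ 3 * cK)]
  simp only [norm_pow, norm_norm]
  have := norm_inner_le_norm (𝕜 := ℝ) x h
  calc cK / ‖x‖ ^ 3 * ‖h‖ + 3 * cK * ‖inner ℝ x h‖ / ‖x‖ ^ 5 * ‖x‖
      ≤ cK / ‖x‖ ^ 3 * ‖h‖ + 3 * cK * (‖x‖ * ‖h‖) / ‖x‖ ^ 5 * ‖x‖ := by gcongr
    _ = _ := by field_simp; ring

theorem hasDerivWithinAt_norm {γ : ℝ → ℍ[ℝ]} {γ' : ℍ[ℝ]} {s : Set ℝ} {t : ℝ}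
    (h : HasDerivWithinAt γ γ' s t) (h0 : γ t ≠ 0) :
    HasDerivWithinAt (fun r => ‖γ r‖) (inner ℝ (γ t) γ' / ‖γ t‖) s t := by
  have h1 := h.norm_sq
  have h2 := h1.sqrt (pow_ne_zero 2 (norm_ne_zero_iff.2 h0))
  simp only [Real.sqrt_sq (norm_nonneg _)] at h2
  exact h2.congr_deriv (by field_simp)

theorem hasDerivWithinAt_K {γ : ℝ → ℍ[ℝ]} {γ' : ℍ[ℝ]} {s : Set ℝ} {t : ℝ}
    (h : HasDerivWithinAt γ γ' s t) (h0 : γ t ≠ 0) :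
    HasDerivWithinAt (fun r => K (γ r)) (DK (γ t) γ') s t := by
  have hn : ‖γ t‖ ≠ 0 := norm_ne_zero_iff.2 h0
  have h1 := ((hasDerivWithinAt_norm h h0).pow 3).inv (pow_ne_zero 3 hn)
  have h2 := (h1.const_mul (-cK)).smul h
  have e : (fun r => K (γ r)) = fun r => (-cK * (‖γ r‖ ^ 3)⁻¹) • γ r := by
    funext r; simp only [K_eq, div_eq_mul_inv]
  rw [e]
  refine h2.congr_deriv ?_
  simp only [DK, Pi.inv_apply, Pi.pow_apply]
  congr 1
  congr 1
  field_simp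
  push_cast
  ring

theorem continuousOn_K : ContinuousOn K {0}ᶜ := by
  intro x hx
  have : ‖x‖ ≠ 0 := norm_ne_zero_iff.2 hx
  unfold K
  exact ContinuousAt.continuousWithinAt (by fun_prop (disch := positivity))

theorem continuousOn_DK {Y : Type*} [TopologicalSpace Y] {f g : Y → ℍ[ℝ]} {s : Set Y}
    (hf : ContinuousOn f s) (hg : ContinuousOn g s) (h0 : ∀ y ∈ s, f y ≠ 0) :
    ContinuousOn (fun y => DK (f y) (g y)) s := by
  have : ∀ y ∈ s, ‖f y‖ ≠ 0 := fun y hy => norm_ne_zero_iff.2 (h0 y hy)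
  have h3 : ∀ y ∈ s, ‖f y‖ ^ 3 ≠ 0 := fun y hy => pow_ne_zero _ (this y hy)
  have h5 : ∀ y ∈ s, ‖f y‖ ^ 5 ≠ 0 := fun y hy => pow_ne_zero _ (this y hy)
  unfold DK
  exact ((continuousOn_const.div (hf.norm.pow 3) h3).smul hg).add
    (((continuousOn_const.mul (hf.inner (𝕜 := ℝ) hg)).div (hf.norm.pow 5) h5).smul hf)

/-- The algebraic identity behind all commutator formulas. It expresses that `K` is Clifford
analytic: the derivative of `K` is a symmetric trace free matrix. -/
theorem DK_cross_cyclic {x a b h : ℍ[ℝ]} (hx : x ≠ 0) (hx0 : x.re = 0) (ha : a.re = 0)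
    (hb : b.re = 0) (hh : h.re = 0) :
    DK x h * cross a b + DK x a * cross b h + DK x b * cross h a = 0 := by
  have hn : ‖x‖ ≠ 0 := norm_ne_zero_iff.2 hx
  have key : -cK / ‖x‖ ^ 3 = -cK * (x.imI ^ 2 + x.imJ ^ 2 + x.imK ^ 2) / ‖x‖ ^ 5 := by
    have := norm_sq_eq x
    rw [hx0] at this
    rw [show x.imI ^ 2 + x.imJ ^ 2 + x.imK ^ 2 = ‖x‖ ^ 2 by rw [this]; ring]
    field_simp
  simp only [DK, key, inner_eq, hx0, ha, hb, hh]
  ext <;> simp [hx0, ha, hb, hh] <;> ring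

/-- The identity that moves `N ×∇` across the kernel: `d` plays the part of the tangential
derivative of the density. -/
theorem mul_K_cross {k a b d : ℍ[ℝ]} (hk : k.re = 0) (ha : a.re = 0) (hb : b.re = 0)
    (hd : d.re = 0) :
    b * (k * cross a d) - a * (k * cross b d)
      = k * cross (cross a b) d - (2 * inner ℝ k d) • cross a b := by
  rw [inner_eq]
  ext <;> simp [hk, ha, hb, hd] <;> ring

theorem re_eq_inner (x : ℍ[ℝ]) : x.re = innerSL ℝ (1 : ℍ[ℝ]) x := by simp [inner_eq]

theorem imK_eq_inner (x : ℍ[ℝ]) : x.imK = innerSL ℝ e3 x := by simp [inner_eq]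

theorem hasDerivWithinAt_re {γ : ℝ → ℍ[ℝ]} {γ' : ℍ[ℝ]} {s : Set ℝ} {t : ℝ}
    (h : HasDerivWithinAt γ γ' s t) : HasDerivWithinAt (fun r => (γ r).re) γ'.re s t := by
  simp only [re_eq_inner]
  exact (innerSL ℝ (1 : ℍ[ℝ])).hasFDerivAt.comp_hasDerivWithinAt t h

theorem norm_cbar (σ : ℍ[ℝ]) : ‖cbar σ‖ = ‖σ‖ := by simp [cbar]

theorem e3_mul_e3 : e3 * e3 = -1 := by ext <;> simp

theorem cbar_mul_cbar (σ τ : ℍ[ℝ]) : cbar σ * cbar τ = -cbar (σ * τ) := by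
  unfold cbar
  calc e3 * σ * e3 * (e3 * τ * e3) = e3 * σ * (e3 * e3) * τ * e3 := by noncomm_ring
    _ = _ := by rw [e3_mul_e3]; noncomm_ring

/-! ### Calculus of one-parameter families of functions on the plane -/

section Calculus

variable {E : Type*} [NormedAddCommGroup E] [NormedSpace ℝ E] {a b : ℝ} {f g : ℝ → ℝ × ℝ → E}

/-- The closed slab `[a, b] × ℝ²` of parameters. -/
def slab (a b : ℝ) : Set (ℝ × (ℝ × ℝ)) := Icc a b ×ˢ univ

/-- A one-parameter family of functions on the plane, as a function on `ℝ × ℝ²`. -/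
def joint (f : ℝ → ℝ × ℝ → E) (y : ℝ × (ℝ × ℝ)) : E := f y.1 y.2

theorem uniqueDiffOn_slab (hab : a < b) : UniqueDiffOn ℝ (slab a b) :=
  (uniqueDiffOn_Icc hab).prod uniqueDiffOn_univ

theorem mem_slab {s : ℝ} (hs : s ∈ Icc a b) (q : ℝ × ℝ) : (s, q) ∈ slab a b := ⟨hs, mem_univ _⟩

/-- The joint derivative of a family on the slab. -/
def jointDeriv (a b : ℝ) (f : ℝ → ℝ × ℝ → E) (y : ℝ × (ℝ × ℝ)) : ℝ × (ℝ × ℝ) →L[ℝ] E :=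
  fderivWithin ℝ (joint f) (slab a b) y

theorem hasFDerivWithinAt_joint (hf : ContDiffOn ℝ 1 (joint f) (slab a b)) {s : ℝ}
    (hs : s ∈ Icc a b) (q : ℝ × ℝ) :
    HasFDerivWithinAt (joint f) (jointDeriv a b f (s, q)) (slab a b) (s, q) :=
  ((hf.differentiableOn one_ne_zero) _ (mem_slab hs q)).hasFDerivWithinAt

theorem continuousOn_jointDeriv (hab : a < b) (hf : ContDiffOn ℝ 1 (joint f) (slab a b)) :
    ContinuousOn (jointDeriv a b f) (slab a b) :=
  hf.continuousOn_fderivWithin (uniqueDiffOn_slab hab) le_rfl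

theorem hasFDerivAt_slice (hf : ContDiffOn ℝ 1 (joint f) (slab a b)) {s : ℝ}
    (hs : s ∈ Icc a b) (q : ℝ × ℝ) :
    HasFDerivAt (f s) ((jointDeriv a b f (s, q)).comp (ContinuousLinearMap.inr ℝ ℝ (ℝ × ℝ))) q := by
  have h1 : HasFDerivWithinAt (fun q : ℝ × ℝ => (s, q))
      (ContinuousLinearMap.inr ℝ ℝ (ℝ × ℝ)) univ q := (hasFDerivAt_prodMk_right s q).hasFDerivWithinAt
  have := (hasFDerivWithinAt_joint hf hs q).comp q h1 (fun q _ => mem_slab hs q)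
  exact hasFDerivWithinAt_univ.1 this

theorem HasFDerivAt.hasDerivAt_α {g : ℝ × ℝ → E} {g' : ℝ × ℝ →L[ℝ] E} {q : ℝ × ℝ}
    (h : HasFDerivAt g g' q) : HasDerivAt (fun r => g (r, q.2)) (g' (1, 0)) q.1 := by
  have h1 : HasDerivAt (fun r : ℝ => (r, q.2)) ((1 : ℝ), (0 : ℝ)) q.1 :=
    (hasDerivAt_id q.1).prodMk (hasDerivAt_const q.1 q.2)
  exact HasFDerivAt.comp_hasDerivAt (f := fun r : ℝ => (r, q.2)) q.1 h h1

theorem HasFDerivAt.hasDerivAt_β {g : ℝ × ℝ → E} {g' : ℝ × ℝ →L[ℝ] E} {q : ℝ × ℝ}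
    (h : HasFDerivAt g g' q) : HasDerivAt (fun r => g (q.1, r)) (g' (0, 1)) q.2 := by
  have h1 : HasDerivAt (fun r : ℝ => (q.1, r)) ((0 : ℝ), (1 : ℝ)) q.2 :=
    (hasDerivAt_const q.2 q.1).prodMk (hasDerivAt_id q.2)
  exact HasFDerivAt.comp_hasDerivAt (f := fun r : ℝ => (q.1, r)) q.2 h h1

theorem HasFDerivAt.dα_eq {g : ℝ × ℝ → E} {g' : ℝ × ℝ →L[ℝ] E} {q : ℝ × ℝ}
    (h : HasFDerivAt g g' q) : dα g q = g' (1, 0) := h.hasDerivAt_α.deriv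

theorem HasFDerivAt.dβ_eq {g : ℝ × ℝ → E} {g' : ℝ × ℝ →L[ℝ] E} {q : ℝ × ℝ}
    (h : HasFDerivAt g g' q) : dβ g q = g' (0, 1) := h.hasDerivAt_β.deriv

theorem _root_.DifferentiableAt.hasDerivAt_dα {g : ℝ × ℝ → E} {q : ℝ × ℝ}
    (h : DifferentiableAt ℝ g q) : HasDerivAt (fun r => g (r, q.2)) (dα g q) q.1 := by
  rw [h.hasFDerivAt.dα_eq]; exact h.hasFDerivAt.hasDerivAt_α

theorem _root_.DifferentiableAt.hasDerivAt_dβ {g : ℝ × ℝ → E} {q : ℝ × ℝ}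
    (h : DifferentiableAt ℝ g q) : HasDerivAt (fun r => g (q.1, r)) (dβ g q) q.2 := by
  rw [h.hasFDerivAt.dβ_eq]; exact h.hasFDerivAt.hasDerivAt_β

theorem differentiable_slice (hf : ContDiffOn ℝ 1 (joint f) (slab a b)) {s : ℝ}
    (hs : s ∈ Icc a b) : Differentiable ℝ (f s) :=
  fun q => (hasFDerivAt_slice hf hs q).differentiableAt

theorem contDiff_slice {n : WithTop ℕ∞} (hf : ContDiffOn ℝ n (joint f) (slab a b)) {s : ℝ}
    (hs : s ∈ Icc a b) : ContDiff ℝ n (f s) := by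
  rw [← contDiffOn_univ]
  exact hf.comp (f := fun q : ℝ × ℝ => (s, q)) (by fun_prop) (fun q _ => mem_slab hs q)

theorem dα_eq_jointDeriv (hf : ContDiffOn ℝ 1 (joint f) (slab a b)) {s : ℝ}
    (hs : s ∈ Icc a b) (q : ℝ × ℝ) : dα (f s) q = jointDeriv a b f (s, q) (0, (1, 0)) := by
  rw [(hasFDerivAt_slice hf hs q).dα_eq]; rfl

theorem dβ_eq_jointDeriv (hf : ContDiffOn ℝ 1 (joint f) (slab a b)) {s : ℝ}
    (hs : s ∈ Icc a b) (q : ℝ × ℝ) : dβ (f s) q = jointDeriv a b f (s, q) (0, (0, 1)) := by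
  rw [(hasFDerivAt_slice hf hs q).dβ_eq]; rfl

theorem continuousOn_dα (hab : a < b) (hf : ContDiffOn ℝ 1 (joint f) (slab a b)) :
    ContinuousOn (joint fun s => dα (f s)) (slab a b) :=
  ((continuousOn_jointDeriv hab hf).clm_apply continuousOn_const).congr
    fun y hy => dα_eq_jointDeriv hf hy.1 y.2

theorem continuousOn_dβ (hab : a < b) (hf : ContDiffOn ℝ 1 (joint f) (slab a b)) :
    ContinuousOn (joint fun s => dβ (f s)) (slab a b) :=
  ((continuousOn_jointDeriv hab hf).clm_apply continuousOn_const).congr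
    fun y hy => dβ_eq_jointDeriv hf hy.1 y.2

theorem contDiffOn_jointDeriv (hab : a < b) (hf : ContDiffOn ℝ 2 (joint f) (slab a b)) :
    ContDiffOn ℝ 1 (jointDeriv a b f) (slab a b) :=
  hf.fderivWithin (uniqueDiffOn_slab hab) (by norm_num)

theorem contDiffOn_dα (hab : a < b) (hf : ContDiffOn ℝ 2 (joint f) (slab a b)) :
    ContDiffOn ℝ 1 (joint fun s => dα (f s)) (slab a b) :=
  ((contDiffOn_jointDeriv hab hf).clm_apply contDiffOn_const).congr
    fun y hy => dα_eq_jointDeriv (hf.of_le one_le_two) hy.1 y.2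

theorem contDiffOn_dβ (hab : a < b) (hf : ContDiffOn ℝ 2 (joint f) (slab a b)) :
    ContDiffOn ℝ 1 (joint fun s => dβ (f s)) (slab a b) :=
  ((contDiffOn_jointDeriv hab hf).clm_apply contDiffOn_const).congr
    fun y hy => dβ_eq_jointDeriv (hf.of_le one_le_two) hy.1 y.2

theorem hasDerivWithinAt_jointDeriv (hf : ContDiffOn ℝ 1 (joint f) (slab a b)) {s : ℝ}
    (hs : s ∈ Icc a b) (q : ℝ × ℝ) :
    HasDerivWithinAt (fun r => f r q) (jointDeriv a b f (s, q) (1, 0)) (Icc a b) s := by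
  have h1 : HasDerivWithinAt (fun r : ℝ => (r, q)) ((1 : ℝ), (0 : ℝ × ℝ)) (Icc a b) s :=
    (hasDerivWithinAt_id s _).prodMk (hasDerivWithinAt_const s _ q)
  exact (hasFDerivWithinAt_joint hf hs q).comp_hasDerivWithinAt (f := fun r : ℝ => (r, q)) s h1
    (fun r hr => mem_slab hr q)

theorem jointDeriv_one_zero (hab : a < b) (hf : ContDiffOn ℝ 1 (joint f) (slab a b))
    (hg : ∀ s ∈ Icc a b, ∀ q, HasDerivWithinAt (fun r => f r q) (g s q) (Icc a b) s) {s : ℝ}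
    (hs : s ∈ Icc a b) (q : ℝ × ℝ) : g s q = jointDeriv a b f (s, q) (1, 0) :=
  (uniqueDiffOn_Icc hab s hs).eq_deriv _ (hg s hs q) (hasDerivWithinAt_jointDeriv hf hs q)

theorem contDiffOn_paramDeriv (hab : a < b) (hf : ContDiffOn ℝ 2 (joint f) (slab a b))
    (hg : ∀ s ∈ Icc a b, ∀ q, HasDerivWithinAt (fun r => f r q) (g s q) (Icc a b) s) :
    ContDiffOn ℝ 1 (joint g) (slab a b) :=
  ((contDiffOn_jointDeriv hab hf).clm_apply contDiffOn_const).congr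
    fun y hy => jointDeriv_one_zero hab (hf.of_le one_le_two) hg hy.1 y.2

theorem isSymmSndFDerivWithinAt_joint (hab : a < b) (hf : ContDiffOn ℝ 2 (joint f) (slab a b))
    {s : ℝ} (hs : s ∈ Icc a b) (q : ℝ × ℝ) :
    IsSymmSndFDerivWithinAt ℝ (joint f) (slab a b) (s, q) := by
  refine (hf _ (mem_slab hs q)).isSymmSndFDerivWithinAt (by simp) (uniqueDiffOn_slab hab) ?_
    (mem_slab hs q)
  rw [slab, interior_prod_eq, closure_prod_eq, interior_Icc, closure_Ioo hab.ne]
  simpa using hs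

theorem hasDerivWithinAt_dα (hab : a < b) (hf : ContDiffOn ℝ 2 (joint f) (slab a b))
    (hg : ∀ s ∈ Icc a b, ∀ q, HasDerivWithinAt (fun r => f r q) (g s q) (Icc a b) s)
    {s : ℝ} (hs : s ∈ Icc a b) (q : ℝ × ℝ) :
    HasDerivWithinAt (fun r => dα (f r) q) (dα (g s) q) (Icc a b) s := by
  have h1 := hf.of_le one_le_two
  have hD := contDiffOn_jointDeriv hab hf
  have hFD : HasFDerivWithinAt (jointDeriv a b f)
      (fderivWithin ℝ (jointDeriv a b f) (slab a b) (s, q)) (slab a b) (s, q) :=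
    ((hD.differentiableOn one_ne_zero) _ (mem_slab hs q)).hasFDerivWithinAt
  have hs1 : HasDerivWithinAt (fun r : ℝ => (r, q)) ((1 : ℝ), (0 : ℝ × ℝ)) (Icc a b) s :=
    (hasDerivWithinAt_id s _).prodMk (hasDerivWithinAt_const s _ q)
  have h2 := hFD.comp_hasDerivWithinAt (f := fun r : ℝ => (r, q)) s hs1 (fun r hr => mem_slab hr q)
  have h3 := h2.clm_apply (hasDerivWithinAt_const s (Icc a b) ((0 : ℝ), ((1 : ℝ), (0 : ℝ))))
  simp only [map_zero, add_zero, Function.comp_def] at h3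
  have h4 : HasFDerivWithinAt (joint g)
      ((fderivWithin ℝ (jointDeriv a b f) (slab a b) (s, q)).flip (1, 0)) (slab a b) (s, q) := by
    have := hFD.clm_apply (hasFDerivWithinAt_const ((1 : ℝ), (0 : ℝ × ℝ)) (s, q) (slab a b))
    simp only [ContinuousLinearMap.comp_zero, zero_add] at this
    exact this.congr (fun y hy => jointDeriv_one_zero hab h1 hg hy.1 y.2)
      (jointDeriv_one_zero hab h1 hg hs q)
  have h5 : dα (g s) q
      = fderivWithin ℝ (jointDeriv a b f) (slab a b) (s, q) (1, 0) (0, (1, 0)) := by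
    have hg1 := contDiffOn_paramDeriv hab hf hg
    rw [dα_eq_jointDeriv hg1 hs q, jointDeriv, h4.fderivWithin (uniqueDiffOn_slab hab _ (mem_slab hs q))]
    rw [ContinuousLinearMap.flip_apply]
    exact (isSymmSndFDerivWithinAt_joint hab hf hs q) _ _
  rw [h5]
  exact h3.congr (fun r hr => dα_eq_jointDeriv h1 hr q) (dα_eq_jointDeriv h1 hs q)

theorem hasDerivWithinAt_dβ (hab : a < b) (hf : ContDiffOn ℝ 2 (joint f) (slab a b))
    (hg : ∀ s ∈ Icc a b, ∀ q, HasDerivWithinAt (fun r => f r q) (g s q) (Icc a b) s)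
    {s : ℝ} (hs : s ∈ Icc a b) (q : ℝ × ℝ) :
    HasDerivWithinAt (fun r => dβ (f r) q) (dβ (g s) q) (Icc a b) s := by
  -- the coordinate swap reduces the claim to the one for `∂_α`
  have hsw : ContDiffOn ℝ 2 (joint fun s q => f s q.swap) (slab a b) :=
    hf.comp (f := fun y : ℝ × (ℝ × ℝ) => (y.1, (y.2.2, y.2.1))) (by fun_prop)
      (fun y hy => mem_slab hy.1 _)
  exact hasDerivWithinAt_dα (f := fun s q => f s q.swap) (g := fun s q => g s q.swap) hab hsw
    (fun s hs q => hg s hs q.swap) hs q.swap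

theorem dα_dβ_comm {g : ℝ × ℝ → E} (hg : ContDiff ℝ 2 g) (q : ℝ × ℝ) :
    dα (dβ g) q = dβ (dα g) q := by
  have hd : Differentiable ℝ g := hg.differentiable two_ne_zero
  have hD : ContDiff ℝ 1 (fderiv ℝ g) := hg.fderiv_right (by norm_num)
  have h2 : HasFDerivAt (fderiv ℝ g) (fderiv ℝ (fderiv ℝ g) q) q :=
    (hD.differentiable one_ne_zero q).hasFDerivAt
  have ea : dα g = fun q => fderiv ℝ g q (1, 0) := funext fun q => (hd q).hasFDerivAt.dα_eq
  have eb : dβ g = fun q => fderiv ℝ g q (0, 1) := funext fun q => (hd q).hasFDerivAt.dβ_eq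
  have ha := h2.clm_apply (hasFDerivAt_const ((1 : ℝ), (0 : ℝ)) q)
  have hb := h2.clm_apply (hasFDerivAt_const ((0 : ℝ), (1 : ℝ)) q)
  rw [ea, eb, ha.dβ_eq, hb.dα_eq]
  simp only [ContinuousLinearMap.comp_zero, zero_add, ContinuousLinearMap.flip_apply]
  exact (hg.contDiffAt.isSymmSndFDerivAt (by simp)) _ _

end Calculus

section LocalBounds

theorem exists_bound_of_continuousOn {F : Type*} [NormedAddCommGroup F] {a b : ℝ}
    {f : ℝ → ℝ × ℝ → F} (hf : ContinuousOn (joint f) (slab a b)) (R : ℝ) :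
    ∃ A, 0 ≤ A ∧ ∀ s ∈ Icc a b, ∀ h : ℝ × ℝ, ‖h‖ ≤ R → ‖f s h‖ ≤ A := by
  have hc : IsCompact (Icc a b ×ˢ Metric.closedBall (0 : ℝ × ℝ) R) :=
    isCompact_Icc.prod (isCompact_closedBall _ _)
  obtain ⟨A, hA⟩ := hc.exists_bound_of_continuousOn
    (hf.mono (prod_mono_right (subset_univ _)))
  refine ⟨max A 0, le_max_right _ _, fun s hs h hh => ?_⟩
  exact (hA (s, h) ⟨hs, by simpa using hh⟩).trans (le_max_left _ _)

variable {E : Type*} [NormedAddCommGroup E] [NormedSpace ℝ E] {a b : ℝ} {f : ℝ → ℝ × ℝ → E}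

theorem exists_lipschitz (hab : a < b) (hf : ContDiffOn ℝ 1 (joint f) (slab a b)) :
    ∃ A, 0 ≤ A ∧ ∀ s ∈ Icc a b, ∀ h h' : ℝ × ℝ, ‖h‖ ≤ 1 → ‖h'‖ ≤ 1 →
      ‖f s h - f s h'‖ ≤ A * ‖h - h'‖ := by
  obtain ⟨A, hA0, hA⟩ := exists_bound_of_continuousOn
    (f := fun s q => (jointDeriv a b f (s, q)).comp (ContinuousLinearMap.inr ℝ ℝ (ℝ × ℝ)))
    ((continuousOn_jointDeriv hab hf).clm_comp continuousOn_const) 1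
  refine ⟨A, hA0, fun s hs h h' hh hh' => ?_⟩
  refine (convex_closedBall (0 : ℝ × ℝ) 1).norm_image_sub_le_of_norm_hasFDerivWithin_le
    (fun q _ => (hasFDerivAt_slice hf hs q).hasFDerivWithinAt)
    (fun q hq => hA s hs q (by simpa using hq)) ?_ ?_ <;> simpa

/-- The second difference is controlled by the oscillation of the derivative along the segment. -/
theorem norm_second_diff_le {g : ℝ × ℝ → E} (hg : Differentiable ℝ g) {h : ℝ × ℝ} {c : ℝ}
    (hc : ∀ r ∈ Icc (0 : ℝ) 1, ‖fderiv ℝ g (r • h) - fderiv ℝ g (-(r • h))‖ ≤ c) :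
    ‖g h + g (-h) - (2 : ℝ) • g 0‖ ≤ c * ‖h‖ := by
  have hd : ∀ r : ℝ, HasDerivAt (fun r : ℝ => g (r • h) + g (-(r • h)))
      ((fderiv ℝ g (r • h) - fderiv ℝ g (-(r • h))) h) r := by
    intro r
    have h1 : HasDerivAt (fun r : ℝ => r • h) h r := by
      simpa using (hasDerivAt_id r).smul_const h
    have h2 := (hg (r • h)).hasFDerivAt.comp_hasDerivAt r h1
    have h3 := (hg (-(r • h))).hasFDerivAt.comp_hasDerivAt (f := fun r : ℝ => -(r • h)) r h1.neg
    exact (h2.add h3).congr_deriv (by simp [sub_eq_add_neg])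
  have := (convex_Icc (0 : ℝ) 1).norm_image_sub_le_of_norm_hasDerivWithin_le
    (f := fun r : ℝ => g (r • h) + g (-(r • h))) (x := 0) (y := 1) (C := c * ‖h‖)
    (fun r _ => (hd r).hasDerivWithinAt)
    (fun r hr => (ContinuousLinearMap.le_opNorm _ _).trans (by gcongr; exact hc r hr))
    (by simp) (by simp)
  simpa [two_smul] using this

theorem fderiv_slice (hf : ContDiffOn ℝ 1 (joint f) (slab a b)) {s : ℝ}
    (hs : s ∈ Icc a b) (q : ℝ × ℝ) : fderiv ℝ (f s) q
      = (jointDeriv a b f (s, q)).comp (ContinuousLinearMap.inr ℝ ℝ (ℝ × ℝ)) :=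
  (hasFDerivAt_slice hf hs q).fderiv

theorem norm_inr_le : ‖ContinuousLinearMap.inr ℝ ℝ (ℝ × ℝ)‖ ≤ 1 :=
  ContinuousLinearMap.opNorm_le_bound _ zero_le_one fun x => by simp

theorem norm_fderiv_slice_sub_le (hf : ContDiffOn ℝ 1 (joint f) (slab a b)) {s : ℝ}
    (hs : s ∈ Icc a b) (q q' : ℝ × ℝ) : ‖fderiv ℝ (f s) q - fderiv ℝ (f s) q'‖
      ≤ ‖jointDeriv a b f (s, q) - jointDeriv a b f (s, q')‖ := by
  rw [fderiv_slice hf hs, fderiv_slice hf hs, ← ContinuousLinearMap.sub_comp]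
  refine (ContinuousLinearMap.opNorm_comp_le _ _).trans ?_
  exact mul_le_of_le_one_right (norm_nonneg _) norm_inr_le

theorem norm_smul_le_of_mem_Icc {r : ℝ} (hr : r ∈ Icc (0 : ℝ) 1) (h : ℝ × ℝ) : ‖r • h‖ ≤ ‖h‖ := by
  rw [norm_smul, Real.norm_of_nonneg hr.1]
  exact mul_le_of_le_one_left (norm_nonneg _) hr.2

theorem exists_second_diff_le (hab : a < b) (hf : ContDiffOn ℝ 2 (joint f) (slab a b)) :
    ∃ A, 0 ≤ A ∧ ∀ s ∈ Icc a b, ∀ h : ℝ × ℝ, ‖h‖ ≤ 1 →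
      ‖f s h + f s (-h) - (2 : ℝ) • f s 0‖ ≤ A * ‖h‖ ^ 2 := by
  have h1 := hf.of_le one_le_two
  obtain ⟨A, hA0, hA⟩ := exists_lipschitz (f := fun s q => jointDeriv a b f (s, q)) hab
    (contDiffOn_jointDeriv hab hf)
  refine ⟨2 * A, by positivity, fun s hs h hh => ?_⟩
  have := norm_second_diff_le (differentiable_slice h1 hs) (h := h) (c := 2 * A * ‖h‖) ?_
  · exact this.trans_eq (by ring)
  intro r hr
  have hrh := norm_smul_le_of_mem_Icc hr h
  refine (norm_fderiv_slice_sub_le h1 hs _ _).trans ((hA s hs _ _ (hrh.trans hh)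
    (by rw [norm_neg]; exact hrh.trans hh)).trans ?_)
  have : ‖r • h - -(r • h)‖ ≤ 2 * ‖h‖ := by
    refine (norm_sub_le _ _).trans ?_
    rw [norm_neg]; linarith
  calc _ ≤ A * (2 * ‖h‖) := by gcongr
    _ = _ := by ring

theorem exists_second_diff_le_eps (hab : a < b) (hf : ContDiffOn ℝ 1 (joint f) (slab a b)) {ε : ℝ}
    (hε : 0 < ε) :
    ∃ δ, 0 < δ ∧ ∀ s ∈ Icc a b, ∀ h : ℝ × ℝ, ‖h‖ ≤ δ →
      ‖f s h + f s (-h) - (2 : ℝ) • f s 0‖ ≤ ε * ‖h‖ := by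
  have hc : IsCompact (Icc a b ×ˢ Metric.closedBall (0 : ℝ × ℝ) 1) :=
    isCompact_Icc.prod (isCompact_closedBall _ _)
  have hu := hc.uniformContinuousOn_of_continuous
    ((continuousOn_jointDeriv hab hf).mono (prod_mono_right (subset_univ _)))
  obtain ⟨δ, hδ, H⟩ := Metric.uniformContinuousOn_iff.1 hu ε hε
  refine ⟨min 1 (δ / 3), by positivity, fun s hs h hh => ?_⟩
  refine norm_second_diff_le (differentiable_slice hf hs) fun r hr => ?_
  have hrh := (norm_smul_le_of_mem_Icc hr h).trans hh
  refine (norm_fderiv_slice_sub_le hf hs _ _).trans ?_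
  rw [← dist_eq_norm]
  refine (H (s, r • h) ⟨hs, ?_⟩ (s, -(r • h)) ⟨hs, ?_⟩ ?_).le
  · simpa using hrh.trans (min_le_left _ _)
  · simpa using hrh.trans (min_le_left _ _)
  · have : dist (r • h) (-(r • h)) ≤ 2 * (δ / 3) := by
      rw [dist_eq_norm]
      refine (norm_sub_le _ _).trans ?_
      rw [norm_neg]
      linarith [hrh.trans (min_le_right _ _)]
    simp only [Prod.dist_eq, dist_self] at this ⊢
    refine lt_of_le_of_lt (max_le (by positivity) this) (by linarith)

end LocalBounds

/-! ### Radial integrals and uniform smallness at infinity -/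

section Radial

theorem integrable_radial_iff {f : ℝ → ℝ} :
    Integrable (fun h : ℝ × ℝ => f ‖h‖) ↔ IntegrableOn (fun y => y * f y) (Ioi 0) := by
  have := integrable_fun_norm_addHaar (volume : Measure (ℝ × ℝ)) (f := f)
  simpa using this

theorem measurableSet_lt_norm (ρ : ℝ) : MeasurableSet {h : ℝ × ℝ | ρ < ‖h‖} :=
  measurableSet_lt measurable_const measurable_norm

theorem measurableSet_norm_le (ρ : ℝ) : MeasurableSet {h : ℝ × ℝ | ‖h‖ ≤ ρ} :=
  measurableSet_le measurable_norm measurable_const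

theorem integrableOn_inv_norm : IntegrableOn (fun h : ℝ × ℝ => ‖h‖⁻¹) {h | ‖h‖ ≤ 1} := by
  rw [← integrable_indicator_iff (measurableSet_norm_le 1)]
  have : ({h : ℝ × ℝ | ‖h‖ ≤ 1}.indicator fun h : ℝ × ℝ => ‖h‖⁻¹)
      = fun h => (Iic (1 : ℝ)).indicator (fun y => y⁻¹) ‖h‖ := by
    funext h; simp [indicator]
  rw [this, integrable_radial_iff]
  have h1 : IntegrableOn (fun _ : ℝ => (1 : ℝ)) (Ioc 0 1) := by simp
  have h2 : IntegrableOn ((Ioc (0 : ℝ) 1).indicator fun _ : ℝ => (1 : ℝ)) (Ioi 0) :=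
    ((integrable_indicator_iff measurableSet_Ioc).2 h1).integrableOn
  refine h2.congr_fun (fun y hy => ?_) measurableSet_Ioi
  have hy0 : (y : ℝ) ≠ 0 := (mem_Ioi.1 hy).ne'
  by_cases h : y ≤ 1
  · simp [indicator, h, mem_Ioi.1 hy, hy0]
  · simp [indicator, h]

theorem integrableOn_rpow_norm {r ρ : ℝ} (hr : r < -2) (hρ : 0 < ρ) :
    IntegrableOn (fun h : ℝ × ℝ => ‖h‖ ^ r) {h | ρ < ‖h‖} := by
  rw [← integrable_indicator_iff (measurableSet_lt_norm ρ)]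
  have : ({h : ℝ × ℝ | ρ < ‖h‖}.indicator fun h : ℝ × ℝ => ‖h‖ ^ r)
      = fun h => (Ioi ρ).indicator (fun y => y ^ r) ‖h‖ := by
    funext h; simp [indicator]
  rw [this, integrable_radial_iff]
  have h1 : IntegrableOn (fun y : ℝ => y ^ (r + 1)) (Ioi ρ) :=
    integrableOn_Ioi_rpow_of_lt (by linarith) hρ
  have h2 : IntegrableOn ((Ioi ρ).indicator fun y : ℝ => y ^ (r + 1)) (Ioi 0) :=
    ((integrable_indicator_iff measurableSet_Ioi).2 h1).integrableOn
  refine h2.congr_fun (fun y hy => ?_) measurableSet_Ioi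
  by_cases h : ρ < y
  · simp [indicator, h, Real.rpow_add_one (mem_Ioi.1 hy).ne', mul_comm]
  · simp [indicator, h]

theorem integrableOn_inv_norm_pow {k : ℕ} (hk : 3 ≤ k) {ρ : ℝ} (hρ : 0 < ρ) :
    IntegrableOn (fun h : ℝ × ℝ => (‖h‖ ^ k)⁻¹) {h | ρ < ‖h‖} := by
  have : (-(k : ℝ)) < -2 := by
    have : (3 : ℝ) ≤ k := by exact_mod_cast hk
    linarith
  refine (integrableOn_rpow_norm this hρ).congr_fun (fun h _ => ?_) (measurableSet_lt_norm ρ)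
  simp only [Real.rpow_neg (norm_nonneg h), Real.rpow_natCast]

theorem exists_small_ball {ε : ℝ} (hε : 0 < ε) :
    ∃ δ, 0 < δ ∧ δ ≤ 1 ∧ ∀ r ≤ δ, ∫ h in {h : ℝ × ℝ | ‖h‖ ≤ r}, ‖h‖⁻¹ ≤ ε := by
  have ht := tendsto_setIntegral_of_antitone (μ := volume)
    (s := fun n : ℕ => {h : ℝ × ℝ | ‖h‖ ≤ 1 / ((n : ℝ) + 1)}) (f := fun h : ℝ × ℝ => ‖h‖⁻¹)
    (fun n => measurableSet_norm_le _)
    (fun m n hmn h hh => le_trans (mem_ofPred_eq ▸ hh)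
      (one_div_le_one_div_of_le (by positivity) (by simpa using hmn))) ⟨0, by simpa using integrableOn_inv_norm⟩
  have h0 : ∫ h in ⋂ n : ℕ, {h : ℝ × ℝ | ‖h‖ ≤ 1 / ((n : ℝ) + 1)}, ‖h‖⁻¹ = 0 := by
    rw [setIntegral_eq_zero_of_forall_eq_zero]
    intro h hh
    have : ‖h‖ ≤ 0 := ge_of_tendsto' tendsto_one_div_add_atTop_nhds_zero_nat
      fun n => by simpa using mem_iInter.1 hh n
    simp [norm_le_zero_iff.1 this]
  rw [h0] at ht
  obtain ⟨n, hn⟩ := ((tendsto_order.1 ht).2 ε hε).exists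
  have hle : 1 / ((n : ℝ) + 1) ≤ 1 := by
    rw [div_le_one (by positivity)]; linarith [n.cast_nonneg (α := ℝ)]
  refine ⟨1 / ((n : ℝ) + 1), by positivity, hle, fun r hr => (le_trans ?_ hn.le)⟩
  refine setIntegral_mono_set (integrableOn_inv_norm.mono_set fun h hh => le_trans hh hle)
    (ae_of_all _ fun h => by positivity) (Eventually.of_forall fun h hh => le_trans hh hr)

variable {E : Type*} [NormedAddCommGroup E] {S : Type*} {I : Set S}

theorem exists_small_tail {g : ℝ × ℝ → E} (hg : ∀ ρ > 0, IntegrableOn g {h | ρ < ‖h‖}) {ε : ℝ}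
    (hε : 0 < ε) : ∃ R, 0 < R ∧ ∫ h in {h : ℝ × ℝ | R < ‖h‖}, ‖g h‖ ≤ ε := by
  have ht := tendsto_setIntegral_of_antitone (μ := volume)
    (s := fun n : ℕ => {h : ℝ × ℝ | (n : ℝ) + 1 < ‖h‖}) (f := fun h : ℝ × ℝ => ‖g h‖)
    (fun n => measurableSet_lt_norm _)
    (fun m n hmn h hh => lt_of_le_of_lt (by simpa using hmn) (mem_ofPred_eq ▸ hh))
    ⟨0, by simpa [IntegrableOn] using (hg 1 one_pos).norm⟩
  have h0 : ⋂ n : ℕ, {h : ℝ × ℝ | (n : ℝ) + 1 < ‖h‖} = ∅ := by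
    refine eq_empty_of_forall_notMem fun h hh => ?_
    obtain ⟨n, hn⟩ := exists_nat_gt ‖h‖
    have := mem_iInter.1 hh n
    simp only [mem_ofPred_eq] at this
    linarith
  rw [h0, setIntegral_empty] at ht
  obtain ⟨n, hn⟩ := ((tendsto_order.1 ht).2 ε hε).exists
  exact ⟨n + 1, by positivity, hn.le⟩

/-- The functions `Φ s`, `s ∈ I`, are integrable off every ball about the origin, and their
integrals at infinity are uniformly small. -/
structure UnifTail (I : Set S) (Φ : S → ℝ × ℝ → E) : Prop where
  integrableOn : ∀ s ∈ I, ∀ ρ > 0, IntegrableOn (Φ s) {h | ρ < ‖h‖}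
  tail : ∀ ε > 0, ∃ R, 0 < R ∧ ∀ s ∈ I, ∫ h in {h : ℝ × ℝ | R < ‖h‖}, ‖Φ s h‖ ≤ ε

theorem UnifTail.tail' {Φ : S → ℝ × ℝ → E} (h : UnifTail I Φ) {ε : ℝ} (hε : 0 < ε) :
    ∃ R, 0 < R ∧ ∀ R' ≥ R, ∀ s ∈ I, ∫ h in {h : ℝ × ℝ | R' < ‖h‖}, ‖Φ s h‖ ≤ ε := by
  obtain ⟨R, hR, H⟩ := h.tail ε hε
  refine ⟨R, hR, fun R' hR' s hs => (le_trans ?_ (H s hs))⟩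
  exact setIntegral_mono_set (h.integrableOn s hs R hR).norm (ae_of_all _ fun h => norm_nonneg _)
    (Eventually.of_forall fun h hh => lt_of_le_of_lt hR' hh)

theorem UnifTail.const {g : ℝ × ℝ → E} (hg : ∀ ρ > 0, IntegrableOn g {h | ρ < ‖h‖}) :
    UnifTail I (fun _ : S => g) :=
  ⟨fun _ _ => hg, fun _ hε => (exists_small_tail hg hε).imp fun _ h => ⟨h.1, fun _ _ => h.2⟩⟩

theorem lt_norm_subset {ρ : ℝ} (hρ : 0 < ρ) : {h : ℝ × ℝ | ρ < ‖h‖} ⊆ {0}ᶜ :=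
  fun _ hh => norm_pos_iff.1 (hρ.trans hh)

theorem UnifTail.mono {Φ : S → ℝ × ℝ → E} {m : S → ℝ × ℝ → ℝ} (hm : UnifTail I m)
    (hc : ∀ s ∈ I, ContinuousOn (Φ s) {0}ᶜ) (hle : ∀ s ∈ I, ∀ h ≠ 0, ‖Φ s h‖ ≤ m s h) :
    UnifTail I Φ := by
  have hi : ∀ s ∈ I, ∀ ρ > 0, IntegrableOn (Φ s) {h | ρ < ‖h‖} := by
    intro s hs ρ hρ
    refine Integrable.mono' (hm.integrableOn s hs ρ hρ)
      (((hc s hs).mono (lt_norm_subset hρ)).aestronglyMeasurable (measurableSet_lt_norm ρ)) ?_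
    exact (ae_restrict_iff' (measurableSet_lt_norm ρ)).2
      (ae_of_all _ fun h hh => hle s hs h (lt_norm_subset hρ hh))
  refine ⟨hi, fun ε hε => ?_⟩
  obtain ⟨R, hR, H⟩ := hm.tail ε hε
  refine ⟨R, hR, fun s hs => le_trans ?_ (H s hs)⟩
  refine setIntegral_mono_on (hi s hs R hR).norm (hm.integrableOn s hs R hR).norm
    (measurableSet_lt_norm R) fun h hh => ?_
  exact (hle s hs h (lt_norm_subset hR hh)).trans (le_abs_self _)

theorem UnifTail.add {Φ Ψ : S → ℝ × ℝ → E} (hΦ : UnifTail I Φ) (hΨ : UnifTail I Ψ) :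
    UnifTail I (fun s h => Φ s h + Ψ s h) := by
  refine ⟨fun s hs ρ hρ => (hΦ.integrableOn s hs ρ hρ).add (hΨ.integrableOn s hs ρ hρ),
    fun ε hε => ?_⟩
  obtain ⟨R, hR, H⟩ := hΦ.tail' (half_pos hε)
  obtain ⟨R', _, H'⟩ := hΨ.tail' (half_pos hε)
  have hm : 0 < max R R' := hR.trans_le (le_max_left _ _)
  refine ⟨max R R', hm, fun s hs => ?_⟩
  have i1 := (hΦ.integrableOn s hs _ hm).norm
  have i2 := (hΨ.integrableOn s hs _ hm).norm
  have := integral_mono ((hΦ.integrableOn s hs _ hm).add (hΨ.integrableOn s hs _ hm)).norm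
    (i1.add i2) (fun h => norm_add_le (Φ s h) (Ψ s h))
  refine this.trans ?_
  simp only [Pi.add_apply]
  rw [integral_add i1 i2]
  linarith [H _ (le_max_left R R') s hs, H' _ (le_max_right R R') s hs]

theorem UnifTail.const_mul {m : S → ℝ × ℝ → ℝ} (hm : UnifTail I m) (c : ℝ) :
    UnifTail I (fun s h => c * m s h) := by
  refine ⟨fun s hs ρ hρ => (hm.integrableOn s hs ρ hρ).const_mul c, fun ε hε => ?_⟩
  obtain ⟨R, hR, H⟩ := hm.tail (ε / (|c| + 1)) (by positivity)
  refine ⟨R, hR, fun s hs => ?_⟩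
  simp only [norm_mul, Real.norm_eq_abs] at H ⊢
  rw [integral_const_mul]
  calc _ ≤ |c| * (ε / (|c| + 1)) := by gcongr; exact H s hs
    _ ≤ (|c| + 1) * (ε / (|c| + 1)) := by gcongr; linarith
    _ = ε := by field_simp

theorem memLp_inv_norm_sq {ρ : ℝ} (hρ : 0 < ρ) :
    MemLp (fun h : ℝ × ℝ => (‖h‖ ^ 2)⁻¹) 2 (volume.restrict {h | ρ < ‖h‖}) := by
  rw [memLp_two_iff_integrable_sq (by fun_prop)]
  refine (integrableOn_inv_norm_pow (k := 4) (by norm_num) hρ).congr_fun (fun h _ => ?_)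
    (measurableSet_lt_norm ρ)
  simp only [inv_pow, ← pow_mul]

/-- The `L²` norm of `‖h‖⁻²` off the ball of radius `ρ`. -/
def tailConst (ρ : ℝ) : ℝ := (∫ h in {h : ℝ × ℝ | ρ < ‖h‖}, (‖h‖ ^ 4)⁻¹) ^ (1 / 2 : ℝ)

theorem tailConst_nonneg (ρ : ℝ) : 0 ≤ tailConst ρ :=
  Real.rpow_nonneg (integral_nonneg fun h => by positivity) _

theorem integral_sq_rpow_half_le {m : ℝ × ℝ → E} {B : ℝ} (hB : 0 ≤ B)
    (hm : MemLp m 2 volume) (h : eLpNorm m 2 volume ≤ ENNReal.ofReal B) (A : Set (ℝ × ℝ)) :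
    (∫ h in A, ‖m h‖ ^ (2 : ℝ)) ^ (1 / 2 : ℝ) ≤ B := by
  have hA : MemLp m 2 (volume.restrict A) := hm.restrict A
  have h1 : eLpNorm m 2 (volume.restrict A) ≤ ENNReal.ofReal B :=
    (eLpNorm_mono_measure _ Measure.restrict_le_self).trans h
  rw [hA.eLpNorm_eq_integral_rpow_norm two_ne_zero ENNReal.ofNat_ne_top,
    ENNReal.ofReal_le_ofReal_iff hB] at h1
  simpa using h1

/-- Cauchy–Schwarz: an `L²` function paired with the inverse square at infinity. -/
theorem integrableOn_inv_sq_mul {m : ℝ × ℝ → E} {B : ℝ} (hB : 0 ≤ B)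
    (hm : MemLp m 2 volume) (h : eLpNorm m 2 volume ≤ ENNReal.ofReal B) {ρ : ℝ} (hρ : 0 < ρ) :
    IntegrableOn (fun h : ℝ × ℝ => (‖h‖ ^ 2)⁻¹ * ‖m h‖) {h | ρ < ‖h‖} ∧
      ∫ h in {h : ℝ × ℝ | ρ < ‖h‖}, (‖h‖ ^ 2)⁻¹ * ‖m h‖ ≤ tailConst ρ * B := by
  have h1 := memLp_inv_norm_sq hρ
  have h2 : MemLp (fun h => ‖m h‖) 2 (volume.restrict {h : ℝ × ℝ | ρ < ‖h‖}) := (hm.restrict _).norm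
  refine ⟨h1.integrable_mul h2, ?_⟩
  have := integral_mul_le_Lp_mul_Lq_of_nonneg (μ := volume.restrict {h : ℝ × ℝ | ρ < ‖h‖})
    Real.HolderConjugate.two_two
    (f := fun h : ℝ × ℝ => (‖h‖ ^ 2)⁻¹) (g := fun h => ‖m h‖)
    (ae_of_all _ fun h => by simp only [Pi.zero_apply]; positivity)
    (ae_of_all _ fun h => norm_nonneg _) (by simpa using h1) (by simpa using h2)
  refine this.trans ?_
  have e : ∀ h : ℝ × ℝ, ((‖h‖ ^ 2)⁻¹ : ℝ) ^ (2 : ℝ) = (‖h‖ ^ 4)⁻¹ := fun h => by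
    rw [Real.rpow_two, inv_pow, ← pow_mul]
  simp only [e]
  exact mul_le_mul_of_nonneg_left (integral_sq_rpow_half_le hB hm h _) (tailConst_nonneg ρ)

theorem exists_tailConst_le {ε : ℝ} (hε : 0 < ε) : ∃ R, 0 < R ∧ tailConst R ≤ ε := by
  obtain ⟨R, hR, H⟩ := exists_small_tail (g := fun h : ℝ × ℝ => (‖h‖ ^ 4)⁻¹)
    (fun ρ hρ => integrableOn_inv_norm_pow (by norm_num) hρ) (ε := ε ^ 2) (by positivity)
  refine ⟨R, hR, ?_⟩
  have e : ∀ h : ℝ × ℝ, ‖(‖h‖ ^ 4)⁻¹‖ = (‖h‖ ^ 4)⁻¹ := fun h =>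
    Real.norm_of_nonneg (by positivity)
  simp only [e] at H
  unfold tailConst
  rw [← Real.sqrt_eq_rpow]
  exact (Real.sqrt_le_left hε.le).2 H

/-- By the Cauchy–Schwarz inequality against `‖h‖⁻²`, which is square integrable off every ball. -/
theorem UnifTail.of_L2 {m : S → ℝ × ℝ → E} {B : ℝ} (hm : ∀ s ∈ I, Continuous (m s))
    (hB : ∀ s ∈ I, eLpNorm (m s) 2 volume ≤ ENNReal.ofReal B) :
    UnifTail I (fun s h => (‖h‖ ^ 2)⁻¹ * ‖m s h‖) := by
  have hB' : ∀ s ∈ I, eLpNorm (m s) 2 volume ≤ ENNReal.ofReal |B| := fun s hs =>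
    (hB s hs).trans (ENNReal.ofReal_le_ofReal (le_abs_self B))
  have hL : ∀ s ∈ I, MemLp (m s) 2 volume := fun s hs =>
    ⟨(hm s hs).aestronglyMeasurable, (hB s hs).trans_lt ENNReal.ofReal_lt_top⟩
  refine ⟨fun s hs ρ hρ => (integrableOn_inv_sq_mul (abs_nonneg B) (hL s hs) (hB' s hs) hρ).1,
    fun ε hε => ?_⟩
  obtain ⟨R, hR, H⟩ := exists_tailConst_le (ε := ε / (|B| + 1)) (by positivity)
  refine ⟨R, hR, fun s hs => ?_⟩
  have e : ∀ h : ℝ × ℝ, ‖(‖h‖ ^ 2)⁻¹ * ‖m s h‖‖ = (‖h‖ ^ 2)⁻¹ * ‖m s h‖ := fun h =>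
    Real.norm_of_nonneg (by positivity)
  simp only [e]
  refine (integrableOn_inv_sq_mul (abs_nonneg B) (hL s hs) (hB' s hs) hR).2.trans ?_
  calc _ ≤ ε / (|B| + 1) * (|B| + 1) := by gcongr; linarith
    _ = ε := by field_simp

end Radial

/-! ### Even cutoffs -/

section Cutoff

/-- A smooth even cutoff on the plane that vanishes for `‖h‖ ≤ 1 / (2 (n + 1))` and for
`‖h‖ ≥ 2 (n + 1)`, and equals `1` for `1 / (n + 1) ≤ ‖h‖ ≤ n + 1`. Here `‖h‖` is the sup norm, while
the profile is a function of the Euclidean norm, which makes it smooth. -/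
def cutoff (n : ℕ) (h : ℝ × ℝ) : ℝ :=
  Real.smoothTransition (2 * ((n : ℝ) + 1) ^ 2 * (h.1 ^ 2 + h.2 ^ 2) - 1) *
    Real.smoothTransition (2 - (h.1 ^ 2 + h.2 ^ 2) / (2 * ((n : ℝ) + 1) ^ 2))

theorem norm_sq_le_add (h : ℝ × ℝ) : ‖h‖ ^ 2 ≤ h.1 ^ 2 + h.2 ^ 2 := by
  rcases max_cases ‖h.1‖ ‖h.2‖ with ⟨e, _⟩ | ⟨e, _⟩ <;>
    rw [Prod.norm_def, e, Real.norm_eq_abs, sq_abs] <;> nlinarith [sq_nonneg h.1, sq_nonneg h.2]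

theorem add_le_two_norm_sq (h : ℝ × ℝ) : h.1 ^ 2 + h.2 ^ 2 ≤ 2 * ‖h‖ ^ 2 := by
  have h1 : h.1 ^ 2 ≤ ‖h‖ ^ 2 := sq_le_sq.2 (by simpa using norm_fst_le h)
  have h2 : h.2 ^ 2 ≤ ‖h‖ ^ 2 := sq_le_sq.2 (by simpa using norm_snd_le h)
  linarith

theorem contDiff_cutoff (n : ℕ) : ContDiff ℝ 1 (cutoff n) := by
  unfold cutoff
  have h : ContDiff ℝ 1 Real.smoothTransition := Real.smoothTransition.contDiff (n := 1)
  refine (h.comp ?_).mul (h.comp ?_) <;> fun_prop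

theorem continuous_cutoff (n : ℕ) : Continuous (cutoff n) := (contDiff_cutoff n).continuous

theorem cutoff_neg (n : ℕ) (h : ℝ × ℝ) : cutoff n (-h) = cutoff n h := by simp [cutoff]

theorem cutoff_nonneg (n : ℕ) (h : ℝ × ℝ) : 0 ≤ cutoff n h :=
  mul_nonneg (Real.smoothTransition.nonneg _) (Real.smoothTransition.nonneg _)

theorem cutoff_le_one (n : ℕ) (h : ℝ × ℝ) : cutoff n h ≤ 1 :=
  mul_le_one₀ (Real.smoothTransition.le_one _) (Real.smoothTransition.nonneg _)
    (Real.smoothTransition.le_one _)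

theorem cutoff_eq_zero_of_le {n : ℕ} {h : ℝ × ℝ} (hh : ‖h‖ ≤ 1 / (2 * ((n : ℝ) + 1))) :
    cutoff n h = 0 := by
  have hn : (0 : ℝ) < (n : ℝ) + 1 := by positivity
  have h1 : ‖h‖ * (2 * ((n : ℝ) + 1)) ≤ 1 := (le_div_iff₀ (by positivity)).1 hh
  have h2 := add_le_two_norm_sq h
  have h3 : (‖h‖ * (2 * ((n : ℝ) + 1))) ^ 2 ≤ 1 := pow_le_one₀ (by positivity) h1
  rw [cutoff, Real.smoothTransition.zero_of_nonpos, zero_mul]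
  nlinarith [sq_nonneg ((n : ℝ) + 1)]

theorem cutoff_eq_zero_of_ge {n : ℕ} {h : ℝ × ℝ} (hh : 2 * ((n : ℝ) + 1) ≤ ‖h‖) :
    cutoff n h = 0 := by
  have hn : (0 : ℝ) < (n : ℝ) + 1 := by positivity
  have h2 := norm_sq_le_add h
  have h3 : (2 * ((n : ℝ) + 1)) ^ 2 ≤ ‖h‖ ^ 2 := by gcongr
  rw [cutoff, mul_comm, Real.smoothTransition.zero_of_nonpos, zero_mul]
  rw [sub_nonpos, le_div_iff₀ (by positivity)]
  nlinarith

theorem cutoff_eq_one {n : ℕ} {h : ℝ × ℝ} (h1 : 1 / ((n : ℝ) + 1) ≤ ‖h‖)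
    (h2 : ‖h‖ ≤ (n : ℝ) + 1) : cutoff n h = 1 := by
  have hn : (0 : ℝ) < (n : ℝ) + 1 := by positivity
  have h3 : 1 ≤ ‖h‖ * ((n : ℝ) + 1) := (div_le_iff₀ hn).1 h1
  have h4 : 1 ≤ (‖h‖ * ((n : ℝ) + 1)) ^ 2 := one_le_pow₀ h3
  have h5 : ‖h‖ ^ 2 ≤ ((n : ℝ) + 1) ^ 2 := by gcongr
  have h6 := norm_sq_le_add h
  have h7 := add_le_two_norm_sq h
  rw [cutoff, Real.smoothTransition.one_of_one_le, Real.smoothTransition.one_of_one_le, one_mul]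
  · rw [le_sub_comm, div_le_iff₀ (by positivity)]; linarith
  · nlinarith [sq_nonneg ((n : ℝ) + 1)]

theorem hasCompactSupport_of_cutoff {E : Type*} [Zero E] {n : ℕ} {F : ℝ × ℝ → E}
    (h : ∀ h : ℝ × ℝ, 2 * ((n : ℝ) + 1) ≤ ‖h‖ → F h = 0) : HasCompactSupport F :=
  HasCompactSupport.intro (isCompact_closedBall 0 (2 * ((n : ℝ) + 1))) fun q hq =>
    h q (by simpa using (not_le.1 (by simpa using hq)).le)

/-- A scalar function with the support, parity and size of a first derivative of the `n`-th
cutoff. -/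
structure IsCutoffGrad (C : ℝ) (n : ℕ) (D : ℝ × ℝ → ℝ) : Prop where
  continuous : Continuous D
  odd : ∀ h, D (-h) = -D h
  bound : ∀ h, |D h| ≤ C / ‖h‖
  inner : ∀ h, ‖h‖ ≤ 1 / (2 * ((n : ℝ) + 1)) → D h = 0
  middle : ∀ h, 1 / ((n : ℝ) + 1) < ‖h‖ → ‖h‖ < (n : ℝ) + 1 → D h = 0
  outer : ∀ h, 2 * ((n : ℝ) + 1) ≤ ‖h‖ → D h = 0

theorem exists_deriv_smoothTransition_bound : ∃ C, 0 < C ∧ ∀ x,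
    |deriv Real.smoothTransition x| ≤ C ∧ (x ≤ 0 ∨ 1 ≤ x → deriv Real.smoothTransition x = 0) := by
  have hc : Continuous (deriv Real.smoothTransition) :=
    (Real.smoothTransition.contDiff (n := 1)).continuous_deriv le_rfl
  obtain ⟨C, hC⟩ := isCompact_Icc.exists_bound_of_continuousOn (hc.continuousOn (s := Icc (0:ℝ) 1))
  have h0 : ∀ x, (x ≤ 0 ∨ 1 ≤ x) → deriv Real.smoothTransition x = 0 := by
    rintro x (hx | hx)
    · have : IsLocalMin Real.smoothTransition x := Eventually.of_forall fun y => by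
        rw [Real.smoothTransition.zero_of_nonpos hx]; exact Real.smoothTransition.nonneg y
      exact this.deriv_eq_zero
    · have : IsLocalMax Real.smoothTransition x := Eventually.of_forall fun y => by
        rw [Real.smoothTransition.one_of_one_le hx]; exact Real.smoothTransition.le_one y
      exact this.deriv_eq_zero
  refine ⟨max C 1, by positivity, fun x => ⟨?_, h0 x⟩⟩
  by_cases hx : x ∈ Icc (0 : ℝ) 1
  · exact (hC x hx).trans (le_max_left _ _)
  · rw [h0 x (by by_contra! h; exact hx ⟨h.1.le, h.2.le⟩), abs_zero]
    positivity

theorem dβ_cutoff_swap (n : ℕ) (h : ℝ × ℝ) : dβ (cutoff n) h = dα (cutoff n) h.swap := by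
  unfold dα dβ
  simp only [cutoff, Prod.fst_swap, Prod.snd_swap, add_comm]

/-- By scaling, the gradients of the cutoffs are bounded by `C / ‖h‖` with `C` independent of `n`. -/
theorem exists_isCutoffGrad : ∃ C, 0 < C ∧ ∀ n, IsCutoffGrad C n (dα (cutoff n)) ∧
    IsCutoffGrad C n (dβ (cutoff n)) := by
  obtain ⟨C, hC, H⟩ := exists_deriv_smoothTransition_bound
  suffices hα : ∀ n, IsCutoffGrad (8 * C) n (dα (cutoff n)) by
    refine ⟨8 * C, by positivity, fun n => ⟨hα n, ?_⟩⟩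
    have e : dβ (cutoff n) = fun h => dα (cutoff n) h.swap := funext (dβ_cutoff_swap n)
    have hs : ∀ h : ℝ × ℝ, ‖h.swap‖ = ‖h‖ := fun h => by simp [Prod.norm_def, max_comm]
    rw [e]
    exact ⟨(hα n).continuous.comp continuous_swap, fun h => (hα n).odd h.swap,
      fun h => by simpa [hs] using (hα n).bound h.swap,
      fun h hh => (hα n).inner h.swap (by rwa [hs]),
      fun h hh hh' => (hα n).middle h.swap (by rwa [hs]) (by rwa [hs]),
      fun h hh => (hα n).outer h.swap (by rwa [hs])⟩
  intro n
  set m : ℝ := (n : ℝ) + 1 with hm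
  have hm0 : 0 < m := by positivity
  have hst : Differentiable ℝ Real.smoothTransition :=
    (Real.smoothTransition.contDiff (n := 1)).differentiable one_ne_zero
  set σ := Real.smoothTransition
  have hd : ∀ h : ℝ × ℝ, dα (cutoff n) h
      = deriv σ (2 * m ^ 2 * (h.1 ^ 2 + h.2 ^ 2) - 1) * (4 * m ^ 2 * h.1)
          * σ (2 - (h.1 ^ 2 + h.2 ^ 2) / (2 * m ^ 2))
        + σ (2 * m ^ 2 * (h.1 ^ 2 + h.2 ^ 2) - 1)
          * (deriv σ (2 - (h.1 ^ 2 + h.2 ^ 2) / (2 * m ^ 2)) * (-(h.1 / m ^ 2))) := by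
    intro h
    have hq : HasDerivAt (fun r : ℝ => r ^ 2 + h.2 ^ 2) (2 * h.1) h.1 := by
      simpa using (hasDerivAt_pow 2 h.1).add_const (h.2 ^ 2)
    have h1 := (hst _).hasDerivAt.comp h.1 ((hq.const_mul (2 * m ^ 2)).sub_const 1)
    have h2 := (hst _).hasDerivAt.comp h.1 ((hq.div_const (2 * m ^ 2)).const_sub 2)
    have h3 := (h1.mul h2).deriv
    unfold dα
    refine h3.trans ?_
    simp only [Function.comp]
    have : 2 * h.1 / (2 * m ^ 2) = h.1 / m ^ 2 := by field_simp
    rw [this]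
    ring
  -- in the transition regions `m² r²` respectively `r² / m²` is of order one
  have key : ∀ h : ℝ × ℝ, |dα (cutoff n) h| ≤ 8 * C / ‖h‖ := by
    intro h
    rcases eq_or_ne h 0 with rfl | h0
    · simp [hd]
    have hp : 0 < ‖h‖ := norm_pos_iff.2 h0
    have h1 : |h.1| ≤ ‖h‖ := by simpa using norm_fst_le h
    have hr := norm_sq_le_add h
    have hr2 := add_le_two_norm_sq h
    set ρ := h.1 ^ 2 + h.2 ^ 2
    have b1 : |deriv σ (2 * m ^ 2 * ρ - 1) * (4 * m ^ 2 * h.1)| ≤ 4 * C / ‖h‖ := by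
      by_cases hx : 1 < 2 * m ^ 2 * ρ - 1
      · rw [(H _).2 (Or.inr hx.le)]; simp; positivity
      · have h3 : m ^ 2 * ‖h‖ ^ 2 ≤ 1 := by nlinarith [sq_nonneg m]
        rw [abs_mul, abs_mul, abs_of_pos (by positivity : 0 < 4 * m ^ 2), le_div_iff₀ hp]
        calc |deriv σ (2 * m ^ 2 * ρ - 1)| * (4 * m ^ 2 * |h.1|) * ‖h‖
            ≤ C * (4 * m ^ 2 * ‖h‖) * ‖h‖ := by gcongr; exact (H _).1
          _ = 4 * C * (m ^ 2 * ‖h‖ ^ 2) := by ring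
          _ ≤ 4 * C * 1 := by gcongr
          _ = _ := by ring
    have b2 : |deriv σ (2 - ρ / (2 * m ^ 2)) * (-(h.1 / m ^ 2))| ≤ 4 * C / ‖h‖ := by
      by_cases hx : 2 - ρ / (2 * m ^ 2) < 0
      · rw [(H _).2 (Or.inl hx.le)]; simp; positivity
      · have h3 : ρ ≤ 2 * (2 * m ^ 2) := by
          rw [← div_le_iff₀ (by positivity)]; linarith
        rw [abs_mul, abs_neg, abs_div, abs_of_pos (by positivity : 0 < m ^ 2), le_div_iff₀ hp]
        calc |deriv σ (2 - ρ / (2 * m ^ 2))| * (|h.1| / m ^ 2) * ‖h‖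
            ≤ C * (‖h‖ / m ^ 2) * ‖h‖ := by gcongr; exact (H _).1
          _ = C * (‖h‖ ^ 2 / m ^ 2) := by ring
          _ ≤ C * 4 := by
            gcongr
            rw [div_le_iff₀ (by positivity)]; linarith
          _ = _ := by ring
    rw [hd]
    refine (abs_add_le _ _).trans ?_
    rw [abs_mul _ (σ _), abs_mul (σ _), abs_of_nonneg (Real.smoothTransition.nonneg _),
      abs_of_nonneg (Real.smoothTransition.nonneg _)]
    have c1 := mul_le_mul b1 (Real.smoothTransition.le_one (2 - ρ / (2 * m ^ 2)))
      (Real.smoothTransition.nonneg _) (by positivity)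
    have c2 := mul_le_mul (Real.smoothTransition.le_one (2 * m ^ 2 * ρ - 1)) b2
      (abs_nonneg _) zero_le_one
    calc _ ≤ 4 * C / ‖h‖ * 1 + 1 * (4 * C / ‖h‖) := add_le_add c1 c2
      _ = _ := by ring
  have hcont : Continuous (dα (cutoff n)) := by
    have hc : Continuous (deriv σ) :=
      (Real.smoothTransition.contDiff (n := 1)).continuous_deriv le_rfl
    have hc' : Continuous σ := hst.continuous
    rw [funext hd]
    fun_prop
  refine ⟨hcont, fun h => ?_, key, fun h hh => ?_, fun h hh hh' => ?_, fun h hh => ?_⟩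
  · rw [hd, hd]; simp; ring
  · have h1 : ‖h‖ * (2 * m) ≤ 1 := (le_div_iff₀ (by positivity)).1 hh
    have h3 : (‖h‖ * (2 * m)) ^ 2 ≤ 1 := pow_le_one₀ (by positivity) h1
    have h2 := add_le_two_norm_sq h
    have h4 : 2 * m ^ 2 * (h.1 ^ 2 + h.2 ^ 2) - 1 ≤ 0 := by nlinarith [sq_nonneg m]
    have h6 : σ (2 * m ^ 2 * (h.1 ^ 2 + h.2 ^ 2) - 1) = 0 :=
      Real.smoothTransition.zero_of_nonpos h4
    rw [hd, (H _).2 (Or.inl h4), h6]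
    simp
  · have h3 : 1 ≤ ‖h‖ * m := (div_le_iff₀ hm0).1 hh.le
    have h4 : 1 ≤ (‖h‖ * m) ^ 2 := one_le_pow₀ h3
    have h5 : ‖h‖ ^ 2 ≤ m ^ 2 := by gcongr
    have h6 := norm_sq_le_add h
    have h7 := add_le_two_norm_sq h
    have h8 : 1 ≤ 2 * m ^ 2 * (h.1 ^ 2 + h.2 ^ 2) - 1 := by nlinarith [sq_nonneg m]
    have h9 : 1 ≤ 2 - (h.1 ^ 2 + h.2 ^ 2) / (2 * m ^ 2) := by
      rw [le_sub_comm, div_le_iff₀ (by positivity)]; linarith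
    rw [hd, (H _).2 (Or.inr h8), (H _).2 (Or.inr h9)]
    simp
  · have h2 := norm_sq_le_add h
    have h3 : (2 * m) ^ 2 ≤ ‖h‖ ^ 2 := by gcongr
    have h4 : 2 - (h.1 ^ 2 + h.2 ^ 2) / (2 * m ^ 2) ≤ 0 := by
      rw [sub_nonpos, le_div_iff₀ (by positivity)]; nlinarith
    have h6 : σ (2 - (h.1 ^ 2 + h.2 ^ 2) / (2 * m ^ 2)) = 0 :=
      Real.smoothTransition.zero_of_nonpos h4
    rw [hd, (H _).2 (Or.inl h4), h6]
    simp

end Cutoff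

/-! ### Symmetrized integrals and principal values -/

section Symmetrize

variable {E : Type*} [NormedAddCommGroup E] {S : Type*} {I : Set S}

theorem aestronglyMeasurable_of_integrableOn {F : ℝ × ℝ → E}
    (hF : ∀ ρ > 0, IntegrableOn F {h | ρ < ‖h‖}) : AEStronglyMeasurable F volume := by
  have hU : (⋃ n : ℕ, {h : ℝ × ℝ | 1 / ((n : ℝ) + 1) < ‖h‖}) = {0}ᶜ := by
    ext h
    simp only [mem_iUnion, mem_ofPred_eq, mem_compl_iff, mem_singleton_iff]
    refine ⟨fun ⟨n, hn⟩ h0 => ?_, fun h0 => exists_nat_one_div_lt (norm_pos_iff.2 h0)⟩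
    rw [h0, norm_zero] at hn
    exact absurd hn (not_lt.2 (by positivity))
  have h1 : AEStronglyMeasurable F (volume.restrict {0}ᶜ) := by
    rw [← hU, aestronglyMeasurable_iUnion_iff]
    exact fun n => (hF _ (by positivity)).aestronglyMeasurable
  rwa [restrict_compl_singleton] at h1

theorem integrableOn_comp_neg {F : ℝ × ℝ → E} {A : Set (ℝ × ℝ)} (hA : ∀ h, -h ∈ A ↔ h ∈ A)
    (hF : IntegrableOn F A) : IntegrableOn (fun h => F (-h)) A := by
  have e : (fun h : ℝ × ℝ => -h) ⁻¹' A = A := ext hA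
  have := ((Measure.measurePreserving_neg (volume : Measure (ℝ × ℝ))).integrableOn_comp_preimage
    (MeasurableEquiv.neg (ℝ × ℝ)).measurableEmbedding (f := F) (s := A)).2 hF
  rwa [show (Neg.neg : ℝ × ℝ → ℝ × ℝ) ⁻¹' A = A from e] at this

theorem integrable_symm {F : ℝ × ℝ → E} (hF : ∀ ρ > 0, IntegrableOn F {h | ρ < ‖h‖}) {A : ℝ}
    (hA : ∀ h ≠ 0, ‖h‖ ≤ 1 → ‖F h + F (-h)‖ ≤ A / ‖h‖) :
    Integrable (fun h => F h + F (-h)) := by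
  have hm := aestronglyMeasurable_of_integrableOn hF
  have hm' : AEStronglyMeasurable (fun h => F (-h)) volume :=
    hm.comp_measurePreserving (Measure.measurePreserving_neg _)
  have h1 : IntegrableOn (fun h => F h + F (-h)) {h | 1 < ‖h‖} :=
    (hF 1 one_pos).add (integrableOn_comp_neg (by simp) (hF 1 one_pos))
  have h2 : IntegrableOn (fun h => F h + F (-h)) {h | ‖h‖ ≤ 1} := by
    refine Integrable.mono' (integrableOn_inv_norm.const_mul A) (hm.add hm').restrict ?_
    refine (ae_restrict_iff' (measurableSet_norm_le 1)).2 ?_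
    filter_upwards [compl_mem_ae_iff.2 (measure_singleton (0 : ℝ × ℝ))] with h h0 hh
    exact (hA h h0 hh).trans_eq (div_eq_mul_inv _ _)
  have := h2.union h1
  rwa [show {h : ℝ × ℝ | ‖h‖ ≤ 1} ∪ {h | 1 < ‖h‖} = univ by
    ext h; simpa using le_or_gt ‖h‖ 1, integrableOn_univ] at this

variable [NormedSpace ℝ E]

/-- The integral of the even part of `F`. It is the value of every symmetric regularization of the
integral of `F`, in particular of the principal value at the origin. -/
def symmIntegral (F : ℝ × ℝ → E) : E := (1 / 2 : ℝ) • ∫ h, (F h + F (-h))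

theorem integral_even_smul {F : ℝ × ℝ → E} {φ : ℝ × ℝ → ℝ} (hφ : ∀ h, φ (-h) = φ h)
    (hi : Integrable (fun h => φ h • F h)) :
    ∫ h, φ h • F h = (1 / 2 : ℝ) • ∫ h, φ h • (F h + F (-h)) := by
  have h1 : ∫ h, φ h • F (-h) = ∫ h, φ h • F h := by
    have := integral_neg_eq_self (fun h => φ h • F h) (volume : Measure (ℝ × ℝ))
    simpa only [hφ] using this
  have h2 : Integrable (fun h => φ h • F (-h)) := by
    simpa only [hφ] using hi.comp_neg
  simp only [smul_add]
  rw [integral_add hi h2, h1, ← two_smul ℝ, smul_smul]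
  norm_num

theorem integral_odd_smul {F : ℝ × ℝ → E} {φ : ℝ × ℝ → ℝ} (hφ : ∀ h, φ (-h) = -φ h)
    (hi : Integrable (fun h => φ h • F h)) :
    ∫ h, φ h • F h = (1 / 2 : ℝ) • ∫ h, φ h • (F h - F (-h)) := by
  have h1 : ∫ h, φ h • F (-h) = -∫ h, φ h • F h := by
    have := integral_neg_eq_self (fun h => φ h • F h) (volume : Measure (ℝ × ℝ))
    simp only [hφ, neg_smul] at this
    rw [integral_neg] at this
    rw [← this, neg_neg]
  have h2 : Integrable (fun h => φ h • F (-h)) := by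
    have := hi.comp_neg
    simp only [hφ, neg_smul] at this
    simpa using this.neg
  simp only [smul_sub]
  rw [integral_sub hi h2, h1, sub_neg_eq_add, ← two_smul ℝ, smul_smul]
  norm_num

theorem symmIntegral_eq_integral {F : ℝ × ℝ → E} (hF : Integrable F) :
    symmIntegral F = ∫ h, F h := by
  have := integral_even_smul (F := F) (φ := fun _ => 1) (by simp) (by simpa using hF)
  simpa [symmIntegral] using this.symm

theorem norm_le_pdist (h : ℝ × ℝ) : ‖h‖ ≤ pdist h 0 := by
  refine Real.le_sqrt_of_sq_le ?_
  simpa using norm_sq_le_add h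

theorem pdist_le_two_norm (h : ℝ × ℝ) : pdist h 0 ≤ 2 * ‖h‖ := by
  refine Real.sqrt_le_left (by positivity) |>.2 ?_
  have := add_le_two_norm_sq h
  simp only [Prod.fst_zero, Prod.snd_zero, sub_zero]
  nlinarith [sq_nonneg ‖h‖]

theorem hasPV_symmIntegral {F : ℝ × ℝ → ℍ[ℝ]} (hF : ∀ ρ > 0, IntegrableOn F {h | ρ < ‖h‖}) {A : ℝ}
    (hA : ∀ h ≠ 0, ‖h‖ ≤ 1 → ‖F h + F (-h)‖ ≤ A / ‖h‖) : HasPV F 0 (symmIntegral F) := by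
  have hs := integrable_symm hF hA
  have hi : ∀ ε : ℝ, 0 < ε → IntegrableOn F {q : ℝ × ℝ | ε < pdist q 0} := fun ε hε =>
    (hF (ε / 2) (by positivity)).mono_set fun h (hh : ε < pdist h 0) => by
      have := pdist_le_two_norm h
      simp only [mem_ofPred_eq]
      linarith
  have hms : ∀ ε : ℝ, MeasurableSet {q : ℝ × ℝ | ε < pdist q 0} := fun ε =>
    measurableSet_lt measurable_const (by unfold pdist; fun_prop)
  refine ⟨hi, ?_⟩
  have e : ∀ ε : ℝ, 0 < ε → truncInt F 0 ε = (1 / 2 : ℝ) • ∫ h,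
      {q : ℝ × ℝ | ε < pdist q 0}.indicator (fun _ => (1 : ℝ)) h • (F h + F (-h)) := by
    intro ε hε
    have e1 : ∀ h, {q : ℝ × ℝ | ε < pdist q 0}.indicator (fun _ => (1 : ℝ)) h • F h
        = {q : ℝ × ℝ | ε < pdist q 0}.indicator F h := fun h => by
      by_cases hh : h ∈ {q : ℝ × ℝ | ε < pdist q 0} <;> simp [hh]
    rw [← integral_even_smul]
    · simp only [e1]
      rw [integral_indicator (hms ε)]; rfl
    · intro h
      have : pdist (-h) 0 = pdist h 0 := by simp [pdist]
      simp [indicator, this]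
    · simp only [e1]
      exact (integrable_indicator_iff (hms ε)).2 (hi ε hε)
  have ht : Tendsto (fun ε : ℝ => ∫ h,
      {q : ℝ × ℝ | ε < pdist q 0}.indicator (fun _ => (1 : ℝ)) h • (F h + F (-h)))
      (𝓝[>] 0) (𝓝 (∫ h, (F h + F (-h)))) := by
    refine tendsto_integral_filter_of_dominated_convergence (fun h => ‖F h + F (-h)‖) ?_ ?_
      hs.norm ?_
    · exact Eventually.of_forall fun ε => AEStronglyMeasurable.smul
        (f := {q : ℝ × ℝ | ε < pdist q 0}.indicator fun _ => (1 : ℝ))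
        ((measurable_const.indicator (hms ε)).aestronglyMeasurable) hs.aestronglyMeasurable
    · refine Eventually.of_forall fun ε => ae_of_all _ fun h => ?_
      rw [norm_smul]
      refine mul_le_of_le_one_left (norm_nonneg _) ?_
      by_cases hh : h ∈ {q : ℝ × ℝ | ε < pdist q 0} <;> simp [hh]
    · filter_upwards [compl_mem_ae_iff.2 (measure_singleton (0 : ℝ × ℝ))] with h h0
      refine tendsto_const_nhds.congr' ?_
      have hp : 0 < pdist h 0 := (norm_pos_iff.2 h0).trans_le (norm_le_pdist h)
      filter_upwards [Ioo_mem_nhdsGT hp] with ε hε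
      have : h ∈ {q : ℝ × ℝ | ε < pdist q 0} := hε.2
      simp [this]
  refine (ht.const_smul (1 / 2 : ℝ)).congr' ?_
  filter_upwards [self_mem_nhdsWithin] with ε hε using (e ε hε).symm

theorem _root_.MeasureTheory.Integrable.cutoff_smul {F : ℝ × ℝ → E} (hF : Integrable F) (n : ℕ) :
    Integrable (fun h => cutoff n h • F h) :=
  hF.bdd_smul (φ := cutoff n) 1 (continuous_cutoff n).aestronglyMeasurable
    (ae_of_all _ fun h => by
      rw [Real.norm_of_nonneg (cutoff_nonneg n h)]; exact cutoff_le_one n h)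

theorem integrable_cutoff_smul {F : ℝ × ℝ → E} (hF : ∀ ρ > 0, IntegrableOn F {h | ρ < ‖h‖})
    (n : ℕ) : Integrable (fun h => cutoff n h • F h) := by
  have hρ : 0 < 1 / (2 * ((n : ℝ) + 1)) := by positivity
  set ρ := 1 / (2 * ((n : ℝ) + 1))
  have h1 : Integrable ({h : ℝ × ℝ | ρ < ‖h‖}.indicator F) :=
    (integrable_indicator_iff (measurableSet_lt_norm ρ)).2 (hF ρ hρ)
  refine (h1.cutoff_smul n).congr (ae_of_all _ fun h => ?_)
  by_cases hh : ρ < ‖h‖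
  · simp [hh]
  · simp [hh, cutoff_eq_zero_of_le (not_lt.1 hh)]

/-- Cut off integrals converge to the symmetrized integral, uniformly in the parameter, as soon as
the even parts have a uniform weak singularity and the integrals are uniformly small at infinity. -/
theorem tendstoUniformlyOn_cutoff {Φ : S → ℝ × ℝ → E} {A : ℝ}
    (hA : ∀ s ∈ I, ∀ h ≠ 0, ‖h‖ ≤ 1 → ‖Φ s h + Φ s (-h)‖ ≤ A / ‖h‖) (hT : UnifTail I Φ) :
    TendstoUniformlyOn (fun n s => ∫ h, cutoff n h • Φ s h) (fun s => symmIntegral (Φ s)) atTop I := by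
  rw [Metric.tendstoUniformlyOn_iff]
  intro ε hε
  obtain ⟨δ, hδ, hδ1, Hδ⟩ := exists_small_ball (ε := ε / (2 * (|A| + 1))) (by positivity)
  obtain ⟨R, hR, HR⟩ := hT.tail' (ε := ε / 4) (by positivity)
  obtain ⟨N, hN⟩ := exists_nat_gt (max R (1 / δ))
  filter_upwards [eventually_ge_atTop N] with n hn s hs
  have hnN : (N : ℝ) ≤ n := by exact_mod_cast hn
  have hnR : R ≤ (n : ℝ) + 1 := by linarith [(le_max_left R (1 / δ)).trans hN.le]
  have hm : (0 : ℝ) < (n : ℝ) + 1 := by positivity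
  have hnδ : 1 / ((n : ℝ) + 1) ≤ δ := by
    rw [div_le_comm₀ hm hδ]
    linarith [(le_max_right R (1 / δ)).trans hN.le]
  have hF := hT.integrableOn s hs
  have hsym := integrable_symm hF (hA s hs)
  have hsymc := hsym.cutoff_smul n
  rw [dist_eq_norm, symmIntegral, integral_even_smul (cutoff_neg n) (integrable_cutoff_smul hF n),
    ← smul_sub, ← integral_sub hsym hsymc, norm_smul]
  -- the difference lives where the cutoff is not `1`
  set B1 := {h : ℝ × ℝ | ‖h‖ ≤ 1 / ((n : ℝ) + 1)}
  set B2 := {h : ℝ × ℝ | (n : ℝ) + 1 < ‖h‖}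
  have hB1 : MeasurableSet B1 := measurableSet_norm_le _
  have hB2 : MeasurableSet B2 := measurableSet_lt_norm _
  have j1 : Integrable (B1.indicator fun h : ℝ × ℝ => |A| * ‖h‖⁻¹) :=
    (integrable_indicator_iff hB1).2 ((integrableOn_inv_norm.mono_set
      fun h hh => le_trans hh (hnδ.trans hδ1)).const_mul _)
  have k1 : IntegrableOn (fun h => ‖Φ s h‖) B2 := (hF _ hm).norm
  have k2 : IntegrableOn (fun h => ‖Φ s (-h)‖) B2 :=
    integrableOn_comp_neg (F := fun h => ‖Φ s h‖) (by simp [B2]) k1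
  have j2 : Integrable (B2.indicator fun h : ℝ × ℝ => ‖Φ s h‖ + ‖Φ s (-h)‖) :=
    (integrable_indicator_iff hB2).2 (k1.add k2)
  have hb : ‖∫ h, (Φ s h + Φ s (-h) - cutoff n h • (Φ s h + Φ s (-h)))‖
      ≤ ∫ h, (B1.indicator (fun h : ℝ × ℝ => |A| * ‖h‖⁻¹) h
        + B2.indicator (fun h : ℝ × ℝ => ‖Φ s h‖ + ‖Φ s (-h)‖) h) := by
    refine norm_integral_le_of_norm_le (j1.add j2) ?_
    filter_upwards [compl_mem_ae_iff.2 (measure_singleton (0 : ℝ × ℝ))] with h h0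
    have e : Φ s h + Φ s (-h) - cutoff n h • (Φ s h + Φ s (-h))
        = (1 - cutoff n h) • (Φ s h + Φ s (-h)) := by rw [sub_smul, one_smul]
    have hle : ‖(1 - cutoff n h) • (Φ s h + Φ s (-h))‖ ≤ ‖Φ s h + Φ s (-h)‖ := by
      rw [norm_smul, Real.norm_of_nonneg (by linarith [cutoff_le_one n h])]
      exact mul_le_of_le_one_left (norm_nonneg _) (by linarith [cutoff_nonneg n h])
    have n1 : 0 ≤ B1.indicator (fun h : ℝ × ℝ => |A| * ‖h‖⁻¹) h :=
      indicator_nonneg (fun _ _ => by positivity) _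
    have n2 : 0 ≤ B2.indicator (fun h : ℝ × ℝ => ‖Φ s h‖ + ‖Φ s (-h)‖) h :=
      indicator_nonneg (fun _ _ => by positivity) _
    rw [e]
    by_cases m1 : h ∈ B1
    · refine hle.trans ((hA s hs h h0 (le_trans m1 (hnδ.trans hδ1))).trans ?_)
      rw [indicator_of_mem m1, div_eq_mul_inv]
      have : A * ‖h‖⁻¹ ≤ |A| * ‖h‖⁻¹ := by gcongr; exact le_abs_self A
      linarith
    by_cases m2 : h ∈ B2
    · refine hle.trans ((norm_add_le _ _).trans ?_)
      rw [indicator_of_mem m2 (f := fun h : ℝ × ℝ => ‖Φ s h‖ + ‖Φ s (-h)‖)]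
      linarith
    rw [cutoff_eq_one (not_le.1 m1).le (not_lt.1 m2)]
    simp only [sub_self, zero_smul, norm_zero]
    positivity
  rw [integral_add j1 j2, integral_indicator hB1, integral_indicator hB2, integral_const_mul,
    integral_add k1 k2] at hb
  have t1 : |A| * ∫ h in B1, ‖h‖⁻¹ ≤ ε / 2 := by
    calc |A| * ∫ h in B1, ‖h‖⁻¹ ≤ |A| * (ε / (2 * (|A| + 1))) := by gcongr; exact Hδ _ hnδ
      _ ≤ (|A| + 1) * (ε / (2 * (|A| + 1))) := by gcongr; linarith
      _ = ε / 2 := by field_simp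
  have t2 : ∫ h in B2, ‖Φ s h‖ ≤ ε / 4 := HR _ hnR s hs
  have t3 : ∫ h in B2, ‖Φ s (-h)‖ = ∫ h in B2, ‖Φ s h‖ := by
    have := (Measure.measurePreserving_neg (volume : Measure (ℝ × ℝ))).setIntegral_preimage_emb
      (MeasurableEquiv.neg (ℝ × ℝ)).measurableEmbedding (fun h => ‖Φ s h‖) B2
    rwa [show (Neg.neg : ℝ × ℝ → ℝ × ℝ) ⁻¹' B2 = B2 from ext fun h => by simp [B2]] at this
  rw [Real.norm_of_nonneg (by norm_num)]
  linarith

end Symmetrize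

/-! ### Integration by parts against the cutoffs -/

section Parts

variable {E : Type*} [NormedAddCommGroup E] [NormedSpace ℝ E] {S : Type*} {I : Set S}

theorem continuous_smul_of_zero_near {F : ℝ × ℝ → E} {φ : ℝ × ℝ → ℝ} {ρ : ℝ} (hρ : 0 < ρ)
    (hφ : Continuous φ) (h0 : ∀ h, ‖h‖ ≤ ρ → φ h = 0) (hF : ContinuousOn F {0}ᶜ) :
    Continuous (fun h => φ h • F h) := by
  rw [continuous_iff_continuousAt]
  intro h
  rcases eq_or_ne h 0 with rfl | hh
  · have : (fun h => φ h • F h) =ᶠ[𝓝 0] fun _ => (0 : E) := by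
      filter_upwards [Metric.closedBall_mem_nhds (0 : ℝ × ℝ) hρ] with q hq
      rw [h0 q (by simpa using hq), zero_smul]
    exact continuousAt_const.congr this.symm
  · exact hφ.continuousAt.smul (hF.continuousAt (isOpen_compl_singleton.mem_nhds hh))

/-- Derivatives of cutoffs, being odd and concentrated on two annuli, pair to zero in the limit with
functions whose odd part is `o(1/‖h‖)` at the origin and which are small at infinity. -/
theorem tendstoUniformlyOn_cutoffGrad {C : ℝ} {D : ℕ → ℝ × ℝ → ℝ} (hC : 0 < C)
    (hD : ∀ n, IsCutoffGrad C n (D n)) {Φ : S → ℝ × ℝ → E} (hc : ∀ s ∈ I, ContinuousOn (Φ s) {0}ᶜ)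
    (hA : ∀ ε > 0, ∃ δ > 0, ∀ s ∈ I, ∀ h ≠ 0, ‖h‖ ≤ δ → ‖Φ s h - Φ s (-h)‖ ≤ ε / ‖h‖)
    (hT : UnifTail I (fun s h => ‖h‖⁻¹ * ‖Φ s h‖)) :
    TendstoUniformlyOn (fun n s => ∫ h, D n h • Φ s h) (fun _ => 0) atTop I := by
  rw [Metric.tendstoUniformlyOn_iff]
  intro ε hε
  obtain ⟨δ, hδ, Hδ⟩ := hA (ε / (16 * (2 * C))) (by positivity)
  obtain ⟨R, hR, HR⟩ := hT.tail' (ε := ε / (4 * C)) (by positivity)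
  obtain ⟨N, hN⟩ := exists_nat_gt (max (max R 1) (1 / δ))
  filter_upwards [eventually_ge_atTop N] with n hn s hs
  have hnN : (N : ℝ) ≤ n := by exact_mod_cast hn
  have hnR : R ≤ n := ((le_max_left R 1).trans ((le_max_left _ _).trans hN.le)).trans hnN
  have hn1 : 1 ≤ (n : ℝ) := ((le_max_right R 1).trans ((le_max_left _ _).trans hN.le)).trans hnN
  set m : ℝ := (n : ℝ) + 1 with hm'
  have hm : 0 < m := by positivity
  have hnδ : 1 / m ≤ δ := by
    rw [div_le_comm₀ hm hδ]
    linarith [(le_max_right (max R 1) (1 / δ)).trans hN.le]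
  have hm1 : 1 / m ≤ n := (div_le_one hm |>.2 (by linarith)).trans hn1
  have hd := hD n
  have hcont := continuous_smul_of_zero_near (by positivity) hd.continuous hd.inner (hc s hs)
  have hi : Integrable (fun h => D n h • Φ s h) :=
    hcont.integrable_of_hasCompactSupport (hasCompactSupport_of_cutoff (n := n)
      fun h hh => by rw [hd.outer h hh, zero_smul])
  rw [dist_comm, dist_zero_right, integral_odd_smul hd.odd hi, norm_smul,
    Real.norm_of_nonneg (by norm_num)]
  set B1 := {h : ℝ × ℝ | ‖h‖ ≤ 1 / m}
  set B2 := {h : ℝ × ℝ | (n : ℝ) < ‖h‖}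
  have hB1 : MeasurableSet B1 := measurableSet_norm_le _
  have hB2 : MeasurableSet B2 := measurableSet_lt_norm _
  have vB1 : volume.real B1 = (2 / m) ^ 2 := by
    have : B1 = Metric.closedBall (0 : ℝ) (1 / m) ×ˢ Metric.closedBall (0 : ℝ) (1 / m) := by
      ext h; simp [B1, Prod.norm_def]
    rw [this, Measure.volume_eq_prod, measureReal_prod_prod, Real.closedBall_eq_Icc]
    rw [Real.volume_real_Icc_of_le (by simp; positivity)]
    ring
  have fB1 : volume B1 ≠ ⊤ := by
    have : B1 = Metric.closedBall (0 : ℝ × ℝ) (1 / m) := by ext h; simp [B1]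
    rw [this]; exact measure_closedBall_lt_top.ne
  -- on the inner annulus the integrand is at most `C ε' / ‖h‖² ≤ 4 C ε' m²`
  obtain ⟨c1, hc1⟩ : ∃ c : ℝ, c = ε / (16 * 2) * (4 * m ^ 2) := ⟨_, rfl⟩
  have hc0 : 0 ≤ c1 := by rw [hc1]; positivity
  have j1 : Integrable (B1.indicator fun _ : ℝ × ℝ => c1) :=
    (integrable_indicator_iff hB1).2 (integrableOn_const fB1)
  have k1 : IntegrableOn (fun h => ‖h‖⁻¹ * ‖Φ s h‖) B2 :=
    hT.integrableOn s hs _ (by linarith)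
  have k2 : IntegrableOn (fun h => ‖h‖⁻¹ * ‖Φ s (-h)‖) B2 := by
    simpa using integrableOn_comp_neg (F := fun h => ‖h‖⁻¹ * ‖Φ s h‖) (by simp [B2]) k1
  have j2 : Integrable (B2.indicator fun h : ℝ × ℝ =>
      C * (‖h‖⁻¹ * ‖Φ s h‖ + ‖h‖⁻¹ * ‖Φ s (-h)‖)) :=
    (integrable_indicator_iff hB2).2 ((k1.add k2).const_mul C)
  have hb : ‖∫ h, D n h • (Φ s h - Φ s (-h))‖ ≤ ∫ h, (B1.indicator (fun _ : ℝ × ℝ => c1) h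
        + B2.indicator (fun h : ℝ × ℝ => C * (‖h‖⁻¹ * ‖Φ s h‖ + ‖h‖⁻¹ * ‖Φ s (-h)‖)) h) := by
    refine norm_integral_le_of_norm_le (j1.add j2) ?_
    filter_upwards [compl_mem_ae_iff.2 (measure_singleton (0 : ℝ × ℝ))] with h h0
    have hp : 0 < ‖h‖ := norm_pos_iff.2 h0
    have n1 : 0 ≤ B1.indicator (fun _ : ℝ × ℝ => c1) h :=
      indicator_nonneg (fun _ _ => hc0) _
    have n2 : 0 ≤ B2.indicator
        (fun h : ℝ × ℝ => C * (‖h‖⁻¹ * ‖Φ s h‖ + ‖h‖⁻¹ * ‖Φ s (-h)‖)) h :=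
      indicator_nonneg (fun _ _ => by positivity) _
    rw [norm_smul, Real.norm_eq_abs]
    by_cases m1 : h ∈ B1
    · rw [indicator_of_mem m1]
      rcases le_or_gt ‖h‖ (1 / (2 * m)) with hh | hh
      · rw [hd.inner h hh, abs_zero, zero_mul]
        positivity
      · have e1 : |D n h| * ‖Φ s h - Φ s (-h)‖ ≤ C / ‖h‖ * (ε / (16 * (2 * C)) / ‖h‖) :=
          mul_le_mul (hd.bound h) (Hδ s hs h h0 (le_trans m1 hnδ)) (norm_nonneg _) (by positivity)
        have e2 : C / ‖h‖ * (ε / (16 * (2 * C)) / ‖h‖) = ε / (16 * 2) * (1 / ‖h‖) ^ 2 := by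
          field_simp
        have e3 : 1 / ‖h‖ ≤ 2 * m := by
          rw [div_le_comm₀ hp (by positivity)]; exact hh.le
        have e4 : (1 / ‖h‖) ^ 2 ≤ 4 * m ^ 2 := by
          calc (1 / ‖h‖) ^ 2 ≤ (2 * m) ^ 2 := by gcongr
            _ = _ := by ring
        have e5 : ε / (16 * 2) * (1 / ‖h‖) ^ 2 ≤ c1 := by rw [hc1]; gcongr
        linarith
    by_cases m2 : h ∈ B2
    · rw [indicator_of_mem m2]
      have e1 : |D n h| * ‖Φ s h - Φ s (-h)‖ ≤ C / ‖h‖ * (‖Φ s h‖ + ‖Φ s (-h)‖) :=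
        mul_le_mul (hd.bound h) (norm_sub_le _ _) (norm_nonneg _) (by positivity)
      have e2 : C / ‖h‖ * (‖Φ s h‖ + ‖Φ s (-h)‖)
          = C * (‖h‖⁻¹ * ‖Φ s h‖ + ‖h‖⁻¹ * ‖Φ s (-h)‖) := by rw [div_eq_mul_inv]; ring
      linarith
    rw [hd.middle h (not_le.1 m1) (by have : ‖h‖ ≤ n := not_lt.1 m2
                                      linarith), abs_zero, zero_mul]
    positivity
  rw [integral_add j1 j2, integral_indicator hB1, integral_indicator hB2, integral_const_mul,
    integral_add k1 k2, setIntegral_const, vB1, smul_eq_mul] at hb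
  have t1 : (2 / m) ^ 2 * c1 = ε / 2 := by rw [hc1]; field_simp; norm_num
  have t2 : ∫ h in B2, ‖h‖⁻¹ * ‖Φ s h‖ ≤ ε / (4 * C) := by
    have := HR _ hnR s hs
    simpa using this
  have t3 : ∫ h in B2, ‖h‖⁻¹ * ‖Φ s (-h)‖ = ∫ h in B2, ‖h‖⁻¹ * ‖Φ s h‖ := by
    have := (Measure.measurePreserving_neg (volume : Measure (ℝ × ℝ))).setIntegral_preimage_emb
      (MeasurableEquiv.neg (ℝ × ℝ)).measurableEmbedding (fun h => ‖h‖⁻¹ * ‖Φ s h‖) B2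
    rw [show (Neg.neg : ℝ × ℝ → ℝ × ℝ) ⁻¹' B2 = B2 from ext fun h => by simp [B2]] at this
    simpa using this
  have t4 : C * ((∫ h in B2, ‖h‖⁻¹ * ‖Φ s h‖) + ∫ h in B2, ‖h‖⁻¹ * ‖Φ s (-h)‖) ≤ ε / 2 := by
    rw [t3]
    calc _ ≤ C * (ε / (4 * C) + ε / (4 * C)) := by gcongr
      _ = ε / 2 := by field_simp; norm_num
  rw [t1] at hb
  linarith

theorem integral_partial_α_eq_zero {u u' : ℝ × ℝ → E} (hu : Continuous u)
    (hcu : HasCompactSupport u) (hu' : Continuous u') (hcu' : HasCompactSupport u')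
    (hd : ∀ h : ℝ × ℝ, HasDerivAt (fun r => u (r, h.2)) (u' h) h.1) : ∫ h, u' h = 0 := by
  have hi' := hu'.integrable_of_hasCompactSupport (μ := volume) hcu'
  have hi := hu.integrable_of_hasCompactSupport (μ := volume) hcu
  rw [Measure.volume_eq_prod] at hi hi' ⊢
  rw [integral_prod_symm _ hi']
  refine integral_eq_zero_of_ae ?_
  filter_upwards [hi'.prod_left_ae, hi.prod_left_ae] with y h1 h2
  exact integral_eq_zero_of_hasDerivAt_of_integrable (f := fun x => u (x, y))
    (fun x => hd (x, y)) h1 h2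

theorem integral_partial_β_eq_zero {u u' : ℝ × ℝ → E} (hu : Continuous u)
    (hcu : HasCompactSupport u) (hu' : Continuous u') (hcu' : HasCompactSupport u')
    (hd : ∀ h : ℝ × ℝ, HasDerivAt (fun r => u (h.1, r)) (u' h) h.2) : ∫ h, u' h = 0 := by
  have hi' := hu'.integrable_of_hasCompactSupport (μ := volume) hcu'
  have hi := hu.integrable_of_hasCompactSupport (μ := volume) hcu
  rw [Measure.volume_eq_prod] at hi hi' ⊢
  rw [integral_prod _ hi']
  refine integral_eq_zero_of_ae ?_
  filter_upwards [hi'.prod_right_ae, hi.prod_right_ae] with x h1 h2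
  exact integral_eq_zero_of_hasDerivAt_of_integrable (f := fun y => u (x, y))
    (fun y => hd (x, y)) h1 h2

theorem integrable_cutoff_smul_of_continuousOn {F : ℝ × ℝ → E} (hF : ContinuousOn F {0}ᶜ) (n : ℕ) :
    Integrable (fun h => cutoff n h • F h) :=
  (continuous_smul_of_zero_near (by positivity) (continuous_cutoff n)
    (fun _ => cutoff_eq_zero_of_le) hF).integrable_of_hasCompactSupport
    (hasCompactSupport_of_cutoff (n := n) fun h hh => by rw [cutoff_eq_zero_of_ge hh, zero_smul])

/-- Integration by parts against a cutoff, for a vector field that may be singular at the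
origin. -/
theorem integral_cutoff_div {F G F' G' : ℝ × ℝ → E} (hF : ContinuousOn F {0}ᶜ)
    (hG : ContinuousOn G {0}ᶜ) (hF' : ContinuousOn F' {0}ᶜ) (hG' : ContinuousOn G' {0}ᶜ)
    (hdF : ∀ h ≠ 0, HasDerivAt (fun r => F (r, h.2)) (F' h) h.1)
    (hdG : ∀ h ≠ 0, HasDerivAt (fun r => G (h.1, r)) (G' h) h.2) (n : ℕ) :
    ∫ h, cutoff n h • (F' h + G' h)
      = -(∫ h, dα (cutoff n) h • F h) - ∫ h, dβ (cutoff n) h • G h := by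
  obtain ⟨C, -, hC⟩ := exists_isCutoffGrad
  obtain ⟨hα, hβ⟩ := hC n
  have hχd : Differentiable ℝ (cutoff n) := (contDiff_cutoff n).differentiable one_ne_zero
  have hρ : 0 < 1 / (2 * ((n : ℝ) + 1)) := by positivity
  have z0 : ∀ h : ℝ × ℝ, ‖h‖ ≤ 1 / (2 * ((n : ℝ) + 1)) → cutoff n h = 0 :=
    fun _ => cutoff_eq_zero_of_le
  have cF := continuous_smul_of_zero_near hρ (continuous_cutoff n) z0 hF
  have cG := continuous_smul_of_zero_near hρ (continuous_cutoff n) z0 hG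
  have cF' := continuous_smul_of_zero_near hρ (continuous_cutoff n) z0 hF'
  have cG' := continuous_smul_of_zero_near hρ (continuous_cutoff n) z0 hG'
  have dF := continuous_smul_of_zero_near hρ hα.continuous hα.inner hF
  have dG := continuous_smul_of_zero_near hρ hβ.continuous hβ.inner hG
  have sF : HasCompactSupport fun h => cutoff n h • F h := hasCompactSupport_of_cutoff (n := n)
    fun h hh => by rw [cutoff_eq_zero_of_ge hh, zero_smul]
  have sG : HasCompactSupport fun h => cutoff n h • G h := hasCompactSupport_of_cutoff (n := n)
    fun h hh => by rw [cutoff_eq_zero_of_ge hh, zero_smul]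
  have sF' : HasCompactSupport fun h => cutoff n h • F' h := hasCompactSupport_of_cutoff (n := n)
    fun h hh => by rw [cutoff_eq_zero_of_ge hh, zero_smul]
  have sG' : HasCompactSupport fun h => cutoff n h • G' h := hasCompactSupport_of_cutoff (n := n)
    fun h hh => by rw [cutoff_eq_zero_of_ge hh, zero_smul]
  have tF : HasCompactSupport fun h => dα (cutoff n) h • F h := hasCompactSupport_of_cutoff (n := n)
    fun h hh => by rw [hα.outer h hh, zero_smul]
  have tG : HasCompactSupport fun h => dβ (cutoff n) h • G h := hasCompactSupport_of_cutoff (n := n)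
    fun h hh => by rw [hβ.outer h hh, zero_smul]
  have hz : ∀ r : ℝ, |r| ≤ 1 / (2 * ((n : ℝ) + 1)) → ‖((r, 0) : ℝ × ℝ)‖ ≤ 1 / (2 * ((n : ℝ) + 1))
      ∧ ‖((0, r) : ℝ × ℝ)‖ ≤ 1 / (2 * ((n : ℝ) + 1)) := fun r hr => by
    simpa [Prod.norm_def] using hr
  have hnear : ∀ᶠ r : ℝ in 𝓝 0, |r| ≤ 1 / (2 * ((n : ℝ) + 1)) := by
    filter_upwards [Metric.closedBall_mem_nhds (0 : ℝ) hρ] with r hr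
    simpa using hr
  have eF : ∫ h, (cutoff n h • F' h + dα (cutoff n) h • F h) = 0 := by
    refine integral_partial_α_eq_zero cF sF (cF'.add dF) (sF'.add tF) fun h => ?_
    rcases eq_or_ne h 0 with rfl | h0
    · rw [z0 0 (by simpa using hρ.le), hα.inner 0 (by simpa using hρ.le), zero_smul, zero_smul,
        add_zero]
      refine (hasDerivAt_const (0 : ℝ) (0 : E)).congr_of_eventuallyEq ?_
      filter_upwards [hnear] with r hr
      rw [Prod.snd_zero, z0 _ (hz r hr).1, zero_smul]
    · exact (hχd h).hasDerivAt_dα.smul (hdF h h0)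
  have eG : ∫ h, (cutoff n h • G' h + dβ (cutoff n) h • G h) = 0 := by
    refine integral_partial_β_eq_zero cG sG (cG'.add dG) (sG'.add tG) fun h => ?_
    rcases eq_or_ne h 0 with rfl | h0
    · rw [z0 0 (by simpa using hρ.le), hβ.inner 0 (by simpa using hρ.le), zero_smul, zero_smul,
        add_zero]
      refine (hasDerivAt_const (0 : ℝ) (0 : E)).congr_of_eventuallyEq ?_
      filter_upwards [hnear] with r hr
      rw [Prod.fst_zero, z0 _ (hz r hr).2, zero_smul]
    · exact (hχd h).hasDerivAt_dβ.smul (hdG h h0)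
  have iF' := cF'.integrable_of_hasCompactSupport (μ := volume) sF'
  have iG' := cG'.integrable_of_hasCompactSupport (μ := volume) sG'
  rw [integral_add iF' (dF.integrable_of_hasCompactSupport tF)] at eF
  rw [integral_add iG' (dG.integrable_of_hasCompactSupport tG)] at eG
  simp only [smul_add]
  rw [integral_add iF' iG', eq_neg_of_add_eq_zero_left eF, eq_neg_of_add_eq_zero_left eG]
  abel

end Parts

section Differentiate

variable {E : Type*} [NormedAddCommGroup E] [NormedSpace ℝ E] {a b : ℝ}

theorem hasDerivWithinAt_integral {X : Type*} [MeasurableSpace X] {μ : Measure X}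
    {Ψ Φ : ℝ → X → E} {J : Set ℝ} (hJ : Convex ℝ J) {bound : X → ℝ} (hb : Integrable bound μ)
    (hΨ : ∀ s ∈ J, Integrable (Ψ s) μ)
    (hd : ∀ s ∈ J, ∀ x, HasDerivWithinAt (fun r => Ψ r x) (Φ s x) J s)
    (hΦ : ∀ s ∈ J, ∀ x, ‖Φ s x‖ ≤ bound x) {s : ℝ} (hs : s ∈ J) :
    HasDerivWithinAt (fun r => ∫ x, Ψ r x ∂μ) (∫ x, Φ s x ∂μ) J s := by
  rw [hasDerivWithinAt_iff_tendsto_slope]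
  have ht : Tendsto (fun r => ∫ x, slope (fun r => Ψ r x) s r ∂μ) (𝓝[J \ {s}] s)
      (𝓝 (∫ x, Φ s x ∂μ)) := by
    refine tendsto_integral_filter_of_dominated_convergence bound ?_ ?_ hb
      (ae_of_all _ fun x => hasDerivWithinAt_iff_tendsto_slope.1 (hd s hs x))
    · filter_upwards [self_mem_nhdsWithin] with r hr
      exact (((hΨ r hr.1).sub (hΨ s hs)).smul _).aestronglyMeasurable
    · filter_upwards [self_mem_nhdsWithin] with r hr
      refine ae_of_all _ fun x => ?_
      have := hJ.norm_image_sub_le_of_norm_hasDerivWithin_le (fun t ht => hd t ht x)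
        (fun t ht => hΦ t ht x) hs hr.1
      have h0 : 0 < ‖r - s‖ := norm_pos_iff.2 (sub_ne_zero.2 hr.2)
      rw [slope_def_module, norm_smul, norm_inv, inv_mul_le_iff₀ h0, mul_comm]
      exact this
  refine ht.congr' ?_
  filter_upwards [self_mem_nhdsWithin] with r hr
  rw [slope_def_module, ← integral_sub (hΨ r hr.1) (hΨ s hs), ← integral_smul]
  simp only [slope_def_module]

/-- Differentiation under a uniform limit of the derivatives, on a convex set of real numbers that
need not be open, such as a closed time interval. -/
theorem hasDerivWithinAt_of_tendstoUniformlyOn {F G : ℕ → ℝ → E} {f g : ℝ → E} {J : Set ℝ}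
    (hJ : Convex ℝ J) (hF : ∀ n, ∀ s ∈ J, HasDerivWithinAt (F n) (G n s) J s)
    (hf : ∀ s ∈ J, Tendsto (fun n => F n s) atTop (𝓝 (f s))) (hg : TendstoUniformlyOn G g atTop J)
    {s : ℝ} (hs : s ∈ J) : HasDerivWithinAt f (g s) J s := by
  rw [hasDerivWithinAt_iff_isLittleO, Asymptotics.isLittleO_iff]
  intro c hc
  have hu := Metric.tendstoUniformlyOn_iff.1 hg (c / 4) (by positivity)
  obtain ⟨n, hn⟩ := eventually_atTop.1 hu
  have h1 := (Asymptotics.isLittleO_iff.1 (hasDerivWithinAt_iff_isLittleO.1 (hF n s hs)))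
    (show 0 < c / 4 by positivity)
  filter_upwards [h1, self_mem_nhdsWithin] with r hr hrJ
  have hdiff : ∀ m ≥ n, ‖(F m r - F n r) - (F m s - F n s)‖ ≤ c / 2 * ‖r - s‖ := by
    intro m hm
    refine hJ.norm_image_sub_le_of_norm_hasDerivWithin_le (f := fun t => F m t - F n t)
      (fun t ht => (hF m t ht).sub (hF n t ht)) (fun t ht => ?_) hs hrJ
    have a1 := hn m hm t ht
    have a2 := hn n le_rfl t ht
    rw [dist_comm, dist_eq_norm] at a1
    rw [dist_eq_norm] at a2
    calc ‖G m t - G n t‖ = ‖(G m t - g t) + (g t - G n t)‖ := by congr 1; abel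
      _ ≤ c / 2 := (norm_add_le _ _).trans (by linarith)
  have hlim : ‖(f r - F n r) - (f s - F n s)‖ ≤ c / 2 * ‖r - s‖ :=
    le_of_tendsto ((((hf r hrJ).sub_const _).sub ((hf s hs).sub_const _)).norm)
      (eventually_atTop.2 ⟨n, hdiff⟩)
  have hgs : ‖(r - s) • (G n s - g s)‖ ≤ c / 4 * ‖r - s‖ := by
    have := hn n le_rfl s hs
    rw [dist_comm, dist_eq_norm] at this
    rw [norm_smul, mul_comm]
    gcongr
  have e : f r - f s - (r - s) • g s = ((f r - F n r) - (f s - F n s))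
      + (F n r - F n s - (r - s) • G n s) + (r - s) • (G n s - g s) := by
    rw [smul_sub]; abel
  rw [e]
  calc _ ≤ ‖(f r - F n r) - (f s - F n s)‖ + ‖F n r - F n s - (r - s) • G n s‖
        + ‖(r - s) • (G n s - g s)‖ := norm_add₃_le
    _ ≤ _ := by linarith

/-- Differentiation under a symmetrically regularized singular integral. -/
theorem hasDerivWithinAt_of_cutoff {Ψ Φ : ℝ → ℝ × ℝ → E} {L L' : ℝ → E}
    (hd : ∀ s ∈ Icc a b, ∀ h ≠ 0, HasDerivWithinAt (fun r => Ψ r h) (Φ s h) (Icc a b) s)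
    (hΨ : ∀ s ∈ Icc a b, ContinuousOn (Ψ s) {0}ᶜ)
    (hΦ : ContinuousOn (joint Φ) (Icc a b ×ˢ {0}ᶜ))
    (hL : ∀ s ∈ Icc a b, Tendsto (fun n => ∫ h, cutoff n h • Ψ s h) atTop (𝓝 (L s)))
    (hL' : TendstoUniformlyOn (fun n s => ∫ h, cutoff n h • Φ s h) L' atTop (Icc a b))
    {s : ℝ} (hs : s ∈ Icc a b) : HasDerivWithinAt L (L' s) (Icc a b) s := by
  refine hasDerivWithinAt_of_tendstoUniformlyOn (convex_Icc a b) (fun n s hs => ?_) hL hL' hs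
  set ρ : ℝ := 1 / (2 * ((n : ℝ) + 1))
  have hρ : 0 < ρ := by positivity
  set A : Set (ℝ × ℝ) := Metric.closedBall 0 (2 * ((n : ℝ) + 1)) ∩ {h | ρ ≤ ‖h‖}
  have hA : IsCompact A :=
    (isCompact_closedBall _ _).inter_right (isClosed_le continuous_const continuous_norm)
  obtain ⟨C, hC⟩ := (isCompact_Icc (a := a) (b := b)).prod hA |>.exists_bound_of_continuousOn
    (hΦ.mono (prod_mono_right fun h hh => norm_pos_iff.1 (hρ.trans_le hh.2)))
  refine hasDerivWithinAt_integral (Φ := fun s h => cutoff n h • Φ s h) (convex_Icc a b)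
    (bound := (Metric.closedBall 0 (2 * ((n : ℝ) + 1))).indicator fun _ => |C|) ?_
    (fun s hs => integrable_cutoff_smul_of_continuousOn (hΨ s hs) n) ?_ ?_ hs
  · exact (integrable_indicator_iff measurableSet_closedBall).2
      (integrableOn_const measure_closedBall_lt_top.ne)
  · intro s hs h
    rcases eq_or_ne h 0 with rfl | h0
    · simp only [cutoff_eq_zero_of_le (show ‖(0 : ℝ × ℝ)‖ ≤ 1 / (2 * ((n : ℝ) + 1)) by
        rw [norm_zero]; exact hρ.le), zero_smul]
      simpa using hasDerivWithinAt_const s (Icc a b) (0 : E)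
    · exact (hd s hs h h0).const_smul _
  · intro s hs h
    have hz : 0 ≤ (Metric.closedBall (0 : ℝ × ℝ) (2 * ((n : ℝ) + 1))).indicator (fun _ => |C|) h :=
      indicator_nonneg (fun _ _ => abs_nonneg C) _
    by_cases m1 : ‖h‖ ≤ ρ
    · rwa [cutoff_eq_zero_of_le m1, zero_smul, norm_zero]
    by_cases m2 : ‖h‖ ≤ 2 * ((n : ℝ) + 1)
    · have hm : h ∈ Metric.closedBall (0 : ℝ × ℝ) (2 * ((n : ℝ) + 1)) := by simpa using m2
      rw [indicator_of_mem hm, norm_smul, Real.norm_of_nonneg (cutoff_nonneg n h)]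
      have := hC (s, h) ⟨hs, hm, (not_le.1 m1).le⟩
      calc _ ≤ 1 * |C| := mul_le_mul (cutoff_le_one n h) (this.trans (le_abs_self C))
            (norm_nonneg _) zero_le_one
        _ = _ := one_mul _
    · rwa [cutoff_eq_zero_of_ge (not_le.1 m2).le, zero_smul, norm_zero]

end Differentiate

/-! ### Singular integrals over a moving surface, at the base point `0` -/

section Moving

/-- A surface `X s` moving with velocity `V s` during the parameter interval `[a, b]`: jointly of
class `C²`, chord-arc at the base point `0`, with bounded tangent vectors and bounded velocity. -/
structure Motion (a b κ Λ B : ℝ) (X V : ℝ → ℝ × ℝ → ℍ[ℝ]) : Prop where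
  lt : a < b
  pos : 0 < κ
  vec : ∀ s ∈ Icc a b, ∀ q, (X s q).re = 0
  reg : ContDiffOn ℝ 2 (joint X) (slab a b)
  deriv : ∀ s ∈ Icc a b, ∀ q, HasDerivWithinAt (fun r => X r q) (V s q) (Icc a b) s
  chord : ∀ s ∈ Icc a b, ∀ h, κ * ‖h‖ ≤ ‖X s h - X s 0‖
  tan_α : ∀ s ∈ Icc a b, ∀ q, ‖dα (X s) q‖ ≤ Λ
  tan_β : ∀ s ∈ Icc a b, ∀ q, ‖dβ (X s) q‖ ≤ Λ
  vel : ∀ s ∈ Icc a b, ∀ q, ‖V s q‖ ≤ B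

/-- A density `f s` with parameter derivative `fs s` whose Hilbert transform over a moving surface
can be differentiated: both are jointly of class `C¹`, the gradient of `f` and `fs` are bounded in
`L²` uniformly in the parameter, and `f` itself decays in the weak sense that its integrals against
`‖h‖⁻²` at infinity converge and those against `‖h‖⁻³` converge uniformly. -/
structure Density (a b B : ℝ) (f fs : ℝ → ℝ × ℝ → ℍ[ℝ]) : Prop where
  reg : ContDiffOn ℝ 1 (joint f) (slab a b)
  reg_deriv : ContDiffOn ℝ 1 (joint fs) (slab a b)
  deriv : ∀ s ∈ Icc a b, ∀ q, HasDerivWithinAt (fun r => f r q) (fs s q) (Icc a b) s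
  integrableOn : ∀ s ∈ Icc a b, ∀ ρ > 0,
    IntegrableOn (fun h : ℝ × ℝ => (‖h‖ ^ 2)⁻¹ * ‖f s h‖) {h | ρ < ‖h‖}
  majorant : ∃ g : ℝ × ℝ → ℝ, (∀ ρ > 0, IntegrableOn (fun h : ℝ × ℝ => (‖h‖ ^ 3)⁻¹ * g h)
    {h | ρ < ‖h‖}) ∧ ∀ s ∈ Icc a b, ∀ h, ‖f s h‖ ≤ g h
  L2_α : ∀ s ∈ Icc a b, eLpNorm (dα (f s)) 2 volume ≤ ENNReal.ofReal B
  L2_β : ∀ s ∈ Icc a b, eLpNorm (dβ (f s)) 2 volume ≤ ENNReal.ofReal B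
  L2_deriv : ∀ s ∈ Icc a b, eLpNorm (fs s) 2 volume ≤ ENNReal.ofReal B

/-- A singular integrand `K(X' - X) g'` at the base point `0`. -/
def kernelIntegrand (X g : ℝ → ℝ × ℝ → ℍ[ℝ]) (s : ℝ) (h : ℝ × ℝ) : ℍ[ℝ] :=
  K (X s h - X s 0) * g s h

variable {a b κ Λ B : ℝ} {X V f fs g : ℝ → ℝ × ℝ → ℍ[ℝ]}

theorem continuousOn_slice {E : Type*} [TopologicalSpace E] {F : ℝ → ℝ × ℝ → E}
    {A : Set (ℝ × ℝ)} (hF : ContinuousOn (fun y : ℝ × (ℝ × ℝ) => F y.1 y.2) (Icc a b ×ˢ A)) {s : ℝ}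
    (hs : s ∈ Icc a b) : ContinuousOn (F s) A :=
  hF.comp (f := fun q : ℝ × ℝ => (s, q)) (by fun_prop) fun _ hq => ⟨hs, hq⟩

theorem _root_.ContinuousOn.punctured {E : Type*} [TopologicalSpace E] {F : ℝ × (ℝ × ℝ) → E}
    (hF : ContinuousOn F (slab a b)) : ContinuousOn F (Icc a b ×ˢ {0}ᶜ) :=
  hF.mono (prod_mono_right (subset_univ _))

theorem ContDiffOn.continuous_slice {E : Type*} [NormedAddCommGroup E] [NormedSpace ℝ E]
    {F : ℝ → ℝ × ℝ → E} (hF : ContinuousOn (joint F) (slab a b)) {s : ℝ} (hs : s ∈ Icc a b) :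
    Continuous (F s) := by
  rw [← continuousOn_univ]; exact continuousOn_slice hF hs

theorem continuousOn_base {E : Type*} [NormedAddCommGroup E]
    {F : ℝ → ℝ × ℝ → E} (hF : ContinuousOn (joint F) (slab a b)) :
    ContinuousOn (fun y : ℝ × (ℝ × ℝ) => F y.1 y.2 - F y.1 0) (slab a b) := by
  have h1 : ContinuousOn (fun y : ℝ × (ℝ × ℝ) => F y.1 0) (slab a b) :=
    hF.comp (f := fun y : ℝ × (ℝ × ℝ) => (y.1, (0 : ℝ × ℝ))) (by fun_prop)
      fun y hy => mem_slab hy.1 0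
  exact ContinuousOn.sub hF h1

namespace Motion

theorem reg_one (hM : Motion a b κ Λ B X V) : ContDiffOn ℝ 1 (joint X) (slab a b) :=
  hM.reg.of_le one_le_two

theorem regV (hM : Motion a b κ Λ B X V) : ContDiffOn ℝ 1 (joint V) (slab a b) :=
  contDiffOn_paramDeriv hM.lt hM.reg hM.deriv

theorem regα (hM : Motion a b κ Λ B X V) : ContDiffOn ℝ 1 (joint fun s => dα (X s)) (slab a b) :=
  contDiffOn_dα hM.lt hM.reg

theorem regβ (hM : Motion a b κ Λ B X V) : ContDiffOn ℝ 1 (joint fun s => dβ (X s)) (slab a b) :=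
  contDiffOn_dβ hM.lt hM.reg

theorem reg_normal (hM : Motion a b κ Λ B X V) :
    ContDiffOn ℝ 1 (joint fun s => normal (X s)) (slab a b) :=
  contDiffOn_cross hM.regα hM.regβ

theorem Λ_nonneg (hM : Motion a b κ Λ B X V) : 0 ≤ Λ :=
  (norm_nonneg _).trans (hM.tan_α a ⟨le_rfl, hM.lt.le⟩ 0)

theorem B_nonneg (hM : Motion a b κ Λ B X V) : 0 ≤ B :=
  (norm_nonneg _).trans (hM.vel a ⟨le_rfl, hM.lt.le⟩ 0)

theorem norm_normal_le (hM : Motion a b κ Λ B X V) {s : ℝ} (hs : s ∈ Icc a b) (q : ℝ × ℝ) :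
    ‖normal (X s) q‖ ≤ Λ * Λ :=
  (norm_cross_le _ _).trans (mul_le_mul (hM.tan_α s hs q) (hM.tan_β s hs q) (norm_nonneg _)
    hM.Λ_nonneg)

theorem pos_of_ne (hM : Motion a b κ Λ B X V) {h : ℝ × ℝ} (h0 : h ≠ 0) : 0 < κ * ‖h‖ :=
  mul_pos hM.pos (norm_pos_iff.2 h0)

theorem ne (hM : Motion a b κ Λ B X V) {s : ℝ} (hs : s ∈ Icc a b) {h : ℝ × ℝ} (h0 : h ≠ 0) :
    X s h - X s 0 ≠ 0 :=
  norm_pos_iff.1 ((hM.pos_of_ne h0).trans_le (hM.chord s hs h))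

theorem norm_K_le (hM : Motion a b κ Λ B X V) {s : ℝ} (hs : s ∈ Icc a b) {h : ℝ × ℝ} (h0 : h ≠ 0) :
    ‖K (X s h - X s 0)‖ ≤ cK / κ ^ 2 * (‖h‖ ^ 2)⁻¹ := by
  refine (WaterWave.norm_K_le (hM.pos_of_ne h0) (hM.chord s hs h)).trans_eq ?_
  rw [mul_pow, ← div_div, div_eq_mul_inv _ (‖h‖ ^ 2)]

theorem continuousOn_K (hM : Motion a b κ Λ B X V) :
    ContinuousOn (fun y : ℝ × (ℝ × ℝ) => K (X y.1 y.2 - X y.1 0)) (Icc a b ×ˢ {0}ᶜ) :=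
  WaterWave.continuousOn_K.comp (continuousOn_base hM.reg.continuousOn).punctured
    fun _ hy => hM.ne hy.1 hy.2

/-- The kernel is odd up to a weakly singular error. -/
theorem exists_K_add_le (hM : Motion a b κ Λ B X V) :
    ∃ A, 0 ≤ A ∧ ∀ s ∈ Icc a b, ∀ h ≠ 0, ‖h‖ ≤ 1 →
      ‖K (X s h - X s 0) + K (X s (-h) - X s 0)‖ ≤ A / ‖h‖ := by
  obtain ⟨A, hA0, hA⟩ := exists_second_diff_le hM.lt hM.reg
  have hc := cK_pos
  have hk := hM.pos
  refine ⟨4 * cK * A / κ ^ 3, by positivity, fun s hs h h0 h1 => ?_⟩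
  have hp : 0 < ‖h‖ := norm_pos_iff.2 h0
  set x := X s h - X s 0
  set y := X s (-h) - X s 0
  have hx : κ * ‖h‖ ≤ ‖x‖ := hM.chord s hs h
  have hy : κ * ‖h‖ ≤ ‖-y‖ := by simpa using hM.chord s hs (-h)
  have h2 : ‖x - -y‖ ≤ A * ‖h‖ ^ 2 := by
    have e : x - -y = X s h + X s (-h) - (2 : ℝ) • X s 0 := by
      simp only [x, y, two_smul]; abel
    rw [e]; exact hA s hs h h1
  have h3 := norm_K_sub_le (hM.pos_of_ne h0) hx hy
  rw [K_neg, sub_neg_eq_add] at h3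
  calc _ ≤ 4 * cK / (κ * ‖h‖) ^ 3 * (A * ‖h‖ ^ 2) := h3.trans (by gcongr)
    _ = _ := by field_simp

theorem continuousOn_kernelIntegrand (hM : Motion a b κ Λ B X V)
    (hg : ContinuousOn (joint g) (slab a b)) :
    ContinuousOn (joint (kernelIntegrand X g)) (Icc a b ×ˢ {0}ᶜ) :=
  hM.continuousOn_K.mul hg.punctured

/-- For a `C¹` density the even part of the singular integrand is only weakly singular. -/
theorem exists_symm_le (hM : Motion a b κ Λ B X V) (hg : ContDiffOn ℝ 1 (joint g) (slab a b)) :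
    ∃ A, ∀ s ∈ Icc a b, ∀ h ≠ 0, ‖h‖ ≤ 1 →
      ‖kernelIntegrand X g s h + kernelIntegrand X g s (-h)‖ ≤ A / ‖h‖ := by
  obtain ⟨A, hA0, hA⟩ := hM.exists_K_add_le
  obtain ⟨A', hA'0, hA'⟩ := exists_lipschitz hM.lt hg
  obtain ⟨G, hG0, hG⟩ := exists_bound_of_continuousOn hg.continuousOn 1
  have hc := cK_pos
  have hk := hM.pos
  refine ⟨A * G + cK / κ ^ 2 * (A' * 2), fun s hs h h0 h1 => ?_⟩
  have hp : 0 < ‖h‖ := norm_pos_iff.2 h0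
  have e : kernelIntegrand X g s h + kernelIntegrand X g s (-h)
      = (K (X s h - X s 0) + K (X s (-h) - X s 0)) * g s h
        + K (X s (-h) - X s 0) * (g s (-h) - g s h) := by
    unfold kernelIntegrand; noncomm_ring
  have h2 : ‖g s (-h) - g s h‖ ≤ A' * (2 * ‖h‖) := by
    refine (hA' s hs (-h) h (by simpa) h1).trans ?_
    gcongr
    refine (norm_sub_le _ _).trans ?_
    rw [norm_neg]; linarith
  have h3 := hM.norm_K_le hs (h := -h) (neg_ne_zero.2 h0)
  rw [norm_neg] at h3
  rw [e]
  refine (norm_add_le _ _).trans ?_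
  rw [norm_mul, norm_mul]
  calc _ ≤ A / ‖h‖ * G + cK / κ ^ 2 * (‖h‖ ^ 2)⁻¹ * (A' * (2 * ‖h‖)) := by
        gcongr
        · exact hA s hs h h0 h1
        · exact hG s hs h h1
    _ = _ := by field_simp

theorem norm_kernelIntegrand_le (hM : Motion a b κ Λ B X V) {s : ℝ} (hs : s ∈ Icc a b) {h : ℝ × ℝ}
    (h0 : h ≠ 0) : ‖kernelIntegrand X g s h‖ ≤ cK / κ ^ 2 * ((‖h‖ ^ 2)⁻¹ * ‖g s h‖) := by
  rw [kernelIntegrand, norm_mul, ← mul_assoc]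
  gcongr
  exact hM.norm_K_le hs h0

theorem unifTail_kernelIntegrand (hM : Motion a b κ Λ B X V)
    (hg : ContinuousOn (joint g) (slab a b)) {J : Set ℝ} (hJ : J ⊆ Icc a b)
    (hT : UnifTail J fun s h => (‖h‖ ^ 2)⁻¹ * ‖g s h‖) : UnifTail J (kernelIntegrand X g) :=
  (hT.const_mul (cK / κ ^ 2)).mono
    (fun _ hs => continuousOn_slice (hM.continuousOn_kernelIntegrand hg) (hJ hs))
    (fun _ hs _ h0 => hM.norm_kernelIntegrand_le (hJ hs) h0)

theorem unifTail_singleton {s : ℝ}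
    (hi : ∀ ρ > 0, IntegrableOn (fun h : ℝ × ℝ => (‖h‖ ^ 2)⁻¹ * ‖g s h‖) {h | ρ < ‖h‖}) :
    UnifTail {s} fun s (h : ℝ × ℝ) => (‖h‖ ^ 2)⁻¹ * ‖g s h‖ := by
  have := UnifTail.const (I := ({s} : Set ℝ)) hi
  exact ⟨fun r hr => by rw [mem_singleton_iff.1 hr]; exact hi, fun ε hε =>
    (this.tail ε hε).imp fun R hR => ⟨hR.1, fun r hr => by
      rw [mem_singleton_iff.1 hr]; exact hR.2 s rfl⟩⟩

theorem hasPV_kernelIntegrand (hM : Motion a b κ Λ B X V)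
    (hg : ContDiffOn ℝ 1 (joint g) (slab a b)) {s : ℝ} (hs : s ∈ Icc a b)
    (hi : ∀ ρ > 0, IntegrableOn (fun h : ℝ × ℝ => (‖h‖ ^ 2)⁻¹ * ‖g s h‖) {h | ρ < ‖h‖}) :
    HasPV (kernelIntegrand X g s) 0 (symmIntegral (kernelIntegrand X g s)) := by
  obtain ⟨A, hA⟩ := hM.exists_symm_le hg
  have hT := hM.unifTail_kernelIntegrand hg.continuousOn (singleton_subset_iff.2 hs)
    (unifTail_singleton hi)
  exact hasPV_symmIntegral (hT.integrableOn s rfl) (hA s hs)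

theorem tendsto_cutoff_kernelIntegrand (hM : Motion a b κ Λ B X V)
    (hg : ContDiffOn ℝ 1 (joint g) (slab a b)) {s : ℝ} (hs : s ∈ Icc a b)
    (hi : ∀ ρ > 0, IntegrableOn (fun h : ℝ × ℝ => (‖h‖ ^ 2)⁻¹ * ‖g s h‖) {h | ρ < ‖h‖}) :
    Tendsto (fun n => ∫ h, cutoff n h • kernelIntegrand X g s h) atTop
      (𝓝 (symmIntegral (kernelIntegrand X g s))) := by
  obtain ⟨A, hA⟩ := hM.exists_symm_le hg
  have hT := hM.unifTail_kernelIntegrand hg.continuousOn (singleton_subset_iff.2 hs)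
    (unifTail_singleton hi)
  exact (tendstoUniformlyOn_cutoff (I := {s}) (A := A) (Φ := kernelIntegrand X g)
    (fun r hr => by rw [mem_singleton_iff.1 hr]; exact hA s hs) hT).tendsto_at rfl

/-- The odd part of the flux through small circles: the velocity difference is odd to first order,
as is the kernel, so their product is even up to `o(1/‖h‖)`. -/
theorem exists_flux_antisymm_le (hM : Motion a b κ Λ B X V) {Y : ℝ → ℝ × ℝ → ℍ[ℝ]}
    (hY : ContDiffOn ℝ 1 (joint Y) (slab a b)) (hf : ContDiffOn ℝ 1 (joint f) (slab a b)) {ε : ℝ}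
    (hε : 0 < ε) :
    ∃ δ > 0, ∀ s ∈ Icc a b, ∀ h ≠ 0, ‖h‖ ≤ δ →
      ‖kernelIntegrand X (fun s q => cross (V s q - V s 0) (Y s q) * f s q) s h
        - kernelIntegrand X (fun s q => cross (V s q - V s 0) (Y s q) * f s q) s (-h)‖
          ≤ ε / ‖h‖ := by
  obtain ⟨A, hA0, hA⟩ := hM.exists_K_add_le
  obtain ⟨C, hC0, hC⟩ := exists_bound_of_continuousOn hY.continuousOn 1
  obtain ⟨C', hC'0, hC'⟩ := exists_bound_of_continuousOn hf.continuousOn 1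
  obtain ⟨L, hL0, hL⟩ := exists_lipschitz hM.lt hM.regV
  obtain ⟨L₁, hL₁0, hL₁⟩ := exists_lipschitz hM.lt hY
  obtain ⟨L₂, hL₂0, hL₂⟩ := exists_lipschitz hM.lt hf
  have hc := cK_pos
  have hk := hM.pos
  set c := cK / κ ^ 2 with hcdef
  have hc' : 0 < c := by positivity
  obtain ⟨δ, hδ, Hδ⟩ := exists_second_diff_le_eps hM.lt hM.regV
    (ε := ε / (2 * (c * C * C' + 1))) (by positivity)
  set Q : ℝ := A * L * C * C' + c * (L * (2 * L₁) * C' + L * C * (2 * L₂))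
  have hQ : 0 ≤ Q := by positivity
  refine ⟨min (min δ 1) (ε / (2 * (Q + 1))), by positivity, fun s hs h h0 hh => ?_⟩
  have hp : 0 < ‖h‖ := norm_pos_iff.2 h0
  have hh1 : ‖h‖ ≤ 1 := hh.trans ((min_le_left _ _).trans (min_le_right _ _))
  have hhδ : ‖h‖ ≤ δ := hh.trans ((min_le_left _ _).trans (min_le_left _ _))
  have hhQ : ‖h‖ ≤ ε / (2 * (Q + 1)) := hh.trans (min_le_right _ _)
  have hn1 : ‖-h‖ ≤ 1 := by rwa [norm_neg]
  have h2 : ‖-h - h‖ ≤ 2 * ‖h‖ := by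
    refine (norm_sub_le _ _).trans ?_
    rw [norm_neg]; linarith
  set η := V s h - V s 0 with hη
  set η' := V s (-h) - V s 0 with hη'
  set k := K (X s h - X s 0)
  set k' := K (X s (-h) - X s 0)
  have e : kernelIntegrand X (fun s q => cross (V s q - V s 0) (Y s q) * f s q) s h
        - kernelIntegrand X (fun s q => cross (V s q - V s 0) (Y s q) * f s q) s (-h)
      = (k + k') * (cross η (Y s h) * f s h) - k' * (cross (η + η') (Y s h) * f s h)
        - k' * (cross η' (Y s (-h) - Y s h) * f s (-h))
        - k' * (cross η' (Y s h) * (f s (-h) - f s h)) := by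
    simp only [kernelIntegrand, cross_sub_right, cross_add_left]
    noncomm_ring
  have bη : ‖η‖ ≤ L * ‖h‖ := by simpa using hL s hs h 0 hh1 (by simp)
  have bη' : ‖η'‖ ≤ L * ‖h‖ := by simpa using hL s hs (-h) 0 hn1 (by simp)
  have bηη : ‖η + η'‖ ≤ ε / (2 * (c * C * C' + 1)) * ‖h‖ := by
    have e1 : η + η' = V s h + V s (-h) - (2 : ℝ) • V s 0 := by
      simp only [hη, hη', two_smul]; abel
    rw [e1]; exact Hδ s hs h hhδ
  have bY := hC s hs h hh1
  have bf := hC' s hs h hh1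
  have bf' := hC' s hs (-h) hn1
  have bYY : ‖Y s (-h) - Y s h‖ ≤ L₁ * (2 * ‖h‖) := (hL₁ s hs _ _ hn1 hh1).trans (by gcongr)
  have bff : ‖f s (-h) - f s h‖ ≤ L₂ * (2 * ‖h‖) := (hL₂ s hs _ _ hn1 hh1).trans (by gcongr)
  have bk : ‖k'‖ ≤ c * (‖h‖ ^ 2)⁻¹ := by
    have := hM.norm_K_le hs (h := -h) (neg_ne_zero.2 h0)
    rwa [norm_neg] at this
  have bkk : ‖k + k'‖ ≤ A / ‖h‖ := hA s hs h h0 hh1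
  have t1 : ‖(k + k') * (cross η (Y s h) * f s h)‖ ≤ A / ‖h‖ * (L * ‖h‖ * C * C') := by
    rw [norm_mul, norm_mul]
    have := norm_cross_le η (Y s h)
    gcongr
    exact this.trans (by gcongr)
  have t2 : ‖k' * (cross (η + η') (Y s h) * f s h)‖
      ≤ c * (‖h‖ ^ 2)⁻¹ * (ε / (2 * (c * C * C' + 1)) * ‖h‖ * C * C') := by
    rw [norm_mul, norm_mul]
    have := norm_cross_le (η + η') (Y s h)
    gcongr
    exact this.trans (by gcongr)
  have t3 : ‖k' * (cross η' (Y s (-h) - Y s h) * f s (-h))‖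
      ≤ c * (‖h‖ ^ 2)⁻¹ * (L * ‖h‖ * (L₁ * (2 * ‖h‖)) * C') := by
    rw [norm_mul, norm_mul]
    have := norm_cross_le η' (Y s (-h) - Y s h)
    gcongr
    exact this.trans (by gcongr)
  have t4 : ‖k' * (cross η' (Y s h) * (f s (-h) - f s h))‖
      ≤ c * (‖h‖ ^ 2)⁻¹ * (L * ‖h‖ * C * (L₂ * (2 * ‖h‖))) := by
    rw [norm_mul, norm_mul]
    have := norm_cross_le η' (Y s h)
    gcongr
    exact this.trans (by gcongr)
  have u2 : c * (‖h‖ ^ 2)⁻¹ * (ε / (2 * (c * C * C' + 1)) * ‖h‖ * C * C') ≤ ε / 2 / ‖h‖ := by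
    have e1 : c * (‖h‖ ^ 2)⁻¹ * (ε / (2 * (c * C * C' + 1)) * ‖h‖ * C * C')
        = c * C * C' * (ε / (2 * (c * C * C' + 1))) / ‖h‖ := by field_simp
    rw [e1]
    gcongr
    calc c * C * C' * (ε / (2 * (c * C * C' + 1)))
        ≤ (c * C * C' + 1) * (ε / (2 * (c * C * C' + 1))) := by gcongr; linarith
      _ = ε / 2 := by field_simp
  have u1 : A / ‖h‖ * (L * ‖h‖ * C * C') + c * (‖h‖ ^ 2)⁻¹ * (L * ‖h‖ * (L₁ * (2 * ‖h‖)) * C')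
      + c * (‖h‖ ^ 2)⁻¹ * (L * ‖h‖ * C * (L₂ * (2 * ‖h‖))) ≤ ε / 2 / ‖h‖ := by
    have e1 : A / ‖h‖ * (L * ‖h‖ * C * C') + c * (‖h‖ ^ 2)⁻¹ * (L * ‖h‖ * (L₁ * (2 * ‖h‖)) * C')
      + c * (‖h‖ ^ 2)⁻¹ * (L * ‖h‖ * C * (L₂ * (2 * ‖h‖))) = Q := by
      simp only [Q]; field_simp; ring
    rw [e1, le_div_iff₀ hp]
    calc Q * ‖h‖ ≤ (Q + 1) * (ε / (2 * (Q + 1))) := by gcongr; linarith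
      _ = ε / 2 := by field_simp
  rw [e]
  refine (norm_sub_le _ _).trans ?_
  refine (add_le_add_left ((norm_sub_le _ _).trans (add_le_add_left (norm_sub_le _ _) _)) _).trans ?_
  have e5 : ε / ‖h‖ = ε / 2 / ‖h‖ + ε / 2 / ‖h‖ := by ring
  linarith

end Motion

end Moving

/-! ### Weakly singular families of integrands -/

section WeaklySingular

variable {a b κ Λ B : ℝ} {X V f fs g η k F G : ℝ → ℝ × ℝ → ℍ[ℝ]}

/-- A family of integrands with an integrable singularity `O(1/‖h‖)` at the origin and uniformly
small integrals at infinity. -/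
structure WeaklySingular (a b : ℝ) (F : ℝ → ℝ × ℝ → ℍ[ℝ]) : Prop where
  core : ∃ A, ∀ s ∈ Icc a b, ∀ h ≠ 0, ‖h‖ ≤ 1 → ‖F s h‖ ≤ A / ‖h‖
  tail : UnifTail (Icc a b) F
  cont : ContinuousOn (joint F) (Icc a b ×ˢ {0}ᶜ)

theorem WeaklySingular.add (hF : WeaklySingular a b F) (hG : WeaklySingular a b G) :
    WeaklySingular a b (fun s h => F s h + G s h) := by
  refine ⟨?_, hF.tail.add hG.tail, hF.cont.add hG.cont⟩
  obtain ⟨A, hA⟩ := hF.core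
  obtain ⟨A', hA'⟩ := hG.core
  refine ⟨A + A', fun s hs h h0 h1 => (norm_add_le _ _).trans ?_⟩
  rw [add_div]
  exact add_le_add (hA s hs h h0 h1) (hA' s hs h h0 h1)

theorem integrable_of_core {F : ℝ × ℝ → ℍ[ℝ]} (hF : ∀ ρ > 0, IntegrableOn F {h | ρ < ‖h‖}) {A : ℝ}
    (hA : ∀ h ≠ 0, ‖h‖ ≤ 1 → ‖F h‖ ≤ A / ‖h‖) : Integrable F := by
  have h2 : IntegrableOn F {h | ‖h‖ ≤ 1} := by
    refine Integrable.mono' (integrableOn_inv_norm.const_mul A)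
      (aestronglyMeasurable_of_integrableOn hF).restrict ?_
    refine (ae_restrict_iff' (measurableSet_norm_le 1)).2 ?_
    filter_upwards [compl_mem_ae_iff.2 (measure_singleton (0 : ℝ × ℝ))] with h h0 hh
    exact (hA h h0 hh).trans_eq (div_eq_mul_inv _ _)
  have := h2.union (hF 1 one_pos)
  rwa [show {h : ℝ × ℝ | ‖h‖ ≤ 1} ∪ {h | 1 < ‖h‖} = univ by
    ext h; simpa using le_or_gt ‖h‖ 1, integrableOn_univ] at this

theorem WeaklySingular.integrable (hF : WeaklySingular a b F) {s : ℝ} (hs : s ∈ Icc a b) :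
    Integrable (F s) := by
  obtain ⟨A, hA⟩ := hF.core
  exact integrable_of_core (hF.tail.integrableOn s hs) (hA s hs)

theorem WeaklySingular.symm_le (hF : WeaklySingular a b F) :
    ∃ A, ∀ s ∈ Icc a b, ∀ h ≠ 0, ‖h‖ ≤ 1 → ‖F s h + F s (-h)‖ ≤ A / ‖h‖ := by
  obtain ⟨A, hA⟩ := hF.core
  refine ⟨A + A, fun s hs h h0 h1 => (norm_add_le _ _).trans ?_⟩
  rw [add_div]
  have := hA s hs (-h) (neg_ne_zero.2 h0) (by rwa [norm_neg])
  rw [norm_neg] at this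
  exact add_le_add (hA s hs h h0 h1) this

theorem WeaklySingular.tendstoUniformlyOn (hF : WeaklySingular a b F) :
    TendstoUniformlyOn (fun n s => ∫ h, cutoff n h • F s h) (fun s => ∫ h, F s h) atTop
      (Icc a b) := by
  obtain ⟨A, hA⟩ := hF.symm_le
  exact (tendstoUniformlyOn_cutoff hA hF.tail).congr_right fun s hs =>
    symmIntegral_eq_integral (hF.integrable hs)

theorem norm_crossIntegrand_le (k : ℍ[ℝ]) (g η f : ℝ × ℝ → ℍ[ℝ]) (p q : ℝ × ℝ) :
    ‖crossIntegrand k g η f p q‖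
      ≤ ‖k‖ * (‖g p - g q‖ * (‖dβ η q‖ * ‖dα f q‖ + ‖dα η q‖ * ‖dβ f q‖)) := by
  rw [crossIntegrand, norm_mul]
  gcongr
  refine (norm_sub_le _ _).trans ?_
  rw [norm_mul, norm_mul]
  calc _ ≤ ‖g p - g q‖ * ‖dβ η q‖ * ‖dα f q‖ + ‖g p - g q‖ * ‖dα η q‖ * ‖dβ f q‖ := by
        gcongr <;> exact norm_cross_le _ _
    _ = _ := by ring

/-- The integrands of all the commutator integrals are weakly singular: the difference of `g`
gains one power at the diagonal, and the gradient of `f` is square integrable at infinity. -/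
theorem weaklySingular_crossIntegrand (hab : a < b) {c L₂ : ℝ}
    (hk : ∀ s ∈ Icc a b, ∀ h ≠ 0, ‖k s h‖ ≤ c * (‖h‖ ^ 2)⁻¹)
    (hkc : ContinuousOn (joint k) (Icc a b ×ˢ {0}ᶜ))
    (hg : ContDiffOn ℝ 1 (joint g) (slab a b)) (hgB : ∀ s ∈ Icc a b, ∀ h, ‖g s h‖ ≤ B)
    (hη : ContDiffOn ℝ 1 (joint η) (slab a b))
    (hηα : ∀ s ∈ Icc a b, ∀ h, ‖dα (η s) h‖ ≤ Λ) (hηβ : ∀ s ∈ Icc a b, ∀ h, ‖dβ (η s) h‖ ≤ Λ)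
    (hf : ContDiffOn ℝ 1 (joint f) (slab a b))
    (hfα : ∀ s ∈ Icc a b, eLpNorm (dα (f s)) 2 volume ≤ ENNReal.ofReal L₂)
    (hfβ : ∀ s ∈ Icc a b, eLpNorm (dβ (f s)) 2 volume ≤ ENNReal.ofReal L₂) :
    WeaklySingular a b (fun s h => crossIntegrand (k s h) (g s) (η s) (f s) 0 h) := by
  have ha : a ∈ Icc a b := ⟨le_rfl, hab.le⟩
  have hΛ : 0 ≤ Λ := (norm_nonneg _).trans (hηα a ha 0)
  have hB : 0 ≤ B := (norm_nonneg _).trans (hgB a ha 0)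
  have hc : 0 ≤ c := by
    have := (norm_nonneg _).trans (hk a ha (1, 0) (by simp))
    simpa [Prod.norm_def] using this
  have cα := continuousOn_dα hab hf
  have cβ := continuousOn_dβ hab hf
  have hcont : ContinuousOn (joint fun s h => crossIntegrand (k s h) (g s) (η s) (f s) 0 h)
      (Icc a b ×ˢ {0}ᶜ) := by
    have hd : ContinuousOn (fun y : ℝ × (ℝ × ℝ) => g y.1 0 - g y.1 y.2) (Icc a b ×ˢ {0}ᶜ) := by
      exact (continuousOn_base hg.continuousOn).punctured.neg.congr fun y _ => (neg_sub _ _).symm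
    exact hkc.mul (((continuousOn_cross hd (continuousOn_dβ hab hη).punctured).mul
      cα.punctured).sub ((continuousOn_cross hd (continuousOn_dα hab hη).punctured).mul
      cβ.punctured))
  refine ⟨?_, ?_, hcont⟩
  · obtain ⟨L, hL0, hL⟩ := exists_lipschitz hab hg
    obtain ⟨A, hA0, hA⟩ := exists_bound_of_continuousOn cα 1
    obtain ⟨A', hA'0, hA'⟩ := exists_bound_of_continuousOn cβ 1
    refine ⟨c * (L * (Λ * A + Λ * A')), fun s hs h h0 h1 => ?_⟩
    have hp : 0 < ‖h‖ := norm_pos_iff.2 h0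
    have hgl : ‖g s 0 - g s h‖ ≤ L * ‖h‖ := by
      simpa using hL s hs 0 h (by simp) h1
    refine (norm_crossIntegrand_le _ _ _ _ _ _).trans ?_
    calc _ ≤ c * (‖h‖ ^ 2)⁻¹ * (L * ‖h‖ * (Λ * A + Λ * A')) := by
          gcongr
          · exact hk s hs h h0
          · exact hηβ s hs h
          · exact hA s hs h h1
          · exact hηα s hs h
          · exact hA' s hs h h1
      _ = _ := by field_simp
  · have hT := ((UnifTail.of_L2 (fun s hs => ContDiffOn.continuous_slice cα hs) hfα).add
      (UnifTail.of_L2 (fun s hs => ContDiffOn.continuous_slice cβ hs) hfβ)).const_mul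
        (c * (2 * B * Λ))
    refine hT.mono (fun s hs => continuousOn_slice (F := fun s h =>
      crossIntegrand (k s h) (g s) (η s) (f s) 0 h) hcont hs) fun s hs h h0 => ?_
    have hgl : ‖g s 0 - g s h‖ ≤ 2 * B := by
      refine (norm_sub_le _ _).trans ?_
      linarith [hgB s hs 0, hgB s hs h]
    refine (norm_crossIntegrand_le _ _ _ _ _ _).trans ?_
    calc _ ≤ c * (‖h‖ ^ 2)⁻¹ * (2 * B * (Λ * ‖dα (f s) h‖ + Λ * ‖dβ (f s) h‖)) := by
          gcongr
          · exact hk s hs h h0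
          · exact hηβ s hs h
          · exact hηα s hs h
      _ = _ := by ring

end WeaklySingular

/-! ### The commutator of the Hilbert transform with a derivation -/

section Commutator

variable {a b κ Λ B B' : ℝ} {X V f fs : ℝ → ℝ × ℝ → ℍ[ℝ]}

/-- The commutator integrand `K(X' - X) (V - V') × (X'_β ∂_α - X'_α ∂_β) f'` at the base
point `0`. -/
def commIntegrand (X V f : ℝ → ℝ × ℝ → ℍ[ℝ]) (s : ℝ) (h : ℝ × ℝ) : ℍ[ℝ] :=
  crossIntegrand (K (X s h - X s 0)) (V s) (X s) (f s) 0 h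

/-- The density of the Hilbert transform, including the normal. -/
def normalMul (X f : ℝ → ℝ × ℝ → ℍ[ℝ]) (s : ℝ) (h : ℝ × ℝ) : ℍ[ℝ] := normal (X s) h * f s h

theorem hilbertIntegrand_eq (s : ℝ) :
    hilbertIntegrand (X s) (f s) 0 = kernelIntegrand X (normalMul X f) s := by
  funext h; simp only [hilbertIntegrand, kernelIntegrand, normalMul, mul_assoc]

theorem integrableOn_inv_sq_bdd_mul {N f : ℝ × ℝ → ℍ[ℝ]} {C : ℝ} (hN : Continuous N)
    (hf : Continuous f) (hC : ∀ h, ‖N h‖ ≤ C) {ρ : ℝ}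
    (hi : IntegrableOn (fun h : ℝ × ℝ => (‖h‖ ^ 2)⁻¹ * ‖f h‖) {h | ρ < ‖h‖}) :
    IntegrableOn (fun h : ℝ × ℝ => (‖h‖ ^ 2)⁻¹ * ‖N h * f h‖) {h | ρ < ‖h‖} := by
  refine Integrable.mono' (hi.const_mul C) ?_ (ae_of_all _ fun h => ?_)
  · have : Measurable fun h : ℝ × ℝ => (‖h‖ ^ 2)⁻¹ := by fun_prop
    exact (this.mul (hN.mul hf).norm.measurable).aestronglyMeasurable
  · rw [Real.norm_of_nonneg (by positivity), norm_mul]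
    calc _ ≤ (‖h‖ ^ 2)⁻¹ * (C * ‖f h‖) := by gcongr; exact hC h
      _ = _ := by ring

/-- The flux `K η × Y f`, where `η` is the velocity relative to the base point; for `Y = X_β` and
`Y = -X_α` these are the two components of the vector field whose divergence appears in the
commutator identity. -/
def flux (X V Y f : ℝ → ℝ × ℝ → ℍ[ℝ]) : ℝ → ℝ × ℝ → ℍ[ℝ] :=
  kernelIntegrand X fun s q => cross (V s q - V s 0) (Y s q) * f s q

/-- The derivative `∂_α` of the flux `K η × X_β f`. -/
def fluxDα (X V f : ℝ → ℝ × ℝ → ℍ[ℝ]) (s : ℝ) (h : ℝ × ℝ) : ℍ[ℝ] :=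
  DK (X s h - X s 0) (dα (X s) h) * (cross (V s h - V s 0) (dβ (X s) h) * f s h)
    + K (X s h - X s 0) * ((cross (dα (V s) h) (dβ (X s) h)
      + cross (V s h - V s 0) (dα (dβ (X s)) h)) * f s h
      + cross (V s h - V s 0) (dβ (X s) h) * dα (f s) h)

/-- The derivative `∂_β` of the flux `K η × X_α f`. -/
def fluxDβ (X V f : ℝ → ℝ × ℝ → ℍ[ℝ]) (s : ℝ) (h : ℝ × ℝ) : ℍ[ℝ] :=
  DK (X s h - X s 0) (dβ (X s) h) * (cross (V s h - V s 0) (dα (X s) h) * f s h)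
    + K (X s h - X s 0) * ((cross (dβ (V s) h) (dα (X s) h)
      + cross (V s h - V s 0) (dβ (dα (X s)) h)) * f s h
      + cross (V s h - V s 0) (dα (X s) h) * dβ (f s) h)

namespace Motion

theorem reg_normalMul (hM : Motion a b κ Λ B X V) (hf : ContDiffOn ℝ 1 (joint f) (slab a b)) :
    ContDiffOn ℝ 1 (joint (normalMul X f)) (slab a b) :=
  hM.reg_normal.mul hf

theorem integrableOn_normalMul (hM : Motion a b κ Λ B X V)
    (hf : ContDiffOn ℝ 1 (joint f) (slab a b)) {s : ℝ} (hs : s ∈ Icc a b)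
    (hi : ∀ ρ > 0, IntegrableOn (fun h : ℝ × ℝ => (‖h‖ ^ 2)⁻¹ * ‖f s h‖) {h | ρ < ‖h‖}) :
    ∀ ρ > 0, IntegrableOn (fun h : ℝ × ℝ => (‖h‖ ^ 2)⁻¹ * ‖normalMul X f s h‖) {h | ρ < ‖h‖} :=
  fun ρ hρ => integrableOn_inv_sq_bdd_mul
    (ContDiffOn.continuous_slice hM.reg_normal.continuousOn hs)
    (ContDiffOn.continuous_slice hf.continuousOn hs) (hM.norm_normal_le hs) (hi ρ hρ)

/-- The Hilbert transform exists at the base point, as the symmetrized integral. -/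
theorem hasPV_hilbert (hM : Motion a b κ Λ B X V) (hf : ContDiffOn ℝ 1 (joint f) (slab a b)) {s : ℝ}
    (hs : s ∈ Icc a b)
    (hi : ∀ ρ > 0, IntegrableOn (fun h : ℝ × ℝ => (‖h‖ ^ 2)⁻¹ * ‖f s h‖) {h | ρ < ‖h‖}) :
    HasPV (hilbertIntegrand (X s) (f s) 0) 0 (symmIntegral (hilbertIntegrand (X s) (f s) 0)) := by
  rw [hilbertIntegrand_eq]
  exact hM.hasPV_kernelIntegrand (hM.reg_normalMul hf) hs (hM.integrableOn_normalMul hf hs hi)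

theorem weaklySingular_comm (hM : Motion a b κ Λ B X V)
    (hf : ContDiffOn ℝ 1 (joint f) (slab a b))
    (hfα : ∀ s ∈ Icc a b, eLpNorm (dα (f s)) 2 volume ≤ ENNReal.ofReal B')
    (hfβ : ∀ s ∈ Icc a b, eLpNorm (dβ (f s)) 2 volume ≤ ENNReal.ofReal B') :
    WeaklySingular a b (commIntegrand X V f) :=
  weaklySingular_crossIntegrand hM.lt (fun _ hs _ h0 => hM.norm_K_le hs h0) hM.continuousOn_K
    hM.regV hM.vel hM.reg_one hM.tan_α hM.tan_β hf hfα hfβ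

theorem vec_V (hM : Motion a b κ Λ B X V) {s : ℝ} (hs : s ∈ Icc a b) (q : ℝ × ℝ) :
    (V s q).re = 0 :=
  (uniqueDiffOn_Icc hM.lt s hs).eq_deriv _ (hasDerivWithinAt_re (hM.deriv s hs q))
    ((hasDerivWithinAt_const s _ (0 : ℝ)).congr (fun r hr => hM.vec r hr q) (hM.vec s hs q))

theorem vec_α (hM : Motion a b κ Λ B X V) {s : ℝ} (hs : s ∈ Icc a b) (q : ℝ × ℝ) :
    (dα (X s) q).re = 0 := by
  have h := hasDerivWithinAt_re
    ((differentiable_slice hM.reg_one hs q).hasDerivAt_dα.hasDerivWithinAt (s := univ))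
  simp only [hM.vec s hs] at h
  exact (hasDerivWithinAt_univ.1 h).unique (hasDerivAt_const _ _)

theorem vec_β (hM : Motion a b κ Λ B X V) {s : ℝ} (hs : s ∈ Icc a b) (q : ℝ × ℝ) :
    (dβ (X s) q).re = 0 := by
  have h := hasDerivWithinAt_re
    ((differentiable_slice hM.reg_one hs q).hasDerivAt_dβ.hasDerivWithinAt (s := univ))
  simp only [hM.vec s hs] at h
  exact (hasDerivWithinAt_univ.1 h).unique (hasDerivAt_const _ _)

theorem continuousOn_DK (hM : Motion a b κ Λ B X V) {Y : ℝ → ℝ × ℝ → ℍ[ℝ]}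
    (hY : ContinuousOn (joint Y) (Icc a b ×ˢ {0}ᶜ)) :
    ContinuousOn (joint fun s h => DK (X s h - X s 0) (Y s h)) (Icc a b ×ˢ {0}ᶜ) :=
  WaterWave.continuousOn_DK (continuousOn_base hM.reg.continuousOn).punctured hY
    fun _ hy => hM.ne hy.1 hy.2

theorem continuousOn_flux (hM : Motion a b κ Λ B X V) {Y : ℝ → ℝ × ℝ → ℍ[ℝ]}
    (hY : ContinuousOn (joint Y) (slab a b)) (hf : ContinuousOn (joint f) (slab a b)) :
    ContinuousOn (joint (flux X V Y f)) (Icc a b ×ˢ {0}ᶜ) :=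
  hM.continuousOn_kernelIntegrand
    (((continuousOn_cross (continuousOn_base hM.regV.continuousOn) hY)).mul hf)

theorem continuousOn_fluxDα (hM : Motion a b κ Λ B X V)
    (hf : ContDiffOn ℝ 1 (joint f) (slab a b)) :
    ContinuousOn (joint (fluxDα X V f)) (Icc a b ×ˢ {0}ᶜ) := by
  have cV := continuousOn_base hM.regV.continuousOn
  have cXα := continuousOn_dα hM.lt hM.reg_one
  have cXβ := continuousOn_dβ hM.lt hM.reg_one
  have cVα := continuousOn_dα hM.lt hM.regV
  have cXαβ := continuousOn_dα hM.lt hM.regβ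
  have cfα := continuousOn_dα hM.lt hf
  have c1 := continuousOn_cross cV cXβ
  have c2 := hM.continuousOn_DK cXα.punctured
  have c3 := (continuousOn_cross cVα cXβ).add (continuousOn_cross cV cXαβ)
  exact (c2.mul (c1.mul hf.continuousOn).punctured).add
    (hM.continuousOn_K.mul ((c3.mul hf.continuousOn).add (c1.mul cfα)).punctured)

theorem continuousOn_fluxDβ (hM : Motion a b κ Λ B X V)
    (hf : ContDiffOn ℝ 1 (joint f) (slab a b)) :
    ContinuousOn (joint (fluxDβ X V f)) (Icc a b ×ˢ {0}ᶜ) := by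
  have cV := continuousOn_base hM.regV.continuousOn
  have cXα := continuousOn_dα hM.lt hM.reg_one
  have cXβ := continuousOn_dβ hM.lt hM.reg_one
  have cVβ := continuousOn_dβ hM.lt hM.regV
  have cXβα := continuousOn_dβ hM.lt hM.regα
  have cfβ := continuousOn_dβ hM.lt hf
  have c1 := continuousOn_cross cV cXα
  have c2 := hM.continuousOn_DK cXβ.punctured
  have c3 := (continuousOn_cross cVβ cXα).add (continuousOn_cross cV cXβα)
  exact (c2.mul (c1.mul hf.continuousOn).punctured).add
    (hM.continuousOn_K.mul ((c3.mul hf.continuousOn).add (c1.mul cfβ)).punctured)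

theorem hasDerivAt_flux_α (hM : Motion a b κ Λ B X V) (hf : ContDiffOn ℝ 1 (joint f) (slab a b))
    {s : ℝ} (hs : s ∈ Icc a b) {h : ℝ × ℝ} (h0 : h ≠ 0) :
    HasDerivAt (fun r => flux X V (fun s => dβ (X s)) f s (r, h.2)) (fluxDα X V f s h) h.1 := by
  have x1 := ((differentiable_slice hM.reg_one hs h).hasDerivAt_dα.sub_const
    (X s 0)).hasDerivWithinAt (s := univ)
  have v1 := ((differentiable_slice hM.regV hs h).hasDerivAt_dα.sub_const
    (V s 0)).hasDerivWithinAt (s := univ)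
  have y1 := (differentiable_slice hM.regβ hs h).hasDerivAt_dα.hasDerivWithinAt (s := univ)
  have f1 := (differentiable_slice hf hs h).hasDerivAt_dα.hasDerivWithinAt (s := univ)
  have k1 := hasDerivWithinAt_K x1 (hM.ne hs h0)
  exact hasDerivWithinAt_univ.1 (k1.mul ((HasDerivWithinAt.cross v1 y1).mul f1))

theorem hasDerivAt_flux_β (hM : Motion a b κ Λ B X V) (hf : ContDiffOn ℝ 1 (joint f) (slab a b))
    {s : ℝ} (hs : s ∈ Icc a b) {h : ℝ × ℝ} (h0 : h ≠ 0) :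
    HasDerivAt (fun r => flux X V (fun s => dα (X s)) f s (h.1, r)) (fluxDβ X V f s h) h.2 := by
  have x1 := ((differentiable_slice hM.reg_one hs h).hasDerivAt_dβ.sub_const
    (X s 0)).hasDerivWithinAt (s := univ)
  have v1 := ((differentiable_slice hM.regV hs h).hasDerivAt_dβ.sub_const
    (V s 0)).hasDerivWithinAt (s := univ)
  have y1 := (differentiable_slice hM.regα hs h).hasDerivAt_dβ.hasDerivWithinAt (s := univ)
  have f1 := (differentiable_slice hf hs h).hasDerivAt_dβ.hasDerivWithinAt (s := univ)
  have k1 := hasDerivWithinAt_K x1 (hM.ne hs h0)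
  exact hasDerivWithinAt_univ.1 (k1.mul ((HasDerivWithinAt.cross v1 y1).mul f1))

theorem _root_.WaterWave.continuousOn_inv_norm_pow (k : ℕ) :
    ContinuousOn (fun h : ℝ × ℝ => (‖h‖ ^ k)⁻¹) {0}ᶜ :=
  (continuous_norm.pow k).continuousOn.inv₀ fun _ h0 => pow_ne_zero _ (norm_ne_zero_iff.2 h0)

theorem unifTail_flux (hM : Motion a b κ Λ B X V) (hf : Density a b B' f fs)
    {Y : ℝ → ℝ × ℝ → ℍ[ℝ]} (hYc : ContinuousOn (joint Y) (slab a b))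
    (hY : ∀ s ∈ Icc a b, ∀ q, ‖Y s q‖ ≤ Λ) :
    UnifTail (Icc a b) fun s h => ‖h‖⁻¹ * ‖flux X V Y f s h‖ := by
  obtain ⟨g, hg, hfg⟩ := hf.majorant
  have hT := (UnifTail.const (I := Icc a b) hg).const_mul (cK / κ ^ 2 * (2 * B * Λ))
  have hpos := cK_pos
  refine hT.mono (fun s hs => ?_) fun s hs h h0 => ?_
  · have c1 := continuousOn_slice (hM.continuousOn_flux hYc hf.reg.continuousOn) hs
    have c2 := (continuousOn_inv_norm_pow 1).mul c1.norm
    simp only [pow_one] at c2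
    exact c2
  · have hp : 0 < ‖h‖ := norm_pos_iff.2 h0
    have hB := hM.B_nonneg
    have hΛ := hM.Λ_nonneg
    have e1 := hM.norm_kernelIntegrand_le
      (g := fun s q => cross (V s q - V s 0) (Y s q) * f s q) hs h0
    have e2 : ‖cross (V s h - V s 0) (Y s h) * f s h‖ ≤ 2 * B * Λ * g h := by
      rw [norm_mul]
      have h2 : ‖V s h - V s 0‖ ≤ 2 * B := by
        refine (norm_sub_le _ _).trans ?_
        linarith [hM.vel s hs h, hM.vel s hs 0]
      gcongr
      · exact (norm_cross_le _ _).trans (by gcongr; exact hY s hs h)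
      · exact hfg s hs h
    rw [norm_mul, norm_inv, norm_norm, norm_norm]
    calc _ ≤ ‖h‖⁻¹ * (cK / κ ^ 2 * ((‖h‖ ^ 2)⁻¹ * (2 * B * Λ * g h))) := by
          gcongr
          exact e1.trans (by gcongr)
      _ = _ := by field_simp

/-- The flux through the boundary of the cutoff region vanishes in the limit. -/
theorem tendstoUniformlyOn_flux (hM : Motion a b κ Λ B X V) (hf : Density a b B' f fs)
    {Y : ℝ → ℝ × ℝ → ℍ[ℝ]} (hYr : ContDiffOn ℝ 1 (joint Y) (slab a b))
    (hY : ∀ s ∈ Icc a b, ∀ q, ‖Y s q‖ ≤ Λ) {C : ℝ} {D : ℕ → ℝ × ℝ → ℝ} (hC : 0 < C)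
    (hD : ∀ n, IsCutoffGrad C n (D n)) :
    TendstoUniformlyOn (fun n s => ∫ h, D n h • flux X V Y f s h) (fun _ => 0) atTop (Icc a b) :=
  tendstoUniformlyOn_cutoffGrad hC hD
    (fun _ hs => continuousOn_slice
      (hM.continuousOn_flux hYr.continuousOn hf.reg.continuousOn) hs)
    (fun _ hε => hM.exists_flux_antisymm_le hYr hf.reg hε)
    (hM.unifTail_flux hf hYr.continuousOn hY)

/-- The pointwise commutator identity: the parameter derivative of the integrand `K N' f'` is the
commutator integrand, plus the integrand for `f_s`, plus the divergence of the flux. -/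
theorem deriv_integrand_eq (hM : Motion a b κ Λ B X V) {s : ℝ} (hs : s ∈ Icc a b) {h : ℝ × ℝ}
    (h0 : h ≠ 0) :
    (DK (X s h - X s 0) (V s h - V s 0) * normal (X s) h
        + K (X s h - X s 0) * (cross (dα (V s) h) (dβ (X s) h) + cross (dα (X s) h) (dβ (V s) h)))
          * f s h + K (X s h - X s 0) * normal (X s) h * fs s h
      = commIntegrand X V f s h + kernelIntegrand X (normalMul X fs) s h
        + (fluxDα X V f s h + -fluxDβ X V f s h) := by
  have hcyc := DK_cross_cyclic (x := X s h - X s 0) (a := dα (X s) h) (b := dβ (X s) h)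
    (h := V s h - V s 0) (hM.ne hs h0) (by simp [hM.vec s hs]) (hM.vec_α hs h) (hM.vec_β hs h)
    (by simp [hM.vec_V hs])
  have ec : ∀ σ τ : ℍ[ℝ], cross σ τ = -cross τ σ := fun σ τ => by
    ext <;> simp <;> ring
  rw [ec (dβ (X s) h) (V s h - V s 0)] at hcyc
  have h1 : DK (X s h - X s 0) (V s h - V s 0) * normal (X s) h
      = DK (X s h - X s 0) (dα (X s) h) * cross (V s h - V s 0) (dβ (X s) h)
        - DK (X s h - X s 0) (dβ (X s) h) * cross (V s h - V s 0) (dα (X s) h) := by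
    rw [← sub_eq_zero, ← hcyc, normal]
    noncomm_ring
  rw [h1, commIntegrand, crossIntegrand, kernelIntegrand, normalMul, fluxDα, fluxDβ,
    dα_dβ_comm (contDiff_slice hM.reg hs) h, ec (dα (X s) h) (dβ (V s) h),
    show V s 0 - V s h = -(V s h - V s 0) by abel, cross_neg_left, cross_neg_left]
  noncomm_ring

theorem unifTail_normalMul (hM : Motion a b κ Λ B X V)
    (hf : ContDiffOn ℝ 1 (joint f) (slab a b))
    (hL : ∀ s ∈ Icc a b, eLpNorm (f s) 2 volume ≤ ENNReal.ofReal B') :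
    UnifTail (Icc a b) (kernelIntegrand X (normalMul X f)) := by
  have rN := (hM.reg_normalMul hf).continuousOn
  refine hM.unifTail_kernelIntegrand rN le_rfl ?_
  refine ((UnifTail.of_L2 (fun s hs => ContDiffOn.continuous_slice hf.continuousOn hs)
    hL).const_mul (Λ * Λ)).mono (fun s hs => ?_) fun s hs h h0 => ?_
  · exact (continuousOn_inv_norm_pow 2).mul (ContDiffOn.continuous_slice rN hs).norm.continuousOn
  · rw [Real.norm_of_nonneg (by positivity), normalMul, norm_mul]
    calc _ ≤ (‖h‖ ^ 2)⁻¹ * (Λ * Λ * ‖f s h‖) := by gcongr; exact hM.norm_normal_le hs h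
      _ = _ := by ring

/-- The Hilbert transform over a moving surface is differentiable in the parameter, and
`∂_s 𝔥 f = 𝔥 f_s + ∬ K (V - V') × (X'_β ∂_α - X'_α ∂_β) f'`. -/
theorem hasDerivWithinAt_hilbert (hM : Motion a b κ Λ B X V) (hf : Density a b B' f fs) {s : ℝ}
    (hs : s ∈ Icc a b) :
    HasDerivWithinAt (fun r => symmIntegral (hilbertIntegrand (X r) (f r) 0))
      ((∫ h, commIntegrand X V f s h) + symmIntegral (hilbertIntegrand (X s) (fs s) 0))
      (Icc a b) s := by
  have cP := hM.continuousOn_flux hM.regβ.continuousOn hf.reg.continuousOn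
  have cQ := hM.continuousOn_flux hM.regα.continuousOn hf.reg.continuousOn
  have cP' := hM.continuousOn_fluxDα hf.reg
  have cQ' := hM.continuousOn_fluxDβ hf.reg
  obtain ⟨C, hC, hχ⟩ := exists_isCutoffGrad
  have lP := hM.tendstoUniformlyOn_flux hf hM.regβ hM.tan_β hC fun n => (hχ n).1
  have lQ := hM.tendstoUniformlyOn_flux hf hM.regα hM.tan_α hC fun n => (hχ n).2
  have wC := hM.weaklySingular_comm hf.reg hf.L2_α hf.L2_β
  have rN := hM.reg_normalMul hf.reg_deriv
  have cN := hM.continuousOn_kernelIntegrand rN.continuousOn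
  obtain ⟨A, hA⟩ := hM.exists_symm_le rN
  have tN := hM.unifTail_normalMul hf.reg_deriv hf.L2_deriv
  have lN := tendstoUniformlyOn_cutoff hA tN
  have hlim := ((wC.tendstoUniformlyOn.add lN).sub lP).add lQ
  refine hasDerivWithinAt_of_cutoff
    (Ψ := fun r => hilbertIntegrand (X r) (f r) 0)
    (Φ := fun s h => commIntegrand X V f s h + kernelIntegrand X (normalMul X fs) s h
      + (fluxDα X V f s h + -fluxDβ X V f s h))
    (L' := fun s => (∫ h, commIntegrand X V f s h) + symmIntegral (hilbertIntegrand (X s) (fs s) 0))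
    ?_ ?_ ?_ ?_ ?_ hs
  · intro s hs h h0
    have k1 := hasDerivWithinAt_K ((hM.deriv s hs h).sub (hM.deriv s hs 0)) (hM.ne hs h0)
    have n1 := HasDerivWithinAt.cross (hasDerivWithinAt_dα hM.lt hM.reg hM.deriv hs h)
      (hasDerivWithinAt_dβ hM.lt hM.reg hM.deriv hs h)
    have := (k1.mul n1).mul (hf.deriv s hs h)
    exact this.congr_deriv (hM.deriv_integrand_eq hs h0)
  · intro s hs
    rw [hilbertIntegrand_eq]
    exact continuousOn_slice
      (hM.continuousOn_kernelIntegrand (hM.reg_normalMul hf.reg).continuousOn) hs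
  · exact (wC.cont.add cN).add (cP'.add cQ'.neg)
  · intro s hs
    simp only [hilbertIntegrand_eq]
    exact hM.tendsto_cutoff_kernelIntegrand (hM.reg_normalMul hf.reg) hs
      (hM.integrableOn_normalMul hf.reg hs (hf.integrableOn s hs))
  · refine (hlim.congr (Eventually.of_forall fun n s hs => ?_)).congr_right fun s hs => ?_
    · have i1 : Integrable fun h => cutoff n h • commIntegrand X V f s h :=
        (wC.integrable hs).cutoff_smul n
      have i2 : Integrable fun h => cutoff n h • kernelIntegrand X (normalMul X fs) s h :=
        integrable_cutoff_smul (tN.integrableOn s hs) n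
      have c3 : ContinuousOn (fun h => fluxDα X V f s h + -fluxDβ X V f s h) {0}ᶜ :=
        (continuousOn_slice cP' hs).add (continuousOn_slice cQ' hs).neg
      have i3 := integrable_cutoff_smul_of_continuousOn c3 n
      have hdiv := integral_cutoff_div (F := flux X V (fun s => dβ (X s)) f s)
        (G := fun h => -flux X V (fun s => dα (X s)) f s h) (F' := fluxDα X V f s)
        (G' := fun h => -fluxDβ X V f s h) (continuousOn_slice cP hs)
        (continuousOn_slice cQ hs).neg (continuousOn_slice cP' hs) (continuousOn_slice cQ' hs).neg
        (fun h h0 => hM.hasDerivAt_flux_α hf.reg hs h0)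
        (fun h h0 => (hM.hasDerivAt_flux_β hf.reg hs h0).neg) n
      have e : ∀ h, cutoff n h • (commIntegrand X V f s h + kernelIntegrand X (normalMul X fs) s h
          + (fluxDα X V f s h + -fluxDβ X V f s h))
          = cutoff n h • commIntegrand X V f s h
            + cutoff n h • kernelIntegrand X (normalMul X fs) s h
            + cutoff n h • (fluxDα X V f s h + -fluxDβ X V f s h) := fun h => by
        rw [smul_add, smul_add]
      simp only [smul_neg, integral_neg] at hdiv
      simp only [Pi.add_apply, Pi.sub_apply, e]
      have i12 : Integrable fun h => cutoff n h • commIntegrand X V f s h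
          + cutoff n h • kernelIntegrand X (normalMul X fs) s h := i1.add i2
      rw [integral_add i12 i3, integral_add i1 i2, hdiv]
      abel
    · simp [hilbertIntegrand_eq]

end Motion

end Commutator

/-! ### Calculus of principal values -/

section HasPV

variable {F G : ℝ × ℝ → ℍ[ℝ]} {p : ℝ × ℝ} {L L' : ℍ[ℝ]}

theorem HasPV.unique (h : HasPV F p L) (h' : HasPV F p L') : L = L' :=
  tendsto_nhds_unique h.2 h'.2

theorem HasPV.add (h : HasPV F p L) (h' : HasPV G p L') :
    HasPV (fun q => F q + G q) p (L + L') := by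
  refine ⟨fun ε hε => (h.1 ε hε).add (h'.1 ε hε), (h.2.add h'.2).congr' ?_⟩
  filter_upwards [self_mem_nhdsWithin] with ε hε
  exact (integral_add (h.1 ε hε) (h'.1 ε hε)).symm

theorem HasPV.clm (h : HasPV F p L) (T : ℍ[ℝ] →L[ℝ] ℍ[ℝ]) : HasPV (fun q => T (F q)) p (T L) := by
  refine ⟨fun ε hε => T.integrable_comp (h.1 ε hε),
    ((T.continuous.tendsto L).comp h.2).congr' ?_⟩
  filter_upwards [self_mem_nhdsWithin] with ε hε
  exact (T.integral_comp_comm (h.1 ε hε)).symm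

theorem HasPV.const_mul (h : HasPV F p L) (c : ℍ[ℝ]) : HasPV (fun q => c * F q) p (c * L) :=
  h.clm (ContinuousLinearMap.mul ℝ ℍ[ℝ] c)

theorem HasPV.mul_const (h : HasPV F p L) (c : ℍ[ℝ]) : HasPV (fun q => F q * c) p (L * c) :=
  h.clm ((ContinuousLinearMap.mul ℝ ℍ[ℝ]).flip c)

theorem HasPV.const_smul (h : HasPV F p L) (c : ℝ) : HasPV (fun q => c • F q) p (c • L) :=
  h.clm (c • ContinuousLinearMap.id ℝ ℍ[ℝ])

theorem HasPV.re_smul (h : HasPV F p L) (c : ℍ[ℝ]) :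
    HasPV (fun q => (F q).re • c) p (L.re • c) := by
  simpa [re_eq_inner] using h.clm ((innerSL ℝ (1 : ℍ[ℝ])).smulRight c)

theorem HasPV.neg (h : HasPV F p L) : HasPV (fun q => -F q) p (-L) := by
  simpa using h.const_smul (-1)

theorem HasPV.sub (h : HasPV F p L) (h' : HasPV G p L') :
    HasPV (fun q => F q - G q) p (L - L') := by
  simpa [sub_eq_add_neg] using h.add h'.neg

theorem HasPV.congr (h : HasPV F p L) (e : ∀ q, G q = F q) : HasPV G p L := by
  rwa [show G = F from funext e]

theorem _root_.MeasureTheory.Integrable.hasPV {F : ℝ × ℝ → ℍ[ℝ]} (hF : Integrable F) :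
    HasPV F 0 (∫ q, F q) := by
  have hm := aestronglyMeasurable_of_integrableOn fun ρ (_ : ρ > 0) =>
    hF.integrableOn (s := {h : ℝ × ℝ | ρ < ‖h‖})
  have hms : ∀ ε : ℝ, MeasurableSet {q : ℝ × ℝ | ε < pdist q 0} := fun ε =>
    measurableSet_lt measurable_const (by unfold pdist; fun_prop)
  refine ⟨fun ε _ => hF.integrableOn, ?_⟩
  have ht : Tendsto (fun ε : ℝ => ∫ h, {q : ℝ × ℝ | ε < pdist q 0}.indicator F h)
      (𝓝[>] 0) (𝓝 (∫ h, F h)) := by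
    refine tendsto_integral_filter_of_dominated_convergence (fun h => ‖F h‖) ?_ ?_ hF.norm ?_
    · exact Eventually.of_forall fun ε => hm.indicator (hms ε)
    · exact Eventually.of_forall fun ε => ae_of_all _ fun h => norm_indicator_le_norm_self _ _
    · filter_upwards [compl_mem_ae_iff.2 (measure_singleton (0 : ℝ × ℝ))] with h h0
      refine tendsto_const_nhds.congr' ?_
      have hp : 0 < pdist h 0 := (norm_pos_iff.2 h0).trans_le (norm_le_pdist h)
      filter_upwards [Ioo_mem_nhdsGT hp] with ε hε
      exact (indicator_of_mem (show h ∈ {q : ℝ × ℝ | ε < pdist q 0} from hε.2) F).symm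
  exact ht.congr fun ε => integral_indicator (hms ε)

/-- Principal values may be computed after translating the singularity to the origin. -/
theorem hasPV_translate_iff : HasPV (fun h => F (p + h)) 0 L ↔ HasPV F p L := by
  have hmp := measurePreserving_add_left (volume : Measure (ℝ × ℝ)) p
  have hme : MeasurableEmbedding (fun h : ℝ × ℝ => p + h) := (MeasurableEquiv.addLeft p).measurableEmbedding
  have e : ∀ ε : ℝ, (fun h : ℝ × ℝ => p + h) ⁻¹' {q | ε < pdist q p} = {q | ε < pdist q 0} :=
    fun ε => by ext h; simp [pdist]
  have e1 : ∀ ε : ℝ, truncInt (fun h => F (p + h)) 0 ε = truncInt F p ε := fun ε => by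
    unfold truncInt
    rw [← e ε]
    exact hmp.setIntegral_preimage_emb hme F _
  have e2 : ∀ ε : ℝ, IntegrableOn (fun h => F (p + h)) {q | ε < pdist q 0}
      ↔ IntegrableOn F {q | ε < pdist q p} := fun ε => by
    rw [← e ε]
    exact hmp.integrableOn_comp_preimage hme
  unfold HasPV
  rw [show truncInt (fun h => F (p + h)) 0 = truncInt F p from funext e1]
  simp only [e2]

end HasPV

/-! ### The derivative of the commutator integral -/

section CommDeriv

variable {a b κ Λ B B' : ℝ} {X V W f fs : ℝ → ℝ × ℝ → ℍ[ℝ]}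

namespace Motion

theorem exists_vel_sub_le (hM : Motion a b κ Λ B X V) :
    ∃ L, 0 ≤ L ∧ ∀ s ∈ Icc a b, ∀ h, ‖V s h - V s 0‖ ≤ L * ‖h‖ := by
  obtain ⟨L, hL0, hL⟩ := exists_lipschitz hM.lt hM.regV
  refine ⟨L + 2 * B, by linarith [hM.B_nonneg], fun s hs h => ?_⟩
  rcases le_or_gt ‖h‖ 1 with h1 | h1
  · have := hL s hs h 0 h1 (by simp)
    rw [sub_zero] at this
    nlinarith [norm_nonneg h, hM.B_nonneg]
  · have : ‖V s h - V s 0‖ ≤ 2 * B := by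
      refine (norm_sub_le _ _).trans ?_
      linarith [hM.vel s hs h, hM.vel s hs 0]
    nlinarith [hM.B_nonneg]

theorem exists_norm_DK_le (hM : Motion a b κ Λ B X V) :
    ∃ c, ∀ s ∈ Icc a b, ∀ h ≠ 0,
      ‖DK (X s h - X s 0) (V s h - V s 0)‖ ≤ c * (‖h‖ ^ 2)⁻¹ := by
  obtain ⟨L, hL0, hL⟩ := hM.exists_vel_sub_le
  have hc := cK_pos
  have hk := hM.pos
  refine ⟨4 * cK / κ ^ 3 * L, fun s hs h h0 => ?_⟩
  have hp : 0 < ‖h‖ := norm_pos_iff.2 h0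
  have hx := hM.chord s hs h
  have hkh := hM.pos_of_ne h0
  calc _ ≤ 4 * cK / ‖X s h - X s 0‖ ^ 3 * ‖V s h - V s 0‖ := norm_DK_le _ _
    _ ≤ 4 * cK / (κ * ‖h‖) ^ 3 * (L * ‖h‖) := by gcongr; exact hL s hs h
    _ = _ := by field_simp

theorem weaklySingular_dK (hM : Motion a b κ Λ B X V)
    (hf : ContDiffOn ℝ 1 (joint f) (slab a b))
    (hfα : ∀ s ∈ Icc a b, eLpNorm (dα (f s)) 2 volume ≤ ENNReal.ofReal B')
    (hfβ : ∀ s ∈ Icc a b, eLpNorm (dβ (f s)) 2 volume ≤ ENNReal.ofReal B') :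
    WeaklySingular a b fun s h => crossIntegrand (DK (X s h - X s 0) (V s h - V s 0)) (V s) (X s)
      (f s) 0 h := by
  obtain ⟨c, hc⟩ := hM.exists_norm_DK_le
  exact weaklySingular_crossIntegrand (k := fun s h => DK (X s h - X s 0) (V s h - V s 0)) hM.lt hc
    (hM.continuousOn_DK (Y := fun s h => V s h - V s 0)
      (continuousOn_base hM.regV.continuousOn).punctured)
    hM.regV hM.vel hM.reg_one hM.tan_α hM.tan_β hf hfα hfβ

/-- The parameter derivative of the commutator integral: it falls on the kernel, on the velocity
difference, on the tangent vectors and on the density. -/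
theorem hasDerivWithinAt_comm (hM : Motion a b κ Λ B X V)
    (hW : ContDiffOn ℝ 1 (joint W) (slab a b))
    (hVW : ∀ s ∈ Icc a b, ∀ q, HasDerivWithinAt (fun r => V r q) (W s q) (Icc a b) s)
    (hWB : ∀ s ∈ Icc a b, ∀ q, ‖W s q‖ ≤ B')
    (hVα : ∀ s ∈ Icc a b, ∀ q, ‖dα (V s) q‖ ≤ B') (hVβ : ∀ s ∈ Icc a b, ∀ q, ‖dβ (V s) q‖ ≤ B')
    (hf : ContDiffOn ℝ 2 (joint f) (slab a b))
    (hfs : ∀ s ∈ Icc a b, ∀ q, HasDerivWithinAt (fun r => f r q) (fs s q) (Icc a b) s)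
    (hfα : ∀ s ∈ Icc a b, eLpNorm (dα (f s)) 2 volume ≤ ENNReal.ofReal B')
    (hfβ : ∀ s ∈ Icc a b, eLpNorm (dβ (f s)) 2 volume ≤ ENNReal.ofReal B')
    (hsα : ∀ s ∈ Icc a b, eLpNorm (dα (fs s)) 2 volume ≤ ENNReal.ofReal B')
    (hsβ : ∀ s ∈ Icc a b, eLpNorm (dβ (fs s)) 2 volume ≤ ENNReal.ofReal B')
    {s : ℝ} (hs : s ∈ Icc a b) :
    HasDerivWithinAt (fun r => ∫ h, commIntegrand X V f r h)
      ((∫ h, crossIntegrand (DK (X s h - X s 0) (V s h - V s 0)) (V s) (X s) (f s) 0 h)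
        + (∫ h, crossIntegrand (K (X s h - X s 0)) (W s) (X s) (f s) 0 h)
        + (∫ h, crossIntegrand (K (X s h - X s 0)) (V s) (V s) (f s) 0 h)
        + ∫ h, commIntegrand X V fs s h) (Icc a b) s := by
  have hf1 : ContDiffOn ℝ 1 (joint f) (slab a b) := hf.of_le one_le_two
  have hfs1 : ContDiffOn ℝ 1 (joint fs) (slab a b) := contDiffOn_paramDeriv hM.lt hf hfs
  have w0 := hM.weaklySingular_comm hf1 hfα hfβ
  have w1 := hM.weaklySingular_dK hf1 hfα hfβ
  have w2 := weaklySingular_crossIntegrand (k := fun s h => K (X s h - X s 0)) hM.lt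
    (fun _ hs _ h0 => hM.norm_K_le hs h0) hM.continuousOn_K hW hWB hM.reg_one hM.tan_α hM.tan_β
    hf1 hfα hfβ
  have w3 := weaklySingular_crossIntegrand (k := fun s h => K (X s h - X s 0)) hM.lt
    (fun _ hs _ h0 => hM.norm_K_le hs h0) hM.continuousOn_K hM.regV hM.vel hM.regV hVα hVβ
    hf1 hfα hfβ
  have w4 := hM.weaklySingular_comm hfs1 hsα hsβ
  have w := ((w1.add w2).add w3).add w4
  refine hasDerivWithinAt_of_cutoff (Ψ := commIntegrand X V f) (L' := fun s =>
      (∫ h, crossIntegrand (DK (X s h - X s 0) (V s h - V s 0)) (V s) (X s) (f s) 0 h)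
        + (∫ h, crossIntegrand (K (X s h - X s 0)) (W s) (X s) (f s) 0 h)
        + (∫ h, crossIntegrand (K (X s h - X s 0)) (V s) (V s) (f s) 0 h)
        + ∫ h, commIntegrand X V fs s h) ?_ ?_ w.cont ?_
    (w.tendstoUniformlyOn.congr_right fun s hs => ?_) hs
  · intro s hs h h0
    have k1 := hasDerivWithinAt_K ((hM.deriv s hs h).sub (hM.deriv s hs 0)) (hM.ne hs h0)
    have v1 := (hVW s hs 0).sub (hVW s hs h)
    have xα := hasDerivWithinAt_dα hM.lt hM.reg hM.deriv hs h
    have xβ := hasDerivWithinAt_dβ hM.lt hM.reg hM.deriv hs h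
    have fα := hasDerivWithinAt_dα hM.lt hf hfs hs h
    have fβ := hasDerivWithinAt_dβ hM.lt hf hfs hs h
    have := k1.mul (((HasDerivWithinAt.cross v1 xβ).mul fα).sub
      ((HasDerivWithinAt.cross v1 xα).mul fβ))
    refine this.congr_deriv ?_
    simp only [commIntegrand, crossIntegrand, Pi.sub_apply, Pi.mul_apply]
    noncomm_ring
  · exact fun s hs => continuousOn_slice w0.cont hs
  · exact fun s hs => w0.tendstoUniformlyOn.tendsto_at hs
  · have i1 := w1.integrable hs
    have i2 := w2.integrable hs
    have i3 := w3.integrable hs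
    have i4 := w4.integrable hs
    have i12 := i1.add i2
    have i123 := i12.add i3
    exact (integral_add i123 i4).trans (by rw [← integral_add i1 i2]; congr 1; exact integral_add i12 i3)

end Motion

end CommDeriv

/-! ### The scalar part of the double layer potential of a tangential field -/

section Scalar

variable {a b κ Λ B B' : ℝ} {X V : ℝ → ℝ × ℝ → ℍ[ℝ]} {ζ : ℝ → ℝ × ℝ → ℝ}

/-- The tangential vector field `ζ_α X_β - ζ_β X_α`, a rotated surface gradient of `ζ`. -/
def skewGrad (X : ℝ → ℝ × ℝ → ℍ[ℝ]) (ζ : ℝ → ℝ × ℝ → ℝ) (s : ℝ) (h : ℝ × ℝ) : ℍ[ℝ] :=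
  dα (ζ s) h • dβ (X s) h - dβ (ζ s) h • dα (X s) h

/-- The Newtonian potential `|X' - X|⁻¹` at the base point, normalized so that its gradient in the
surface point is `K`. -/
def potential (X : ℝ → ℝ × ℝ → ℍ[ℝ]) (s : ℝ) (h : ℝ × ℝ) : ℝ := cK * ‖X s h - X s 0‖⁻¹

namespace Motion

theorem reg_skewGrad (hM : Motion a b κ Λ B X V) (hζ : ContDiffOn ℝ 2 (joint ζ) (slab a b)) :
    ContDiffOn ℝ 1 (joint (skewGrad X ζ)) (slab a b) :=
  ((contDiffOn_dα hM.lt hζ).smul hM.regβ).sub ((contDiffOn_dβ hM.lt hζ).smul hM.regα)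

theorem norm_skewGrad_le (hM : Motion a b κ Λ B X V) {s : ℝ} (hs : s ∈ Icc a b) (h : ℝ × ℝ) :
    ‖skewGrad X ζ s h‖ ≤ Λ * (‖dα (ζ s) h‖ + ‖dβ (ζ s) h‖) := by
  refine (norm_sub_le _ _).trans ?_
  rw [norm_smul, norm_smul]
  nlinarith [mul_le_mul_of_nonneg_left (hM.tan_β s hs h) (norm_nonneg (dα (ζ s) h)),
    mul_le_mul_of_nonneg_left (hM.tan_α s hs h) (norm_nonneg (dβ (ζ s) h))]

theorem integrableOn_skewGrad (hM : Motion a b κ Λ B X V)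
    (hζ : ContDiffOn ℝ 2 (joint ζ) (slab a b))
    (hα : ∀ s ∈ Icc a b, eLpNorm (dα (ζ s)) 2 volume ≤ ENNReal.ofReal B')
    (hβ : ∀ s ∈ Icc a b, eLpNorm (dβ (ζ s)) 2 volume ≤ ENNReal.ofReal B')
    {s : ℝ} (hs : s ∈ Icc a b) : ∀ ρ > 0,
      IntegrableOn (fun h : ℝ × ℝ => (‖h‖ ^ 2)⁻¹ * ‖skewGrad X ζ s h‖) {h | ρ < ‖h‖} := by
  have h1 := hζ.of_le one_le_two
  have hT := ((UnifTail.of_L2 (fun s hs => ContDiffOn.continuous_slice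
    (continuousOn_dα hM.lt h1) hs) hα).add (UnifTail.of_L2 (fun s hs =>
    ContDiffOn.continuous_slice (continuousOn_dβ hM.lt h1) hs) hβ)).const_mul Λ
  have := hT.mono (Φ := fun s h => (‖h‖ ^ 2)⁻¹ * ‖skewGrad X ζ s h‖)
    (fun s hs => (continuousOn_inv_norm_pow 2).mul
      (ContDiffOn.continuous_slice (hM.reg_skewGrad hζ).continuousOn hs).norm.continuousOn)
    fun s hs h h0 => by
      rw [Real.norm_of_nonneg (by positivity)]
      calc _ ≤ (‖h‖ ^ 2)⁻¹ * (Λ * (‖dα (ζ s) h‖ + ‖dβ (ζ s) h‖)) := by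
            gcongr; exact hM.norm_skewGrad_le hs h
        _ = _ := by ring
  exact this.integrableOn s hs

theorem hasPV_skewGrad (hM : Motion a b κ Λ B X V)
    (hζ : ContDiffOn ℝ 2 (joint ζ) (slab a b))
    (hα : ∀ s ∈ Icc a b, eLpNorm (dα (ζ s)) 2 volume ≤ ENNReal.ofReal B')
    (hβ : ∀ s ∈ Icc a b, eLpNorm (dβ (ζ s)) 2 volume ≤ ENNReal.ofReal B')
    {s : ℝ} (hs : s ∈ Icc a b) : HasPV (kernelIntegrand X (skewGrad X ζ) s) 0
      (symmIntegral (kernelIntegrand X (skewGrad X ζ) s)) :=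
  hM.hasPV_kernelIntegrand (hM.reg_skewGrad hζ) hs (hM.integrableOn_skewGrad hζ hα hβ hs)

theorem continuousOn_potential (hM : Motion a b κ Λ B X V) :
    ContinuousOn (joint (potential X)) (Icc a b ×ˢ {0}ᶜ) :=
  continuousOn_const.mul ((continuousOn_base hM.reg.continuousOn).punctured.norm.inv₀
    fun _ hy => norm_ne_zero_iff.2 (hM.ne hy.1 hy.2))

theorem hasDerivAt_potential (hM : Motion a b κ Λ B X V) {s : ℝ} (hs : s ∈ Icc a b) {h : ℝ × ℝ}
    (h0 : h ≠ 0) {γ : ℝ → ℝ × ℝ} {r : ℝ} {y : ℍ[ℝ]} (hγ : γ r = h)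
    (hd : HasDerivAt (fun r => X s (γ r)) y r) :
    HasDerivAt (fun r => potential X s (γ r)) (inner ℝ (K (X s h - X s 0)) y) r := by
  subst hγ
  have hn := hM.ne hs h0
  have h1 := hasDerivWithinAt_univ.1 (hasDerivWithinAt_norm
    (hd.sub_const (X s 0)).hasDerivWithinAt hn)
  have h2 := (h1.fun_inv (norm_ne_zero_iff.2 hn)).const_mul cK
  refine h2.congr_deriv ?_
  rw [K_eq, inner_smul_left]
  simp only [conj_trivial]
  have : ‖X s (γ r) - X s 0‖ ≠ 0 := norm_ne_zero_iff.2 hn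
  field_simp

theorem norm_potential_le (hM : Motion a b κ Λ B X V) {s : ℝ} (hs : s ∈ Icc a b) {h : ℝ × ℝ}
    (h0 : h ≠ 0) : ‖potential X s h‖ ≤ cK / κ * ‖h‖⁻¹ := by
  have hc := cK_pos
  have hk := hM.pos_of_ne h0
  have hp := hM.pos
  rw [potential, norm_mul, norm_inv, norm_norm, Real.norm_of_nonneg hc.le]
  calc _ ≤ cK * (κ * ‖h‖)⁻¹ := by gcongr; exact hM.chord s hs h
    _ = _ := by rw [mul_inv]; field_simp

/-- The flux of the potential is even up to a bounded error. -/
theorem exists_potential_antisymm_le (hM : Motion a b κ Λ B X V) {m : ℝ → ℝ × ℝ → ℝ}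
    (hm : ContDiffOn ℝ 1 (joint m) (slab a b)) :
    ∃ A, 0 ≤ A ∧ ∀ s ∈ Icc a b, ∀ h ≠ 0, ‖h‖ ≤ 1 →
      ‖potential X s h * m s h - potential X s (-h) * m s (-h)‖ ≤ A := by
  obtain ⟨A, hA0, hA⟩ := exists_second_diff_le hM.lt hM.reg
  obtain ⟨L, hL0, hL⟩ := exists_lipschitz hM.lt hm
  obtain ⟨G, hG0, hG⟩ := exists_bound_of_continuousOn hm.continuousOn 1
  have hc := cK_pos
  have hk := hM.pos
  refine ⟨cK * A / κ ^ 2 * G + cK / κ * (L * 2), by positivity, fun s hs h h0 h1 => ?_⟩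
  have hp : 0 < ‖h‖ := norm_pos_iff.2 h0
  have hkp : 0 < κ * ‖h‖ := by positivity
  have hx := hM.chord s hs h
  have hy := hM.chord s hs (-h)
  rw [norm_neg] at hy
  have hd : ‖potential X s h - potential X s (-h)‖ ≤ cK * A / κ ^ 2 := by
    have hn : |‖X s (-h) - X s 0‖ - ‖X s h - X s 0‖| ≤ A * ‖h‖ ^ 2 := by
      refine le_trans ?_ (hA s hs h h1)
      have := abs_norm_sub_norm_le (X s (-h) - X s 0) (-(X s h - X s 0))
      rw [norm_neg] at this
      refine this.trans_eq ?_
      congr 1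
      rw [two_smul]
      abel
    have e : potential X s h - potential X s (-h) = cK * (‖X s (-h) - X s 0‖ - ‖X s h - X s 0‖)
        / (‖X s h - X s 0‖ * ‖X s (-h) - X s 0‖) := by
      have := (hkp.trans_le hx).ne'
      have := (hkp.trans_le hy).ne'
      rw [potential, potential]
      field_simp
    rw [e, Real.norm_eq_abs, abs_div, abs_mul, abs_of_pos hc, abs_of_pos
      (mul_pos (hkp.trans_le hx) (hkp.trans_le hy))]
    calc _ ≤ cK * (A * ‖h‖ ^ 2) / (κ * ‖h‖ * (κ * ‖h‖)) := by gcongr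
      _ = _ := by field_simp
  have e : potential X s h * m s h - potential X s (-h) * m s (-h)
      = (potential X s h - potential X s (-h)) * m s h
        + potential X s (-h) * (m s h - m s (-h)) := by ring
  rw [e]
  refine (norm_add_le _ _).trans ?_
  rw [norm_mul, norm_mul]
  have hl : ‖m s h - m s (-h)‖ ≤ L * 2 * ‖h‖ := by
    refine (hL s hs h (-h) h1 (by rwa [norm_neg])).trans_eq ?_
    rw [sub_neg_eq_add, ← two_smul ℝ h, norm_smul]; norm_num; ring
  have hq := hM.norm_potential_le hs (neg_ne_zero.2 h0)
  rw [norm_neg] at hq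
  refine add_le_add (by gcongr; exact hG s hs h h1) ?_
  calc _ ≤ cK / κ * ‖h‖⁻¹ * (L * 2 * ‖h‖) := by gcongr
    _ = _ := by field_simp

theorem tendsto_potential_flux (hM : Motion a b κ Λ B X V) {m : ℝ → ℝ × ℝ → ℝ}
    (hm : ContDiffOn ℝ 1 (joint m) (slab a b))
    (hL : ∀ s ∈ Icc a b, eLpNorm (m s) 2 volume ≤ ENNReal.ofReal B') {C : ℝ}
    {D : ℕ → ℝ × ℝ → ℝ} (hC : 0 < C) (hD : ∀ n, IsCutoffGrad C n (D n)) {s : ℝ}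
    (hs : s ∈ Icc a b) :
    Tendsto (fun n => ∫ h, D n h • (potential X s h * m s h)) atTop (𝓝 0) := by
  have cm : ∀ s ∈ Icc a b, Continuous (m s) := fun s hs =>
    ContDiffOn.continuous_slice hm.continuousOn hs
  have cF : ∀ s ∈ Icc a b, ContinuousOn (fun h => potential X s h * m s h) {0}ᶜ := fun s hs =>
    (continuousOn_slice hM.continuousOn_potential hs).mul (cm s hs).continuousOn
  refine (tendstoUniformlyOn_cutoffGrad (I := Icc a b)
    (Φ := fun s h => potential X s h * m s h) hC hD cF (fun ε hε => ?_) ?_).tendsto_at hs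
  · obtain ⟨A, hA0, hA⟩ := hM.exists_potential_antisymm_le hm
    refine ⟨min 1 (ε / (A + 1)), by positivity, fun s hs h h0 h1 => ?_⟩
    have hp : 0 < ‖h‖ := norm_pos_iff.2 h0
    refine (hA s hs h h0 (h1.trans (min_le_left _ _))).trans ?_
    have h2 := h1.trans (min_le_right _ _)
    rw [le_div_iff₀ (by positivity)] at h2 ⊢
    nlinarith
  · refine ((UnifTail.of_L2 cm hL).const_mul (cK / κ)).mono (fun s hs => ?_) fun s hs h h0 => ?_
    · have := (continuousOn_inv_norm_pow 1).mul (cF s hs).norm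
      simp only [pow_one] at this
      exact this
    · have hk := hM.norm_potential_le hs h0
      rw [norm_mul, norm_inv, norm_norm, norm_norm, norm_mul]
      calc _ ≤ ‖h‖⁻¹ * (cK / κ * ‖h‖⁻¹ * ‖m s h‖) := by gcongr
        _ = _ := by rw [sq, mul_inv]; ring

/-- The scalar part of `p.v. ∬ K (ζ_α X_β - ζ_β X_α)'` vanishes: it is the integral of the
divergence of the potential times the rotated gradient of `ζ`. -/
theorem symmIntegral_skewGrad_re (hM : Motion a b κ Λ B X V)
    (hζ : ContDiffOn ℝ 2 (joint ζ) (slab a b))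
    (hα : ∀ s ∈ Icc a b, eLpNorm (dα (ζ s)) 2 volume ≤ ENNReal.ofReal B')
    (hβ : ∀ s ∈ Icc a b, eLpNorm (dβ (ζ s)) 2 volume ≤ ENNReal.ofReal B')
    {s : ℝ} (hs : s ∈ Icc a b) :
    (symmIntegral (kernelIntegrand X (skewGrad X ζ) s)).re = 0 := by
  have h1 := hζ.of_le one_le_two
  have rα := contDiffOn_dα hM.lt hζ
  have rβ := contDiffOn_dβ hM.lt hζ
  have hlim := hM.tendsto_cutoff_kernelIntegrand (hM.reg_skewGrad hζ) hs
    (hM.integrableOn_skewGrad hζ hα hβ hs)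
  have hlim' := ((innerSL ℝ (1 : ℍ[ℝ])).continuous.tendsto _).comp hlim
  rw [re_eq_inner]
  refine tendsto_nhds_unique hlim' ?_
  obtain ⟨C, hC, hχ⟩ := exists_isCutoffGrad
  have lα := hM.tendsto_potential_flux rβ hβ hC (fun n => (hχ n).1) hs
  have lβ := hM.tendsto_potential_flux rα hα hC (fun n => (hχ n).2) hs
  have l := lβ.sub lα
  rw [sub_zero] at l
  refine l.congr fun n => ?_
  have cp := continuousOn_slice hM.continuousOn_potential hs
  have cK := continuousOn_slice (F := fun s h => K (X s h - X s 0)) hM.continuousOn_K hs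
  have cα := (ContDiffOn.continuous_slice rα.continuousOn hs).continuousOn (s := {0}ᶜ)
  have cβ := (ContDiffOn.continuous_slice rβ.continuousOn hs).continuousOn (s := {0}ᶜ)
  have cXα := (ContDiffOn.continuous_slice hM.regα.continuousOn hs).continuousOn (s := {0}ᶜ)
  have cXβ := (ContDiffOn.continuous_slice hM.regβ.continuousOn hs).continuousOn (s := {0}ᶜ)
  have cαβ := (ContDiffOn.continuous_slice (continuousOn_dα hM.lt rβ) hs).continuousOn
    (s := {0}ᶜ)
  have cβα := (ContDiffOn.continuous_slice (continuousOn_dβ hM.lt rα) hs).continuousOn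
    (s := {0}ᶜ)
  have hdiv := integral_cutoff_div
    (F := fun h => potential X s h * dβ (ζ s) h) (G := fun h => -(potential X s h * dα (ζ s) h))
    (F' := fun h => inner ℝ (K (X s h - X s 0)) (dα (X s) h) * dβ (ζ s) h
      + potential X s h * dα (dβ (ζ s)) h)
    (G' := fun h => -(inner ℝ (K (X s h - X s 0)) (dβ (X s) h) * dα (ζ s) h
      + potential X s h * dβ (dα (ζ s)) h))
    (cp.mul cβ) (cp.mul cα).neg (((cK.inner cXα).mul cβ).add (cp.mul cαβ))
    (((cK.inner cXβ).mul cα).add (cp.mul cβα)).neg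
    (fun h h0 => (hM.hasDerivAt_potential hs h0 (γ := fun r => (r, h.2)) rfl
      (differentiable_slice hM.reg_one hs h).hasDerivAt_dα).mul
        (differentiable_slice rβ hs h).hasDerivAt_dα)
    (fun h h0 => ((hM.hasDerivAt_potential hs h0 (γ := fun r => (h.1, r)) rfl
      (differentiable_slice hM.reg_one hs h).hasDerivAt_dβ).mul
        (differentiable_slice rα hs h).hasDerivAt_dβ).neg) n
  simp only [smul_neg, integral_neg] at hdiv
  rw [sub_neg_eq_add, neg_add_eq_sub] at hdiv
  rw [← hdiv, Function.comp_apply, ← ContinuousLinearMap.integral_comp_comm]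
  · refine integral_congr_ae (ae_of_all _ fun h => ?_)
    simp only [map_smul, ← re_eq_inner]
    congr 1
    have kre : (K (X s h - X s 0)).re = 0 := K_re _ (by simp [hM.vec s hs])
    rw [dα_dβ_comm (contDiff_slice hζ hs) h, kernelIntegrand, skewGrad, inner_eq, inner_eq]
    simp [kre, hM.vec_α hs, hM.vec_β hs]
    ring
  · have := continuousOn_slice (hM.continuousOn_kernelIntegrand
      (hM.reg_skewGrad hζ).continuousOn) hs
    exact integrable_cutoff_smul_of_continuousOn this n

end Motion

end Scalar

/-! ### Moving base points -/

section Shift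

variable {E : Type*} [NormedAddCommGroup E] [NormedSpace ℝ E] {a b κ Λ B : ℝ}
  {c : ℝ → ℝ × ℝ} {f g η : ℝ → ℝ × ℝ → E}

/-- The family `f` seen from the moving base point `c s`. -/
def shift (c : ℝ → ℝ × ℝ) (f : ℝ → ℝ × ℝ → E) (s : ℝ) (h : ℝ × ℝ) : E := f s (c s + h)

theorem contDiffOn_shift {n : WithTop ℕ∞} (hc : ContDiff ℝ n c)
    (hf : ContDiffOn ℝ n (joint f) (slab a b)) : ContDiffOn ℝ n (joint (shift c f)) (slab a b) := by
  have h1 : ContDiff ℝ n fun y : ℝ × (ℝ × ℝ) => (y.1, c y.1 + y.2) :=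
    contDiff_fst.prodMk ((hc.comp contDiff_fst).add contDiff_snd)
  exact hf.comp h1.contDiffOn fun y hy => mem_slab hy.1 _

theorem dα_add_left (g : ℝ × ℝ → E) (p : ℝ × ℝ) :
    dα (fun h => g (p + h)) = fun h => dα g (p + h) := by
  funext h
  exact deriv_comp_const_add (f := fun r => g (r, p.2 + h.2)) p.1 h.1

theorem dβ_add_left (g : ℝ × ℝ → E) (p : ℝ × ℝ) :
    dβ (fun h => g (p + h)) = fun h => dβ g (p + h) := by
  funext h
  exact deriv_comp_const_add (f := fun r => g (p.1 + h.1, r)) p.2 h.2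

theorem dα_shift (s : ℝ) : dα (shift c f s) = shift c (fun s => dα (f s)) s := dα_add_left _ _

theorem dβ_shift (s : ℝ) : dβ (shift c f s) = shift c (fun s => dβ (f s)) s := dβ_add_left _ _

theorem eLpNorm_shift {F : Type*} [NormedAddCommGroup F] {f : ℝ → ℝ × ℝ → F} {s : ℝ} (hf : Continuous (f s))
    (r : ENNReal) : eLpNorm (shift c f s) r volume = eLpNorm (f s) r volume :=
  eLpNorm_comp_measurePreserving hf.aestronglyMeasurable
    (measurePreserving_add_left (volume : Measure (ℝ × ℝ)) (c s))

theorem normal_shift {X : ℝ → ℝ × ℝ → ℍ[ℝ]} (s : ℝ) (h : ℝ × ℝ) :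
    normal (shift c X s) h = normal (X s) (c s + h) := by
  rw [normal, dα_shift, dβ_shift]; rfl

theorem hilbertIntegrand_shift {X f : ℝ → ℝ × ℝ → ℍ[ℝ]} (s : ℝ) (h : ℝ × ℝ) :
    hilbertIntegrand (shift c X s) (shift c f s) 0 h
      = hilbertIntegrand (X s) (f s) (c s) (c s + h) := by
  simp [hilbertIntegrand, normal_shift, shift]

theorem crossIntegrand_shift {g η f : ℝ → ℝ × ℝ → ℍ[ℝ]} (k : ℍ[ℝ]) (s : ℝ) (h : ℝ × ℝ) :
    crossIntegrand k (shift c g s) (shift c η s) (shift c f s) 0 h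
      = crossIntegrand k (g s) (η s) (f s) (c s) (c s + h) := by
  simp [crossIntegrand, dα_shift, dβ_shift, shift]

theorem hasPV_hilbertIntegrand_shift {X f : ℝ → ℝ × ℝ → ℍ[ℝ]} {s : ℝ} {L : ℍ[ℝ]} :
    HasPV (hilbertIntegrand (shift c X s) (shift c f s) 0) 0 L
      ↔ HasPV (hilbertIntegrand (X s) (f s) (c s)) (c s) L := by
  rw [funext (hilbertIntegrand_shift s), hasPV_translate_iff]

theorem norm_le_pdist_sub (p q : ℝ × ℝ) : ‖p - q‖ ≤ pdist p q := by
  simpa [pdist] using norm_le_pdist (p - q)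

theorem motion_shift {X V : ℝ → ℝ × ℝ → ℍ[ℝ]} (hab : a < b) (hκ : 0 < κ)
    (hc : ContDiff ℝ 2 c) (hvec : ∀ s ∈ Icc a b, ∀ q, (X s q).re = 0)
    (hX : ContDiffOn ℝ 2 (joint X) (slab a b))
    (hchord : ∀ s ∈ Icc a b, ∀ p q, κ * pdist p q ≤ ‖X s p - X s q‖)
    (hα : ∀ s ∈ Icc a b, ∀ q, ‖dα (X s) q‖ ≤ Λ) (hβ : ∀ s ∈ Icc a b, ∀ q, ‖dβ (X s) q‖ ≤ Λ)
    (hV : ∀ s ∈ Icc a b, ∀ h, HasDerivWithinAt (fun r => X r (c r + h)) (V s h) (Icc a b) s)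
    (hB : ∀ s ∈ Icc a b, ∀ h, ‖V s h‖ ≤ B) : Motion a b κ Λ B (shift c X) V where
  lt := hab
  pos := hκ
  vec s hs q := hvec s hs _
  reg := contDiffOn_shift hc hX
  deriv := hV
  chord s hs h := by
    refine le_trans ?_ (hchord s hs _ _)
    gcongr
    simpa using norm_le_pdist_sub (c s + h) (c s + 0)
  tan_α s hs q := by rw [dα_shift]; exact hα s hs _
  tan_β s hs q := by rw [dβ_shift]; exact hβ s hs _
  vel := hB

end Shift

/-! ### Densities -/

section Density

variable {E : Type*} [NormedAddCommGroup E]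

/-- Hölder's inequality at infinity: `‖h‖⁻²` lies in every `L^q`, `q > 1`, off a ball. -/
theorem integrableOn_inv_sq_mul_of_memLp {f : ℝ × ℝ → E} {r : ENNReal} (hr : 1 ≤ r) (hr' : r ≠ ⊤)
    (hf : MemLp f r volume) {ρ : ℝ} (hρ : 0 < ρ) :
    IntegrableOn (fun h : ℝ × ℝ => (‖h‖ ^ 2)⁻¹ * ‖f h‖) {h | ρ < ‖h‖} := by
  have hmw : Measurable fun h : ℝ × ℝ => (‖h‖ ^ 2)⁻¹ := by fun_prop
  have hm := (hmw.aestronglyMeasurable (μ := volume.restrict {h : ℝ × ℝ | ρ < ‖h‖})).mul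
    hf.1.norm.restrict
  have hr0 : r ≠ 0 := (zero_lt_one.trans_le hr).ne'
  have hi : Integrable fun h => ‖f h‖ ^ r.toReal := hf.integrable_norm_rpow hr0 hr'
  have h1 : 1 ≤ r.toReal := by
    simpa using (ENNReal.toReal_le_toReal ENNReal.one_ne_top hr').2 hr
  rcases h1.eq_or_lt with h1 | h1
  · rw [← h1] at hi
    refine Integrable.mono' (hi.integrableOn.const_mul (ρ ^ 2)⁻¹) hm ?_
    refine (ae_restrict_iff' (measurableSet_lt_norm ρ)).2 (ae_of_all _ fun h hh => ?_)
    have hh : ρ < ‖h‖ := hh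
    rw [Real.norm_of_nonneg (by positivity), Real.rpow_one]
    gcongr
  · obtain ⟨q, hq⟩ : ∃ q, r.toReal.HolderConjugate q := ⟨_, Real.HolderConjugate.conjExponent h1⟩
    have hw := integrableOn_rpow_norm (r := -(2 * q)) (by linarith [hq.symm.lt]) hρ
    refine Integrable.mono' ((hi.integrableOn.div_const r.toReal).add (hw.div_const q)) hm ?_
    refine (ae_restrict_iff' (measurableSet_lt_norm ρ)).2 (ae_of_all _ fun h hh => ?_)
    have hh : ρ < ‖h‖ := hh
    have hp : 0 ≤ ‖h‖ := norm_nonneg h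
    rw [Real.norm_of_nonneg (by positivity), mul_comm]
    refine (Real.young_inequality_of_nonneg (norm_nonneg _) (by positivity) hq).trans_eq ?_
    congr 2
    rw [← Real.rpow_natCast, ← Real.rpow_neg hp, ← Real.rpow_mul hp]
    congr 1
    push_cast
    ring

variable {a b B C : ℝ} {f fs : ℝ → ℝ × ℝ → ℍ[ℝ]}

/-- A density with bounded parameter derivative; boundedness provides the majorant. -/
theorem Density.of_bounded (hab : a < b) (hf : ContDiffOn ℝ 1 (joint f) (slab a b))
    (hfs : ContDiffOn ℝ 1 (joint fs) (slab a b))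
    (hd : ∀ s ∈ Icc a b, ∀ q, HasDerivWithinAt (fun r => f r q) (fs s q) (Icc a b) s)
    (hi : ∀ s ∈ Icc a b, ∀ ρ > 0,
      IntegrableOn (fun h : ℝ × ℝ => (‖h‖ ^ 2)⁻¹ * ‖f s h‖) {h | ρ < ‖h‖})
    (hC : ∀ s ∈ Icc a b, ∀ h, ‖fs s h‖ ≤ C)
    (hα : ∀ s ∈ Icc a b, eLpNorm (dα (f s)) 2 volume ≤ ENNReal.ofReal B)
    (hβ : ∀ s ∈ Icc a b, eLpNorm (dβ (f s)) 2 volume ≤ ENNReal.ofReal B)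
    (hL : ∀ s ∈ Icc a b, eLpNorm (fs s) 2 volume ≤ ENNReal.ofReal B) : Density a b B f fs where
  reg := hf
  reg_deriv := hfs
  deriv := hd
  integrableOn := hi
  L2_α := hα
  L2_β := hβ
  L2_deriv := hL
  majorant := by
    have ha : a ∈ Icc a b := ⟨le_rfl, hab.le⟩
    have hC0 : 0 ≤ C := (norm_nonneg _).trans (hC a ha 0)
    have hf0 := ContDiffOn.continuous_slice hf.continuousOn ha
    refine ⟨fun h => ‖f a h‖ + C * (b - a), fun ρ hρ => ?_, fun s hs h => ?_⟩
    · have h1 : IntegrableOn (fun h : ℝ × ℝ => (‖h‖ ^ 3)⁻¹ * ‖f a h‖) {h | ρ < ‖h‖} := by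
        have hmw : Measurable fun h : ℝ × ℝ => (‖h‖ ^ 3)⁻¹ := by fun_prop
        refine Integrable.mono' ((hi a ha ρ hρ).const_mul ρ⁻¹)
          (hmw.mul hf0.norm.measurable).aestronglyMeasurable ?_
        refine (ae_restrict_iff' (measurableSet_lt_norm ρ)).2 (ae_of_all _ fun h hh => ?_)
        have hh : ρ < ‖h‖ := hh
        rw [Real.norm_of_nonneg (by positivity)]
        calc _ = ‖h‖⁻¹ * ((‖h‖ ^ 2)⁻¹ * ‖f a h‖) := by rw [pow_succ', mul_inv, mul_assoc]
          _ ≤ _ := by gcongr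
      have h2 := (integrableOn_inv_norm_pow (le_refl 3) hρ).mul_const (C * (b - a))
      simp only [mul_add]
      exact h1.add h2
    · have := Convex.norm_image_sub_le_of_norm_hasDerivWithin_le (fun r hr => hd r hr h)
        (fun r hr => hC r hr h) (convex_Icc a b) ha hs
      rw [Real.norm_of_nonneg (by linarith [hs.1])] at this
      have h3 : ‖f s h‖ ≤ ‖f a h‖ + ‖f s h - f a h‖ := by
        simpa using norm_add_le (f a h) (f s h - f a h)
      have h4 : C * (s - a) ≤ C * (b - a) := by gcongr; exact hs.2
      linarith

theorem memLp_shift {c : ℝ → ℝ × ℝ} {s : ℝ} {r : ENNReal} (hf : Continuous (f s))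
    (hm : MemLp (f s) r volume) : MemLp (shift c f s) r volume :=
  ⟨(hf.comp (continuous_const.add continuous_id)).aestronglyMeasurable,
    (eLpNorm_shift hf r).trans_lt hm.2⟩

theorem density_shift {c : ℝ → ℝ × ℝ} {r : ENNReal} (hr : 1 ≤ r) (hr' : r ≠ ⊤) (hab : a < b)
    (hc : ContDiff ℝ 1 c) (hf : ContDiffOn ℝ 1 (joint f) (slab a b))
    (hfs : ContDiffOn ℝ 1 (joint fs) (slab a b))
    (hd : ∀ s ∈ Icc a b, ∀ h,
      HasDerivWithinAt (fun r => f r (c r + h)) (fs s (c s + h)) (Icc a b) s)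
    (hm : ∀ s ∈ Icc a b, MemLp (f s) r volume) (hC : ∀ s ∈ Icc a b, ∀ h, ‖fs s h‖ ≤ C)
    (hα : ∀ s ∈ Icc a b, eLpNorm (dα (f s)) 2 volume ≤ ENNReal.ofReal B)
    (hβ : ∀ s ∈ Icc a b, eLpNorm (dβ (f s)) 2 volume ≤ ENNReal.ofReal B)
    (hL : ∀ s ∈ Icc a b, eLpNorm (fs s) 2 volume ≤ ENNReal.ofReal B) :
    Density a b B (shift c f) (shift c fs) := by
  have cs : ∀ {g : ℝ → ℝ × ℝ → ℍ[ℝ]}, ContinuousOn (joint g) (slab a b) → ∀ s ∈ Icc a b,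
      Continuous (g s) := fun hg s hs => ContDiffOn.continuous_slice hg hs
  refine Density.of_bounded hab (contDiffOn_shift hc hf) (contDiffOn_shift hc hfs) hd
    (fun s hs ρ hρ => integrableOn_inv_sq_mul_of_memLp hr hr'
      (memLp_shift (cs hf.continuousOn s hs) (hm s hs)) hρ)
    (fun s hs h => hC s hs _) (fun s hs => ?_) (fun s hs => ?_) fun s hs => ?_
  · rw [dα_shift, eLpNorm_shift (f := fun s => dα (f s)) (cs (continuousOn_dα hab hf) s hs)]
    exact hα s hs
  · rw [dβ_shift, eLpNorm_shift (f := fun s => dβ (f s)) (cs (continuousOn_dβ hab hf) s hs)]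
    exact hβ s hs
  · rw [eLpNorm_shift (cs hfs.continuousOn s hs)]
    exact hL s hs

end Density

/-! ### The height as a linear function of the surface -/

section Height

variable {E F : Type*} [NormedAddCommGroup E] [NormedSpace ℝ E] [NormedAddCommGroup F]
  [NormedSpace ℝ F]

theorem dα_clm (L : E →L[ℝ] F) {g : ℝ × ℝ → E} (hg : Differentiable ℝ g) :
    dα (fun q => L (g q)) = fun q => L (dα g q) := by
  funext q
  exact (L.hasFDerivAt.comp_hasDerivAt _ (hg q).hasDerivAt_dα).deriv

theorem dβ_clm (L : E →L[ℝ] F) {g : ℝ × ℝ → E} (hg : Differentiable ℝ g) :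
    dβ (fun q => L (g q)) = fun q => L (dβ g q) := by
  funext q
  exact (L.hasFDerivAt.comp_hasDerivAt _ (hg q).hasDerivAt_dβ).deriv

/-- The height of a point, as a Clifford number. -/
def heightL : ℍ[ℝ] →L[ℝ] ℍ[ℝ] := (innerSL ℝ e3).smulRight 1

/-- The vertical part `z e₃` of a point. -/
def vertL : ℍ[ℝ] →L[ℝ] ℍ[ℝ] := (innerSL ℝ e3).smulRight e3

theorem heightL_apply (σ : ℍ[ℝ]) : heightL σ = (σ.imK : ℍ[ℝ]) := by
  rw [heightL, ContinuousLinearMap.smulRight_apply, ← imK_eq_inner]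
  ext <;> simp

theorem vertL_apply (σ : ℍ[ℝ]) : vertL σ = σ.imK • e3 := by
  rw [vertL, ContinuousLinearMap.smulRight_apply, ← imK_eq_inner]

theorem heightL_mul_e3 (σ : ℍ[ℝ]) : heightL σ * e3 = vertL σ := by
  rw [heightL_apply, vertL_apply, Quaternion.coe_mul_eq_smul]

theorem norm_heightL (σ : ℍ[ℝ]) : ‖heightL σ‖ = |σ.imK| := by
  rw [heightL_apply, Quaternion.norm_coe, Real.norm_eq_abs]

theorem norm_vertL (σ : ℍ[ℝ]) : ‖vertL σ‖ = |σ.imK| := by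
  rw [← heightL_mul_e3, norm_mul, norm_e3, mul_one, norm_heightL]

theorem norm_vertL_le (σ : ℍ[ℝ]) : ‖vertL σ‖ ≤ ‖σ‖ := (norm_vertL σ).trans_le (abs_imK_le σ)

theorem heightC_eq (ξ : ℝ × ℝ → ℍ[ℝ]) : heightC ξ = fun q => heightL (ξ q) := by
  funext q; rw [heightL_apply]; rfl

theorem heightC_mul_e3 (ξ : ℝ × ℝ → ℍ[ℝ]) :
    (fun q => heightC ξ q * e3) = fun q => vertL (ξ q) := by
  funext q; rw [heightC_eq, heightL_mul_e3]

theorem height_eq (ξ : ℝ × ℝ → ℍ[ℝ]) : height ξ = fun q => innerSL ℝ e3 (ξ q) := by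
  funext q; rw [← imK_eq_inner]; rfl

theorem dα_height {ξ : ℝ × ℝ → ℍ[ℝ]} (h : Differentiable ℝ ξ) :
    dα (height ξ) = fun q => (dα ξ q).imK := by
  rw [height_eq, dα_clm _ h]; funext q; rw [imK_eq_inner]

theorem dβ_height {ξ : ℝ × ℝ → ℍ[ℝ]} (h : Differentiable ℝ ξ) :
    dβ (height ξ) = fun q => (dβ ξ q).imK := by
  rw [height_eq, dβ_clm _ h]; funext q; rw [imK_eq_inner]

theorem crossIntegrand_vertL {X : ℝ × ℝ → ℍ[ℝ]} (hX : Differentiable ℝ X) (k : ℍ[ℝ])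
    (g η : ℝ × ℝ → ℍ[ℝ]) (p q : ℝ × ℝ) : crossIntegrand k g η (fun q => vertL (X q)) p q
      = crossIntegrand k g η (heightC X) p q * e3 := by
  rw [heightC_eq]
  simp only [crossIntegrand, dα_clm vertL hX, dβ_clm vertL hX, dα_clm heightL hX,
    dβ_clm heightL hX]
  simp only [← heightL_mul_e3]
  noncomm_ring

theorem cbar_eq_of_re {σ : ℍ[ℝ]} (h : σ.re = 0) : cbar σ = σ - (2 : ℝ) • vertL σ := by
  rw [vertL_apply]
  ext <;> (simp [cbar, h]; try ring)

theorem contDiffOn_clm {n : WithTop ℕ∞} {a b : ℝ} {f : ℝ → ℝ × ℝ → E} (L : E →L[ℝ] F)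
    (hf : ContDiffOn ℝ n (joint f) (slab a b)) :
    ContDiffOn ℝ n (joint fun s q => L (f s q)) (slab a b) :=
  L.contDiff.comp_contDiffOn hf

end Height

theorem hasPV_of_integrable {F : ℝ × ℝ → ℍ[ℝ]} (hF : Integrable F) (p : ℝ × ℝ) :
    HasPV F p (∫ q, F q) := by
  rw [← hasPV_translate_iff, ← integral_add_left_eq_self F p]
  exact (hF.comp_add_left p).hasPV

theorem integrable_of_comp_add_left {F : ℝ × ℝ → ℍ[ℝ]} {p : ℝ × ℝ}
    (hF : Integrable fun h => F (p + h)) : Integrable F := by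
  simpa using hF.comp_add_left (-p)

theorem HasPV.hilbert_eq {X f : ℝ × ℝ → ℍ[ℝ]} {p : ℝ × ℝ} {L : ℍ[ℝ]}
    (h : HasPV (hilbertIntegrand X f p) p L) : hilbert X f p = L := h.2.limUnder_eq

/-! ### Time derivatives along a solution -/

namespace IsSolution

variable {T κ Λ B : ℝ} {ξ v w : ℝ → ℝ × ℝ → ℍ[ℝ]} {a : ℝ → ℝ × ℝ → ℝ}

/-- The uniform bounds on a solution, with a chosen constant. -/
def Bounded (T B : ℝ) (ξ v w : ℝ → ℝ × ℝ → ℍ[ℝ]) : Prop :=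
  ∀ t ∈ Icc 0 T, SizeBound (ξ t) (v t) B ∧ eLpNorm (v t) 2 volume ≤ ENNReal.ofReal B ∧
    eLpNorm (w t) 2 volume ≤ ENNReal.ofReal B ∧ ∀ p, ‖w t p‖ ≤ B

theorem regV (hS : IsSolution T κ Λ ξ v w a) (hT : 0 < T) :
    ContDiffOn ℝ 1 (joint v) (slab 0 T) :=
  contDiffOn_paramDeriv hT hS.regular_ξ hS.hasDeriv_ξ

theorem reg_one (hS : IsSolution T κ Λ ξ v w a) : ContDiffOn ℝ 1 (joint ξ) (slab 0 T) :=
  hS.regular_ξ.of_le one_le_two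

theorem diffξ (hS : IsSolution T κ Λ ξ v w a) {t : ℝ} (ht : t ∈ Icc 0 T) :
    Differentiable ℝ (ξ t) := differentiable_slice hS.reg_one ht

theorem diffV (hS : IsSolution T κ Λ ξ v w a) (hT : 0 < T) {t : ℝ} (ht : t ∈ Icc 0 T) :
    Differentiable ℝ (v t) := differentiable_slice (hS.regV hT) ht

/-- The surface seen from a fixed Lagrangian point. -/
theorem motion (hS : IsSolution T κ Λ ξ v w a) (hκ : 0 < κ) (hT : 0 < T)
    (hB : Bounded T B ξ v w) (p : ℝ × ℝ) :
    Motion 0 T κ Λ B (shift (fun _ => p) ξ) (shift (fun _ => p) v) :=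
  motion_shift hT hκ contDiff_const hS.isVector hS.regular_ξ hS.chordArc hS.tangent_α
    hS.tangent_β (fun s hs h => hS.hasDeriv_ξ s hs (p + h)) fun s hs _ => (hB s hs).1.vel _

theorem eLpNorm_vertL_le {g : ℝ × ℝ → ℍ[ℝ]} (h : eLpNorm g 2 volume ≤ ENNReal.ofReal B) :
    eLpNorm (fun q => vertL (g q)) 2 volume ≤ ENNReal.ofReal B :=
  (eLpNorm_mono fun _ => norm_vertL_le _).trans h

theorem eLpNorm_dα_vertL (hS : IsSolution T κ Λ ξ v w a) (hB : Bounded T B ξ v w) {t : ℝ}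
    (ht : t ∈ Icc 0 T) : eLpNorm (dα fun q => vertL (ξ t q)) 2 volume ≤ ENNReal.ofReal B := by
  refine le_trans (eLpNorm_mono fun q => ?_) (hB t ht).1.slope_α_L2
  rw [dα_clm _ (hS.diffξ ht), dα_height (hS.diffξ ht), norm_vertL, Real.norm_eq_abs]

theorem eLpNorm_dβ_vertL (hS : IsSolution T κ Λ ξ v w a) (hB : Bounded T B ξ v w) {t : ℝ}
    (ht : t ∈ Icc 0 T) : eLpNorm (dβ fun q => vertL (ξ t q)) 2 volume ≤ ENNReal.ofReal B := by
  refine le_trans (eLpNorm_mono fun q => ?_) (hB t ht).1.slope_β_L2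
  rw [dβ_clm _ (hS.diffξ ht), dβ_height (hS.diffξ ht), norm_vertL, Real.norm_eq_abs]

theorem eLpNorm_dα_vertL_vel (hS : IsSolution T κ Λ ξ v w a) (hT : 0 < T)
    (hB : Bounded T B ξ v w) {t : ℝ} (ht : t ∈ Icc 0 T) :
    eLpNorm (dα fun q => vertL (v t q)) 2 volume ≤ ENNReal.ofReal B := by
  rw [dα_clm _ (hS.diffV hT ht)]
  exact eLpNorm_vertL_le (hB t ht).1.vel_α_L2

theorem eLpNorm_dβ_vertL_vel (hS : IsSolution T κ Λ ξ v w a) (hT : 0 < T)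
    (hB : Bounded T B ξ v w) {t : ℝ} (ht : t ∈ Icc 0 T) :
    eLpNorm (dβ fun q => vertL (v t q)) 2 volume ≤ ENNReal.ofReal B := by
  rw [dβ_clm _ (hS.diffV hT ht)]
  exact eLpNorm_vertL_le (hB t ht).1.vel_β_L2

theorem memLp_two {g : ℝ × ℝ → ℍ[ℝ]} (hg : Continuous g)
    (h : eLpNorm g 2 volume ≤ ENNReal.ofReal B) : MemLp g 2 volume :=
  ⟨hg.aestronglyMeasurable, h.trans_lt ENNReal.ofReal_lt_top⟩

theorem memLp_vertL {r : ENNReal} (hS : IsSolution T κ Λ ξ v w a) {t : ℝ} (ht : t ∈ Icc 0 T)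
    (hr : MemLp (height (ξ t)) r volume) : MemLp (fun q => vertL (ξ t q)) r volume := by
  refine hr.of_le ((vertL.continuous.comp (hS.diffξ ht).continuous).aestronglyMeasurable)
    (ae_of_all _ fun q => ?_)
  rw [norm_vertL]; exact le_rfl

/-- The density `z e₃`. -/
theorem density_height (hS : IsSolution T κ Λ ξ v w a) (hT : 0 < T) (hB : Bounded T B ξ v w)
    (p : ℝ × ℝ) :
    Density 0 T B (shift (fun _ => p) fun s q => vertL (ξ s q))
    (shift (fun _ => p) fun s q => vertL (v s q)) := by
  obtain ⟨r, hr, hr', hm⟩ := hS.height_decay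
  exact density_shift hr hr' hT contDiff_const (contDiffOn_clm vertL hS.reg_one)
    (contDiffOn_clm vertL (hS.regV hT))
    (fun s hs h => vertL.hasFDerivAt.comp_hasDerivWithinAt s (hS.hasDeriv_ξ s hs (p + h)))
    (fun s hs => hS.memLp_vertL hs (hm s hs))
    (fun s hs _ => (norm_vertL_le _).trans ((hB s hs).1.vel _))
    (fun s hs => hS.eLpNorm_dα_vertL hB hs) (fun s hs => hS.eLpNorm_dβ_vertL hB hs)
    fun s hs => eLpNorm_vertL_le (hB s hs).2.1

/-- The density `z_t e₃`. -/
theorem density_heightVel (hS : IsSolution T κ Λ ξ v w a) (hT : 0 < T) (hB : Bounded T B ξ v w)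
    (p : ℝ × ℝ) :
    Density 0 T B (shift (fun _ => p) fun s q => vertL (v s q))
    (shift (fun _ => p) fun s q => vertL (w s q)) :=
  density_shift one_le_two (by simp) hT contDiff_const (contDiffOn_clm vertL (hS.regV hT))
    (contDiffOn_clm vertL hS.regular_w)
    (fun s hs h => vertL.hasFDerivAt.comp_hasDerivWithinAt s (hS.hasDeriv_v s hs (p + h)))
    (fun s hs => memLp_two (vertL.continuous.comp (hS.diffV hT hs).continuous)
      (eLpNorm_vertL_le (hB s hs).2.1))
    (fun s hs _ => (norm_vertL_le _).trans ((hB s hs).2.2.2 _))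
    (fun s hs => hS.eLpNorm_dα_vertL_vel hT hB hs) (fun s hs => hS.eLpNorm_dβ_vertL_vel hT hB hs)
    fun s hs => eLpNorm_vertL_le (hB s hs).2.2.1

/-- The density `ξ_t`. -/
theorem density_vel (hS : IsSolution T κ Λ ξ v w a) (hT : 0 < T) (hB : Bounded T B ξ v w)
    (p : ℝ × ℝ) :
    Density 0 T B (shift (fun _ => p) v) (shift (fun _ => p) w) :=
  density_shift one_le_two (by simp) hT contDiff_const (hS.regV hT) hS.regular_w
    (fun s hs h => hS.hasDeriv_v s hs (p + h))
    (fun s hs => memLp_two (hS.diffV hT hs).continuous (hB s hs).2.1)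
    (fun s hs _ => (hB s hs).2.2.2 _) (fun s hs => (hB s hs).1.vel_α_L2)
    (fun s hs => (hB s hs).1.vel_β_L2) fun s hs => (hB s hs).2.2.1

end IsSolution

/-! ### The Hilbert transform at a moving base point -/

theorem hasPV_of_integrable_comp_add {F : ℝ × ℝ → ℍ[ℝ]} {p : ℝ × ℝ}
    (hF : Integrable fun h => F (p + h)) : HasPV F p (∫ h, F (p + h)) :=
  hasPV_translate_iff.1 hF.hasPV

section ShiftHilbert

variable {a b κ Λ B B' : ℝ} {c : ℝ → ℝ × ℝ} {X V f fs : ℝ → ℝ × ℝ → ℍ[ℝ]}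

theorem Motion.hasPV_hilbert_shift (hM : Motion a b κ Λ B (shift c X) V)
    (hf : ContDiffOn ℝ 1 (joint (shift c f)) (slab a b)) {s : ℝ} (hs : s ∈ Icc a b)
    (hi : ∀ ρ > 0, IntegrableOn (fun h : ℝ × ℝ => (‖h‖ ^ 2)⁻¹ * ‖shift c f s h‖) {h | ρ < ‖h‖}) :
    HasPV (hilbertIntegrand (X s) (f s) (c s)) (c s)
      (symmIntegral (hilbertIntegrand (shift c X s) (shift c f s) 0)) :=
  hasPV_hilbertIntegrand_shift.1 (hM.hasPV_hilbert hf hs hi)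

theorem Density.integrableOn_deriv (hf : Density a b B f fs) {s : ℝ} (hs : s ∈ Icc a b) :
    ∀ ρ > 0, IntegrableOn (fun h : ℝ × ℝ => (‖h‖ ^ 2)⁻¹ * ‖fs s h‖) {h | ρ < ‖h‖} :=
  fun _ hρ => (integrableOn_inv_sq_mul_of_memLp one_le_two (by simp)
    ⟨(ContDiffOn.continuous_slice hf.reg_deriv.continuousOn hs).aestronglyMeasurable,
      (hf.L2_deriv s hs).trans_lt ENNReal.ofReal_lt_top⟩ hρ)

/-- The derivative of the Hilbert transform at a moving base point. -/
theorem Motion.hasDerivWithinAt_hilbert_shift (hM : Motion a b κ Λ B (shift c X) V)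
    (hf : Density a b B' (shift c f) (shift c fs)) {s : ℝ} (hs : s ∈ Icc a b) :
    HasDerivWithinAt (fun r => hilbert (X r) (f r) (c r))
      ((∫ h, commIntegrand (shift c X) V (shift c f) s h) + hilbert (X s) (fs s) (c s))
      (Icc a b) s := by
  have h1 := hM.hasDerivWithinAt_hilbert hf hs
  have e : ∀ r ∈ Icc a b, hilbert (X r) (f r) (c r)
      = symmIntegral (hilbertIntegrand (shift c X r) (shift c f r) 0) := fun r hr =>
    (hM.hasPV_hilbert_shift hf.reg hr (hf.integrableOn r hr)).hilbert_eq
  rw [(hM.hasPV_hilbert_shift hf.reg_deriv hs (hf.integrableOn_deriv hs)).hilbert_eq]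
  exact h1.congr e (e s hs)

end ShiftHilbert

/-! ### The normal derivative operator applied to the Hilbert transform of the height -/

section Space

variable {κ Λ B : ℝ} {η : ℝ × ℝ → ℍ[ℝ]} {r : ENNReal}

/-- A `C²` chord-arc surface with bounded tangent vectors whose height decays and has
square integrable gradient. -/
structure FlatSurface (κ Λ B : ℝ) (η : ℝ × ℝ → ℍ[ℝ]) : Prop where
  pos : 0 < κ
  vec : ∀ q, (η q).re = 0
  reg : ContDiff ℝ 2 η
  chord : ∀ p q, κ * pdist p q ≤ ‖η p - η q‖
  tan_α : ∀ q, ‖dα η q‖ ≤ Λ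
  tan_β : ∀ q, ‖dβ η q‖ ≤ Λ
  decay : ∃ r : ENNReal, 1 ≤ r ∧ r ≠ ⊤ ∧ MemLp (height η) r volume
  L2_α : eLpNorm (dα (height η)) 2 volume ≤ ENNReal.ofReal B
  L2_β : eLpNorm (dβ (height η)) 2 volume ≤ ENNReal.ofReal B

theorem contDiffOn_const_family {E : Type*} [NormedAddCommGroup E] [NormedSpace ℝ E]
    {n : WithTop ℕ∞} {g : ℝ × ℝ → E} (hg : ContDiff ℝ n g) (a b : ℝ) :
    ContDiffOn ℝ n (joint fun _ => g) (slab a b) := (hg.comp contDiff_snd).contDiffOn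

theorem hasDerivAt_comp_line {g y : ℝ × ℝ → ℍ[ℝ]} (hg : Differentiable ℝ g) {e : ℝ × ℝ}
    (he : ∀ q, fderiv ℝ g q e = y q) (p h : ℝ × ℝ) (s : ℝ) :
    HasDerivAt (fun r => g (p + r • e + h)) (y (p + s • e + h)) s := by
  rw [← he]
  have h1 : HasDerivAt (fun r : ℝ => p + r • e + h) e s := by
    simpa using (((hasDerivAt_id s).smul_const e).const_add p).add_const h
  exact (hg _).hasFDerivAt.comp_hasDerivAt s h1

theorem hasDerivAt_of_line_α {H : ℝ × ℝ → ℍ[ℝ]} {p : ℝ × ℝ} {D : ℍ[ℝ]}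
    (h : HasDerivAt (fun s : ℝ => H (p + s • ((1 : ℝ), (0 : ℝ)))) D 0) :
    HasDerivAt (fun s => H (s, p.2)) D p.1 := by
  have h1 := HasDerivAt.comp_sub_const p.1 p.1 (f' := D)
    (f := fun s : ℝ => H (p + s • ((1 : ℝ), (0 : ℝ))))
    (by rwa [sub_self])
  refine h1.congr_of_eventuallyEq (Eventually.of_forall fun s => ?_)
  have e : p + (s - p.1) • ((1 : ℝ), (0 : ℝ)) = (s, p.2) := by ext <;> simp
  simp only [e]

theorem hasDerivAt_of_line_β {H : ℝ × ℝ → ℍ[ℝ]} {p : ℝ × ℝ} {D : ℍ[ℝ]}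
    (h : HasDerivAt (fun s : ℝ => H (p + s • ((0 : ℝ), (1 : ℝ)))) D 0) :
    HasDerivAt (fun s => H (p.1, s)) D p.2 := by
  have h1 := HasDerivAt.comp_sub_const p.2 p.2 (f' := D)
    (f := fun s : ℝ => H (p + s • ((0 : ℝ), (1 : ℝ))))
    (by rwa [sub_self])
  refine h1.congr_of_eventuallyEq (Eventually.of_forall fun s => ?_)
  have e : p + (s - p.2) • ((0 : ℝ), (1 : ℝ)) = (p.1, s) := by ext <;> simp
  simp only [e]

namespace FlatSurface

theorem diff (hη : FlatSurface κ Λ B η) : Differentiable ℝ η := hη.reg.differentiable two_ne_zero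

theorem reg_dα (hη : FlatSurface κ Λ B η) : ContDiff ℝ 1 (dα η) :=
  contDiff_slice (contDiffOn_dα one_pos (contDiffOn_const_family hη.reg 0 1)) (s := 0) (by simp)

theorem reg_dβ (hη : FlatSurface κ Λ B η) : ContDiff ℝ 1 (dβ η) :=
  contDiff_slice (contDiffOn_dβ one_pos (contDiffOn_const_family hη.reg 0 1)) (s := 0) (by simp)

/-- The surface translated in its parameter plane in the direction `e`. -/
theorem motion (hη : FlatSurface κ Λ B η) {e : ℝ × ℝ} {y : ℝ × ℝ → ℍ[ℝ]}
    (he : ∀ q, fderiv ℝ η q e = y q) (hy : ∀ q, ‖y q‖ ≤ Λ) (p : ℝ × ℝ) :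
    Motion (-1) 1 κ Λ Λ (shift (fun s => p + s • e) fun _ => η)
      (shift (fun s => p + s • e) fun _ => y) := by
  refine motion_shift (by norm_num) hη.pos (by fun_prop) (fun _ _ => hη.vec)
    (contDiffOn_const_family hη.reg _ _) (fun _ _ => hη.chord) (fun _ _ => hη.tan_α)
    (fun _ _ => hη.tan_β) (fun s _ h => ?_) fun _ _ h => hy _
  exact (hasDerivAt_comp_line hη.diff he p h s).hasDerivWithinAt

theorem density (hη : FlatSurface κ Λ B η) {e : ℝ × ℝ} {y : ℝ × ℝ → ℍ[ℝ]}
    (he : ∀ q, fderiv ℝ η q e = y q) (hy : ∀ q, ‖y q‖ ≤ Λ) (hyr : ContDiff ℝ 1 y)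
    (hL : eLpNorm (fun q => vertL (y q)) 2 volume ≤ ENNReal.ofReal B) (p : ℝ × ℝ) :
    Density (-1) 1 B (shift (fun s => p + s • e) fun _ q => vertL (η q))
      (shift (fun s => p + s • e) fun _ q => vertL (y q)) := by
  obtain ⟨r, hr, hr', hm⟩ := hη.decay
  have hreg := hη.reg.of_le one_le_two
  refine density_shift hr hr' (by norm_num) (by fun_prop)
    (contDiffOn_const_family (vertL.contDiff.comp hreg) _ _)
    (contDiffOn_const_family (vertL.contDiff.comp hyr) _ _)
    (fun s _ h => ((vertL.hasFDerivAt.comp_hasDerivAt s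
      (hasDerivAt_comp_line hη.diff he p h s)).hasDerivWithinAt))
    (fun _ _ => ?_) (fun _ _ h => (norm_vertL_le _).trans (hy _)) (fun _ _ => ?_) (fun _ _ => ?_)
    fun _ _ => hL
  · refine hm.of_le (vertL.continuous.comp hη.diff.continuous).aestronglyMeasurable
      (ae_of_all _ fun q => ?_)
    rw [norm_vertL]; exact le_rfl
  · refine le_trans (eLpNorm_mono fun q => ?_) hη.L2_α
    rw [dα_clm _ hη.diff, dα_height hη.diff, norm_vertL, Real.norm_eq_abs]
  · refine le_trans (eLpNorm_mono fun q => ?_) hη.L2_β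
    rw [dβ_clm _ hη.diff, dβ_height hη.diff, norm_vertL, Real.norm_eq_abs]

/-- The field `z_α η_β - z_β η_α = N × e₃`. -/
def field (η : ℝ × ℝ → ℍ[ℝ]) (q : ℝ × ℝ) : ℍ[ℝ] :=
  dα (height η) q • dβ η q - dβ (height η) q • dα η q

theorem vec_α (hη : FlatSurface κ Λ B η) (q : ℝ × ℝ) : (dα η q).re = 0 := by
  have h := hasDerivWithinAt_re ((hη.diff q).hasDerivAt_dα.hasDerivWithinAt (s := univ))
  simp only [hη.vec] at h
  exact (hasDerivWithinAt_univ.1 h).unique (hasDerivAt_const _ _)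

theorem vec_β (hη : FlatSurface κ Λ B η) (q : ℝ × ℝ) : (dβ η q).re = 0 := by
  have h := hasDerivWithinAt_re ((hη.diff q).hasDerivAt_dβ.hasDerivWithinAt (s := univ))
  simp only [hη.vec] at h
  exact (hasDerivWithinAt_univ.1 h).unique (hasDerivAt_const _ _)

theorem crossIntegrand_vertL_eq (hη : FlatSurface κ Λ B η) (k : ℍ[ℝ]) (g : ℝ × ℝ → ℍ[ℝ])
    (p q : ℝ × ℝ) : crossIntegrand k g η (fun q => vertL (η q)) p q
      = k * (cross (g p - g q) (field η q) * e3) := by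
  rw [crossIntegrand, dα_clm _ hη.diff, dβ_clm _ hη.diff]
  simp only
  rw [vertL_apply, vertL_apply, field,
    cross_sub_right, cross_smul_right, cross_smul_right, dα_height hη.diff, dβ_height hη.diff,
    sub_mul, mul_smul_comm, mul_smul_comm, smul_mul_assoc, smul_mul_assoc]

/-- Directional derivatives of `𝔥(z e₃)`: the commutator cancels the tangential part of the
differentiated density, and `y × (N × e₃)` at the base point remains. -/
theorem exists_hasDerivAt_hilbert (hη : FlatSurface κ Λ B η) {e : ℝ × ℝ} {y : ℝ × ℝ → ℍ[ℝ]}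
    (he : ∀ q, fderiv ℝ η q e = y q) (hy : ∀ q, ‖y q‖ ≤ Λ) (hyr : ContDiff ℝ 1 y)
    (hL : eLpNorm (fun q => vertL (y q)) 2 volume ≤ ENNReal.ofReal B)
    (hyd : ∀ q, cross (y q) (field η q) * e3 = normal η q * vertL (y q)) (p : ℝ × ℝ) :
    ∃ D : ℍ[ℝ], HasDerivAt (fun s : ℝ => hilbert η (fun q => vertL (η q)) (p + s • e)) D 0 ∧
      HasPV (fun q => K (η q - η p) * cross (y p) (field η q) * e3) p D := by
  have hM := hη.motion he hy p
  have hD := hη.density he hy hyr hL p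
  have h0 : (0 : ℝ) ∈ Icc (-1 : ℝ) 1 := by norm_num
  have hd := (hM.hasDerivWithinAt_hilbert_shift (X := fun _ => η)
    (f := fun _ q => vertL (η q)) (fs := fun _ q => vertL (y q)) hD h0).hasDerivAt
      (Icc_mem_nhds (by norm_num) (by norm_num))
  refine ⟨_, hd, ?_⟩
  have c0 : p + (0 : ℝ) • e = p := by simp
  have h1 := (hM.weaklySingular_comm hD.reg hD.L2_α hD.L2_β).integrable h0
  obtain ⟨G, hG⟩ : ∃ G : ℝ × ℝ → ℍ[ℝ], ∀ q,
      G q = crossIntegrand (K (η q - η p)) y η (fun q => vertL (η q)) p q := ⟨_, fun _ => rfl⟩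
  have ec : commIntegrand (shift (fun s => p + s • e) fun _ => η)
      (shift (fun s => p + s • e) fun _ => y)
      (shift (fun s => p + s • e) fun _ q => vertL (η q)) 0 = fun h => G (p + h) := by
    funext h
    rw [commIntegrand, crossIntegrand_shift, hG]
    simp only [shift, c0, add_zero]
  rw [ec] at h1 ⊢
  have p1 := hasPV_of_integrable_comp_add h1
  have p2 := hM.hasPV_hilbert_shift (X := fun _ => η) (f := fun _ q => vertL (y q))
    hD.reg_deriv h0 (hD.integrableOn_deriv h0)
  have p3 := p2
  rw [← p2.hilbert_eq] at p3
  simp only [c0] at p3 ⊢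
  refine (p1.add p3).congr fun q => ?_
  rw [hG, hη.crossIntegrand_vertL_eq, cross_sub_left, sub_mul, hyd, hilbertIntegrand]
  noncomm_ring

theorem cross_dα_field (hη : FlatSurface κ Λ B η) (q : ℝ × ℝ) :
    cross (dα η q) (field η q) * e3 = normal η q * vertL (dα η q) := by
  rw [field, dα_height hη.diff, dβ_height hη.diff, vertL_apply, normal]
  ext <;> simp <;> ring

theorem cross_dβ_field (hη : FlatSurface κ Λ B η) (q : ℝ × ℝ) :
    cross (dβ η q) (field η q) * e3 = normal η q * vertL (dβ η q) := by
  rw [field, dα_height hη.diff, dβ_height hη.diff, vertL_apply, normal]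
  ext <;> simp <;> ring

theorem exists_hasDerivAt_hilbert_α (hη : FlatSurface κ Λ B η) (p : ℝ × ℝ) :
    ∃ D : ℍ[ℝ], HasDerivAt (fun s => hilbert η (fun q => vertL (η q)) (s, p.2)) D p.1 ∧
      HasPV (fun q => K (η q - η p) * cross (dα η p) (field η q) * e3) p D := by
  obtain ⟨D, h1, h2⟩ := hη.exists_hasDerivAt_hilbert (e := (1, 0))
    (fun q => ((hη.diff q).hasFDerivAt.dα_eq).symm) hη.tan_α hη.reg_dα
    (le_trans (eLpNorm_mono fun q => by
      rw [norm_vertL, dα_height hη.diff, Real.norm_eq_abs]) hη.L2_α) hη.cross_dα_field p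
  exact ⟨D, hasDerivAt_of_line_α h1, h2⟩

theorem exists_hasDerivAt_hilbert_β (hη : FlatSurface κ Λ B η) (p : ℝ × ℝ) :
    ∃ D : ℍ[ℝ], HasDerivAt (fun s => hilbert η (fun q => vertL (η q)) (p.1, s)) D p.2 ∧
      HasPV (fun q => K (η q - η p) * cross (dβ η p) (field η q) * e3) p D := by
  obtain ⟨D, h1, h2⟩ := hη.exists_hasDerivAt_hilbert (e := (0, 1))
    (fun q => ((hη.diff q).hasFDerivAt.dβ_eq).symm) hη.tan_β hη.reg_dβ
    (le_trans (eLpNorm_mono fun q => by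
      rw [norm_vertL, dβ_height hη.diff, Real.norm_eq_abs]) hη.L2_β) hη.cross_dβ_field p
  exact ⟨D, hasDerivAt_of_line_β h1, h2⟩

/-- The scalar part of `p.v. ∬ K (N × e₃)'` vanishes. -/
theorem exists_hasPV_field (hη : FlatSurface κ Λ B η) (p : ℝ × ℝ) :
    ∃ L : ℍ[ℝ], L.re = 0 ∧ HasPV (fun q => K (η q - η p) * field η q) p L := by
  have hM := hη.motion (e := (1, 0)) (fun q => ((hη.diff q).hasFDerivAt.dα_eq).symm) hη.tan_α p
  have h0 : (0 : ℝ) ∈ Icc (-1 : ℝ) 1 := by norm_num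
  have c0 : p + (0 : ℝ) • ((1 : ℝ), (0 : ℝ)) = p := by simp
  have hz : ContDiff ℝ 2 (height η) := by
    rw [height_eq]; exact (innerSL ℝ e3).contDiff.comp hη.reg
  have rz := contDiffOn_shift (c := fun s : ℝ => p + s • ((1 : ℝ), (0 : ℝ))) (n := 2) (by fun_prop)
    (contDiffOn_const_family hz (-1) 1)
  have hz1 := contDiffOn_const_family hz (-1) 1 |>.of_le one_le_two
  have hα : ∀ s ∈ Icc (-1 : ℝ) 1, eLpNorm (dα (shift (fun s : ℝ => p + s • ((1 : ℝ), (0 : ℝ)))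
      (fun _ => height η) s)) 2 volume ≤ ENNReal.ofReal B := fun s hs => by
    rw [dα_shift, eLpNorm_shift (f := fun _ => dα (height η))
      (ContDiffOn.continuous_slice (continuousOn_dα (by norm_num) hz1) hs)]
    exact hη.L2_α
  have hβ : ∀ s ∈ Icc (-1 : ℝ) 1, eLpNorm (dβ (shift (fun s : ℝ => p + s • ((1 : ℝ), (0 : ℝ)))
      (fun _ => height η) s)) 2 volume ≤ ENNReal.ofReal B := fun s hs => by
    rw [dβ_shift, eLpNorm_shift (f := fun _ => dβ (height η))
      (ContDiffOn.continuous_slice (continuousOn_dβ (by norm_num) hz1) hs)]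
    exact hη.L2_β
  refine ⟨_, hM.symmIntegral_skewGrad_re rz hα hβ h0, hasPV_translate_iff.1
    ((hM.hasPV_skewGrad rz hα hβ h0).congr fun h => ?_)⟩
  rw [kernelIntegrand, skewGrad, field]
  simp only [dα_shift, dβ_shift, shift, c0, add_zero]

/-- `N × ∇` applied to `𝔥(z e₃)` is the principal value integral with density
`N × (N × e₃)' e₃`. -/
theorem hasPV_normalCrossGrad_hilbert (hη : FlatSurface κ Λ B η) (p : ℝ × ℝ) :
    HasPV (fun q => K (η q - η p) * cross (normal η p) (field η q) * e3) p
      (normalCrossGrad η (hilbert η fun q => vertL (η q)) p) := by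
  obtain ⟨D, hD, pD⟩ := hη.exists_hasDerivAt_hilbert_α p
  obtain ⟨D', hD', pD'⟩ := hη.exists_hasDerivAt_hilbert_β p
  obtain ⟨L, hL, pL⟩ := hη.exists_hasPV_field p
  have h := ((pD.const_mul (dβ η p)).sub (pD'.const_mul (dα η p))).add
    (pL.re_smul (-(2 : ℝ) • (normal η p * e3)))
  rw [hL, zero_smul, add_zero] at h
  have e1 : dα (hilbert η fun q => vertL (η q)) p = D := hD.deriv
  have e2 : dβ (hilbert η fun q => vertL (η q)) p = D' := hD'.deriv
  rw [normalCrossGrad, e1, e2]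
  refine h.congr fun q => ?_
  have kre : (K (η q - η p)).re = 0 := K_re _ (by simp [hη.vec])
  have dre : (field η q).re = 0 := by simp [field, hη.vec_α, hη.vec_β]
  have h4 := mul_K_cross kre (hη.vec_α p) (hη.vec_β p) dre
  have h5 : (K (η q - η p) * field η q).re = -inner ℝ (K (η q - η p)) (field η q) := by
    rw [inner_eq]; simp [kre, dre]; ring
  have h6 : K (η q - η p) * cross (normal η p) (field η q)
      = dβ η p * (K (η q - η p) * cross (dα η p) (field η q))
        - dα η p * (K (η q - η p) * cross (dβ η p) (field η q))
        + (2 * inner ℝ (K (η q - η p)) (field η q)) • normal η p := by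
    rw [h4, normal]; abel
  rw [h5, h6, add_mul, sub_mul, smul_smul, neg_mul_neg, smul_mul_assoc, mul_comm (2 : ℝ)]
  simp only [mul_assoc]

end FlatSurface
end Space

/-! ### The second time derivative of `𝔥(z e₃)` -/

namespace IsSolution

variable {T κ Λ B : ℝ} {ξ v w f fs : ℝ → ℝ × ℝ → ℍ[ℝ]} {a : ℝ → ℝ × ℝ → ℝ} {t : ℝ}

theorem flatSurface (hS : IsSolution T κ Λ ξ v w a) (hκ : 0 < κ) (hB : Bounded T B ξ v w)
    (ht : t ∈ Icc 0 T) : FlatSurface κ Λ B (ξ t) where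
  pos := hκ
  vec := hS.isVector t ht
  reg := contDiff_slice hS.regular_ξ ht
  chord := hS.chordArc t ht
  tan_α := hS.tangent_α t ht
  tan_β := hS.tangent_β t ht
  decay := hS.height_decay.imp fun _ h => ⟨h.1, h.2.1, h.2.2 t ht⟩
  L2_α := (hB t ht).1.slope_α_L2
  L2_β := (hB t ht).1.slope_β_L2

theorem commIntegrand_shift (p : ℝ × ℝ) (t : ℝ) :
    commIntegrand (shift (fun _ => p) ξ) (shift (fun _ => p) v) (shift (fun _ => p) f) t
      = fun h => crossIntegrand (K (ξ t (p + h) - ξ t p)) (v t) (ξ t) (f t) p (p + h) := by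
  funext h
  rw [commIntegrand, crossIntegrand_shift]
  simp only [shift, add_zero]

theorem integrable_comm (hS : IsSolution T κ Λ ξ v w a) (hκ : 0 < κ) (hT : 0 < T)
    (hB : Bounded T B ξ v w) {p : ℝ × ℝ}
    (hf : Density 0 T B (shift (fun _ => p) f) (shift (fun _ => p) fs)) (ht : t ∈ Icc 0 T) :
    Integrable fun q => crossIntegrand (K (ξ t q - ξ t p)) (v t) (ξ t) (f t) p q := by
  have h := ((hS.motion hκ hT hB p).weaklySingular_comm hf.reg hf.L2_α hf.L2_β).integrable ht
  rw [commIntegrand_shift] at h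
  exact integrable_of_comp_add_left h

theorem hasPV_hilbert (hS : IsSolution T κ Λ ξ v w a) (hκ : 0 < κ) (hT : 0 < T)
    (hB : Bounded T B ξ v w) {p : ℝ × ℝ}
    (hf : Density 0 T B (shift (fun _ => p) f) (shift (fun _ => p) fs)) (ht : t ∈ Icc 0 T) :
    HasPV (hilbertIntegrand (ξ t) (f t) p) p (hilbert (ξ t) (f t) p) := by
  have h := (hS.motion hκ hT hB p).hasPV_hilbert_shift hf.reg ht (hf.integrableOn t ht)
  rwa [← h.hilbert_eq] at h

theorem hasPV_hilbert_deriv (hS : IsSolution T κ Λ ξ v w a) (hκ : 0 < κ) (hT : 0 < T)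
    (hB : Bounded T B ξ v w) {p : ℝ × ℝ}
    (hf : Density 0 T B (shift (fun _ => p) f) (shift (fun _ => p) fs)) (ht : t ∈ Icc 0 T) :
    HasPV (hilbertIntegrand (ξ t) (fs t) p) p (hilbert (ξ t) (fs t) p) := by
  have h := (hS.motion hκ hT hB p).hasPV_hilbert_shift hf.reg_deriv ht (hf.integrableOn_deriv ht)
  rwa [← h.hilbert_eq] at h

theorem hasDerivWithinAt_hilbert (hS : IsSolution T κ Λ ξ v w a) (hκ : 0 < κ) (hT : 0 < T)
    (hB : Bounded T B ξ v w) {p : ℝ × ℝ}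
    (hf : Density 0 T B (shift (fun _ => p) f) (shift (fun _ => p) fs)) (ht : t ∈ Icc 0 T) :
    HasDerivWithinAt (fun r => hilbert (ξ r) (f r) p)
      ((∫ q, crossIntegrand (K (ξ t q - ξ t p)) (v t) (ξ t) (f t) p q)
        + hilbert (ξ t) (fs t) p) (Icc 0 T) t := by
  have h := (hS.motion hκ hT hB p).hasDerivWithinAt_hilbert_shift hf ht
  rw [commIntegrand_shift, integral_add_left_eq_self
    (fun q => crossIntegrand (K (ξ t q - ξ t p)) (v t) (ξ t) (f t) p q) p] at h
  exact h

/-- The difference of the accelerations enters the second derivative of the commutator. -/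
theorem integrable_accel (hS : IsSolution T κ Λ ξ v w a) (hκ : 0 < κ) (hT : 0 < T)
    (hB : Bounded T B ξ v w) (p : ℝ × ℝ) (ht : t ∈ Icc 0 T) :
    Integrable fun q =>
      crossIntegrand (K (ξ t q - ξ t p)) (w t) (ξ t) (fun q => vertL (ξ t q)) p q := by
  have hM := hS.motion hκ hT hB p
  have hD := hS.density_height hT hB p
  have h := (weaklySingular_crossIntegrand
    (k := fun s h => K (shift (fun _ => p) ξ s h - shift (fun _ => p) ξ s 0)) hT
    (fun _ hs _ h0 => hM.norm_K_le hs h0) hM.continuousOn_K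
    (contDiffOn_shift (c := fun _ => p) contDiff_const hS.regular_w)
    (fun s hs h => (hB s hs).2.2.2 _) hM.reg_one hM.tan_α hM.tan_β hD.reg hD.L2_α
    hD.L2_β).integrable ht
  simp only [crossIntegrand_shift, shift, add_zero] at h
  exact integrable_of_comp_add_left h

theorem integrable_velocityTangent (hS : IsSolution T κ Λ ξ v w a) (hκ : 0 < κ) (hT : 0 < T)
    (hB : Bounded T B ξ v w) (p : ℝ × ℝ) (ht : t ∈ Icc 0 T) :
    Integrable fun q =>
      crossIntegrand (K (ξ t q - ξ t p)) (v t) (v t) (fun q => vertL (ξ t q)) p q := by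
  have hM := hS.motion hκ hT hB p
  have hD := hS.density_height hT hB p
  have h := (weaklySingular_crossIntegrand (Λ := B)
    (k := fun s h => K (shift (fun _ => p) ξ s h - shift (fun _ => p) ξ s 0)) hT
    (fun _ hs _ h0 => hM.norm_K_le hs h0) hM.continuousOn_K hM.regV hM.vel hM.regV
    (fun s hs h => by rw [dα_shift]; exact (hB s hs).1.vel_α _)
    (fun s hs h => by rw [dβ_shift]; exact (hB s hs).1.vel_β _) hD.reg hD.L2_α
    hD.L2_β).integrable ht
  simp only [crossIntegrand_shift, shift, add_zero] at h
  exact integrable_of_comp_add_left h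

theorem integrable_dK (hS : IsSolution T κ Λ ξ v w a) (hκ : 0 < κ) (hT : 0 < T)
    (hB : Bounded T B ξ v w) (p : ℝ × ℝ) (ht : t ∈ Icc 0 T) :
    Integrable fun q => crossIntegrand (DK (ξ t q - ξ t p) (v t q - v t p)) (v t) (ξ t)
      (fun q => vertL (ξ t q)) p q := by
  have hD := hS.density_height hT hB p
  have h := ((hS.motion hκ hT hB p).weaklySingular_dK hD.reg hD.L2_α hD.L2_β).integrable ht
  simp only [crossIntegrand_shift, shift, add_zero] at h
  exact integrable_of_comp_add_left h

theorem hasDerivWithinAt_comm (hS : IsSolution T κ Λ ξ v w a) (hκ : 0 < κ) (hT : 0 < T)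
    (hB : Bounded T B ξ v w) (p : ℝ × ℝ) (ht : t ∈ Icc 0 T) :
    HasDerivWithinAt (fun r => ∫ q,
        crossIntegrand (K (ξ r q - ξ r p)) (v r) (ξ r) (fun q => vertL (ξ r q)) p q)
      ((∫ q, crossIntegrand (DK (ξ t q - ξ t p) (v t q - v t p)) (v t) (ξ t)
          (fun q => vertL (ξ t q)) p q)
        + (∫ q, crossIntegrand (K (ξ t q - ξ t p)) (w t) (ξ t) (fun q => vertL (ξ t q)) p q)
        + (∫ q, crossIntegrand (K (ξ t q - ξ t p)) (v t) (v t) (fun q => vertL (ξ t q)) p q)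
        + ∫ q, crossIntegrand (K (ξ t q - ξ t p)) (v t) (ξ t) (fun q => vertL (v t q)) p q)
      (Icc 0 T) t := by
  have hM := hS.motion hκ hT hB p
  have hD := hS.density_height hT hB p
  have hD' := hS.density_heightVel hT hB p
  have h := hM.hasDerivWithinAt_comm (B' := B) (W := shift (fun _ => p) w)
    (contDiffOn_shift contDiff_const hS.regular_w)
    (fun s hs q => hS.hasDeriv_v s hs (p + q)) (fun s hs q => (hB s hs).2.2.2 _)
    (fun s hs h => by rw [dα_shift]; exact (hB s hs).1.vel_α _)
    (fun s hs h => by rw [dβ_shift]; exact (hB s hs).1.vel_β _)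
    (contDiffOn_shift (c := fun _ => p) contDiff_const (contDiffOn_clm vertL hS.regular_ξ))
    hD.deriv hD.L2_α hD.L2_β hD'.L2_α hD'.L2_β ht
  simp only [commIntegrand_shift] at h
  simp only [crossIntegrand_shift, shift, add_zero] at h
  refine (h.congr_deriv ?_).congr (fun r _ => ?_) ?_
  · congr 1
    · congr 1
      · congr 1
        · exact integral_add_left_eq_self (fun q => crossIntegrand
            (DK (ξ t q - ξ t p) (v t q - v t p)) (v t) (ξ t) (fun q => vertL (ξ t q)) p q) p
        · exact integral_add_left_eq_self (fun q => crossIntegrand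
            (K (ξ t q - ξ t p)) (w t) (ξ t) (fun q => vertL (ξ t q)) p q) p
      · exact integral_add_left_eq_self (fun q => crossIntegrand
          (K (ξ t q - ξ t p)) (v t) (v t) (fun q => vertL (ξ t q)) p q) p
    · exact integral_add_left_eq_self (fun q => crossIntegrand
        (K (ξ t q - ξ t p)) (v t) (ξ t) (fun q => vertL (v t q)) p q) p
  · exact (integral_add_left_eq_self (fun q => crossIntegrand
        (K (ξ r q - ξ r p)) (v r) (ξ r) (fun q => vertL (ξ r q)) p q) p).symm
  · exact (integral_add_left_eq_self (fun q => crossIntegrand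
        (K (ξ t q - ξ t p)) (v t) (ξ t) (fun q => vertL (ξ t q)) p q) p).symm

/-- Differentiating `ξ_t = 𝔥 ξ_t` in time. -/
theorem accel_eq (hS : IsSolution T κ Λ ξ v w a) (hκ : 0 < κ) (hT : 0 < T)
    (hB : Bounded T B ξ v w) (p : ℝ × ℝ) (ht : t ∈ Icc 0 T) :
    w t p = (∫ q, crossIntegrand (K (ξ t q - ξ t p)) (v t) (ξ t) (v t) p q)
        + hilbert (ξ t) (w t) p := by
  have h := hS.hasDerivWithinAt_hilbert hκ hT hB (hS.density_vel hT hB p) ht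
  refine (uniqueDiffOn_Icc hT t ht).eq_deriv _ (hS.hasDeriv_v t ht p) (h.congr (fun r hr => ?_) ?_)
  · exact (hS.analytic r hr p).hilbert_eq.symm
  · exact (hS.analytic t ht p).hilbert_eq.symm

theorem vel_re (hS : IsSolution T κ Λ ξ v w a) (hT : 0 < T) (p : ℝ × ℝ) (ht : t ∈ Icc 0 T) :
    (v t p).re = 0 :=
  (uniqueDiffOn_Icc hT t ht).eq_deriv _ (hasDerivWithinAt_re (hS.hasDeriv_ξ t ht p))
    ((hasDerivWithinAt_const t _ (0 : ℝ)).congr (fun r hr => hS.isVector r hr p)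
      (hS.isVector t ht p))

theorem accel_re (hS : IsSolution T κ Λ ξ v w a) (p : ℝ × ℝ) (ht : t ∈ Icc 0 T) :
    (w t p).re = 0 := by
  have := congrArg (fun σ : ℍ[ℝ] => σ.re) (hS.momentum t ht p)
  simpa [normal] using this

/-- On the surface `ξ_tt + e₃ = 𝔞 N` turns `𝔞 N × e₃` into the horizontal acceleration. -/
theorem smul_field_mul_e3 (hS : IsSolution T κ Λ ξ v w a) (hκ : 0 < κ) (hB : Bounded T B ξ v w)
    (p : ℝ × ℝ) (ht : t ∈ Icc 0 T) :
    a t p • (FlatSurface.field (ξ t) p * e3) = vertL (w t p) - w t p := by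
  have hη := hS.flatSurface hκ hB ht
  have h1 : a t p • FlatSurface.field (ξ t) p = cross (w t p + e3) e3 := by
    rw [hS.momentum t ht p, cross_smul_left, FlatSurface.field, dα_height hη.diff,
      dβ_height hη.diff, normal]
    congr 1
    ext <;> simp [hη.vec_α, hη.vec_β] <;> ring
  rw [← smul_mul_assoc, h1, vertL_apply]
  have := hS.accel_re p ht
  ext <;> simp [this]

theorem normal_mul_field (hS : IsSolution T κ Λ ξ v w a) (hκ : 0 < κ) (hB : Bounded T B ξ v w)
    (p : ℝ × ℝ) (ht : t ∈ Icc 0 T) : cross (normal (ξ t) p) (FlatSurface.field (ξ t) p)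
      = normal (ξ t) p * FlatSurface.field (ξ t) p := by
  have hη := hS.flatSurface hκ hB ht
  rw [FlatSurface.field, dα_height hη.diff, dβ_height hη.diff, normal]
  ext <;> simp [hη.vec_α, hη.vec_β] <;> ring

/-- The tangential part of the acceleration: the terms of `π_tt` and of `𝔞 N × ∇ π` that contain
second derivatives cancel, because `𝔞' (N × e₃)' e₃` is minus the horizontal acceleration. -/
theorem hilbert_accel_eq (hS : IsSolution T κ Λ ξ v w a) (hκ : 0 < κ) (hT : 0 < T)
    (hB : Bounded T B ξ v w) (p : ℝ × ℝ) (ht : t ∈ Icc 0 T) :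
    hilbert (ξ t) (w t) p - hilbert (ξ t) (fun q => vertL (w t q)) p
      - (∫ q, crossIntegrand (K (ξ t q - ξ t p)) (w t) (ξ t) (fun q => vertL (ξ t q)) p q)
      + a t p • normalCrossGrad (ξ t) (hilbert (ξ t) fun q => vertL (ξ t q)) p = 0 := by
  have hη := hS.flatSurface hκ hB ht
  have h1 := hS.hasPV_hilbert_deriv hκ hT hB (hS.density_vel hT hB p) ht
  have h2 := hS.hasPV_hilbert_deriv hκ hT hB (hS.density_heightVel hT hB p) ht
  have h3 := hasPV_of_integrable (hS.integrable_accel hκ hT hB p ht) p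
  have h4 := (hη.hasPV_normalCrossGrad_hilbert p).const_smul (a t p)
  have h5 := ((h1.sub h2).sub h3).add h4
  have h0 : HasPV (0 : ℝ × ℝ → ℍ[ℝ]) p 0 := by
    simpa using hasPV_of_integrable (integrable_zero _ _ _) p
  refine h5.unique (h0.congr fun q => ?_)
  change _ = (0 : ℍ[ℝ])
  have e1 : a t p • (K (ξ t q - ξ t p) * cross (normal (ξ t) p) (FlatSurface.field (ξ t) q) * e3)
      = K (ξ t q - ξ t p) * (cross (w t p + e3) (FlatSurface.field (ξ t) q) * e3) := by
    rw [hS.momentum t ht p, cross_smul_left, mul_assoc, smul_mul_assoc, mul_smul_comm]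
  have e2 : cross (w t q + e3) (FlatSurface.field (ξ t) q) * e3
      = normal (ξ t) q * (vertL (w t q) - w t q) := by
    rw [← hS.smul_field_mul_e3 hκ hB q ht, hS.momentum t ht q, cross_smul_left,
      hS.normal_mul_field hκ hB q ht, smul_mul_assoc, mul_smul_comm, mul_assoc]
  have e3' : cross (w t p + e3) (FlatSurface.field (ξ t) q)
      = cross (w t p - w t q) (FlatSurface.field (ξ t) q)
        + cross (w t q + e3) (FlatSurface.field (ξ t) q) := by
    rw [← cross_add_left]; congr 1; abel
  rw [e1, e3', add_mul, e2, hη.crossIntegrand_vertL_eq, hilbertIntegrand, hilbertIntegrand]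
  noncomm_ring

end IsSolution

/-! ### The equation for `π` -/

/-- The time derivative of `π` along a solution. -/
def piT (ξ v : ℝ → ℝ × ℝ → ℍ[ℝ]) (t : ℝ) (p : ℝ × ℝ) : ℍ[ℝ] :=
  vertL (v t p)
    - ((∫ q, crossIntegrand (K (ξ t q - ξ t p)) (v t) (ξ t) (fun q => vertL (ξ t q)) p q)
      + hilbert (ξ t) (fun q => vertL (v t q)) p)

/-- The second time derivative of `π` along a solution. -/
def piTT (ξ v w : ℝ → ℝ × ℝ → ℍ[ℝ]) (t : ℝ) (p : ℝ × ℝ) : ℍ[ℝ] :=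
  vertL (w t p)
    - ((∫ q, crossIntegrand (DK (ξ t q - ξ t p) (v t q - v t p)) (v t) (ξ t)
          (fun q => vertL (ξ t q)) p q)
        + (∫ q, crossIntegrand (K (ξ t q - ξ t p)) (w t) (ξ t) (fun q => vertL (ξ t q)) p q)
        + (∫ q, crossIntegrand (K (ξ t q - ξ t p)) (v t) (v t) (fun q => vertL (ξ t q)) p q)
        + (∫ q, crossIntegrand (K (ξ t q - ξ t p)) (v t) (ξ t) (fun q => vertL (v t q)) p q)
      + ((∫ q, crossIntegrand (K (ξ t q - ξ t p)) (v t) (ξ t) (fun q => vertL (v t q)) p q)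
        + hilbert (ξ t) (fun q => vertL (w t q)) p))

theorem integrable_of_integrable_mul_e3 {F : ℝ × ℝ → ℍ[ℝ]} (h : Integrable fun q => F q * e3) :
    Integrable F := by
  have h1 := ((ContinuousLinearMap.mul ℝ ℍ[ℝ]).flip (-e3)).integrable_comp h
  refine h1.congr (ae_of_all _ fun q => ?_)
  simp [mul_assoc, e3_mul_e3]

theorem integral_mul_e3 {F : ℝ × ℝ → ℍ[ℝ]} (h : Integrable F) :
    ∫ q, F q * e3 = (∫ q, F q) * e3 :=
  ((ContinuousLinearMap.mul ℝ ℍ[ℝ]).flip e3).integral_comp_comm h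

theorem piQ_eq (ξ : ℝ × ℝ → ℍ[ℝ]) (p : ℝ × ℝ) :
    piQ ξ p = vertL (ξ p) - hilbert ξ (fun q => vertL (ξ q)) p := by
  rw [piQ, heightC_mul_e3, heightC_eq, heightL_mul_e3]

namespace IsSolution

variable {T κ Λ B : ℝ} {ξ v w : ℝ → ℝ × ℝ → ℍ[ℝ]} {a : ℝ → ℝ × ℝ → ℝ} {t : ℝ}

theorem hasDerivWithinAt_piQ (hS : IsSolution T κ Λ ξ v w a) (hκ : 0 < κ) (hT : 0 < T)
    (hB : Bounded T B ξ v w) (p : ℝ × ℝ) (ht : t ∈ Icc 0 T) :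
    HasDerivWithinAt (fun s => piQ (ξ s) p) (piT ξ v t p) (Icc 0 T) t := by
  have h1 : HasDerivWithinAt (fun s => vertL (ξ s p)) (vertL (v t p)) (Icc 0 T) t :=
    vertL.hasFDerivAt.comp_hasDerivWithinAt t (hS.hasDeriv_ξ t ht p)
  have h2 := hS.hasDerivWithinAt_hilbert hκ hT hB (hS.density_height hT hB p) ht
  rw [funext fun s => piQ_eq (ξ s) p, piT]
  exact h1.fun_sub h2

theorem hasDerivWithinAt_piT (hS : IsSolution T κ Λ ξ v w a) (hκ : 0 < κ) (hT : 0 < T)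
    (hB : Bounded T B ξ v w) (p : ℝ × ℝ) (ht : t ∈ Icc 0 T) :
    HasDerivWithinAt (fun s => piT ξ v s p) (piTT ξ v w t p) (Icc 0 T) t := by
  have h1 : HasDerivWithinAt (fun s => vertL (v s p)) (vertL (w t p)) (Icc 0 T) t :=
    vertL.hasFDerivAt.comp_hasDerivWithinAt t (hS.hasDeriv_v t ht p)
  have h2 := hS.hasDerivWithinAt_hilbert hκ hT hB (hS.density_heightVel hT hB p) ht
  have h3 := hS.hasDerivWithinAt_comm hκ hT hB p ht
  simp only [piT]
  exact h1.fun_sub (h3.fun_add h2)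

theorem dtK_eq (hS : IsSolution T κ Λ ξ v w a) (hκ : 0 < κ) (hT : 0 < T) (ht : t ∈ Icc 0 T)
    {p q : ℝ × ℝ} (hpq : q ≠ p) : dtK T ξ t p q = DK (ξ t q - ξ t p) (v t q - v t p) := by
  have h0 : ξ t q - ξ t p ≠ 0 := by
    have h1 : 0 < κ * pdist q p :=
      mul_pos hκ ((norm_pos_iff.2 (sub_ne_zero.2 hpq)).trans_le (norm_le_pdist_sub q p))
    exact norm_pos_iff.1 (h1.trans_le (hS.chordArc t ht q p))
  exact (hasDerivWithinAt_K ((hS.hasDeriv_ξ t ht q).sub (hS.hasDeriv_ξ t ht p)) h0).derivWithin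
    (uniqueDiffOn_Icc hT t ht)

theorem integrand₃_eq (hS : IsSolution T κ Λ ξ v w a) (hκ : 0 < κ) (hT : 0 < T)
    (ht : t ∈ Icc 0 T) (p q : ℝ × ℝ) : integrand₃ T ξ v t p q
      = crossIntegrand (DK (ξ t q - ξ t p) (v t q - v t p)) (v t) (ξ t) (heightC (ξ t)) p q := by
  rcases eq_or_ne q p with rfl | hpq
  · have h0 : ∀ τ, cross 0 τ = 0 := fun τ => by ext <;> simp
    simp [integrand₃, crossIntegrand, h0]
  · rw [integrand₃, hS.dtK_eq hκ hT ht hpq]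

theorem cbar_vel (hS : IsSolution T κ Λ ξ v w a) (hT : 0 < T) (ht : t ∈ Icc 0 T) :
    (fun q => cbar (v t q)) = fun q => (ContinuousLinearMap.id ℝ ℍ[ℝ] - (2 : ℝ) • vertL) (v t q) := by
  funext q
  rw [cbar_eq_of_re (hS.vel_re hT q ht)]
  simp

theorem integrand₁_eq (hS : IsSolution T κ Λ ξ v w a) (hT : 0 < T) (ht : t ∈ Icc 0 T)
    (p q : ℝ × ℝ) : integrand₁ ξ v t p q
      = crossIntegrand (K (ξ t q - ξ t p)) (v t) (ξ t) (v t) p q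
        - (2 : ℝ) • crossIntegrand (K (ξ t q - ξ t p)) (v t) (ξ t) (fun q => vertL (v t q)) p q := by
  rw [integrand₁, hS.cbar_vel hT ht, crossIntegrand, crossIntegrand, crossIntegrand,
    dα_clm _ (hS.diffV hT ht), dβ_clm _ (hS.diffV hT ht), dα_clm _ (hS.diffV hT ht),
    dβ_clm _ (hS.diffV hT ht)]
  simp only [sub_apply, smul_apply,
    ContinuousLinearMap.id_apply, two_smul]
  noncomm_ring

theorem integrable_integrand₁ (hS : IsSolution T κ Λ ξ v w a) (hκ : 0 < κ) (hT : 0 < T)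
    (hB : Bounded T B ξ v w) (p : ℝ × ℝ) (ht : t ∈ Icc 0 T) : Integrable (integrand₁ ξ v t p) := by
  rw [funext (hS.integrand₁_eq hT ht p)]
  exact (hS.integrable_comm hκ hT hB (hS.density_vel hT hB p) ht).sub
    ((hS.integrable_comm hκ hT hB (hS.density_heightVel hT hB p) ht).fun_smul (2 : ℝ))

theorem integral_integrand₁ (hS : IsSolution T κ Λ ξ v w a) (hκ : 0 < κ) (hT : 0 < T)
    (hB : Bounded T B ξ v w) (p : ℝ × ℝ) (ht : t ∈ Icc 0 T) : ∫ q, integrand₁ ξ v t p q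
      = (∫ q, crossIntegrand (K (ξ t q - ξ t p)) (v t) (ξ t) (v t) p q)
        - (2 : ℝ) • ∫ q, crossIntegrand (K (ξ t q - ξ t p)) (v t) (ξ t)
          (fun q => vertL (v t q)) p q := by
  simp only [hS.integrand₁_eq hT ht p]
  rw [← integral_smul]
  exact integral_sub (hS.integrable_comm hκ hT hB (hS.density_vel hT hB p) ht)
    ((hS.integrable_comm hκ hT hB (hS.density_heightVel hT hB p) ht).fun_smul (2 : ℝ))

theorem integrand₂_mul_e3 (hS : IsSolution T κ Λ ξ v w a) (ht : t ∈ Icc 0 T) (p q : ℝ × ℝ) :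
    integrand₂ ξ v t p q * e3
      = crossIntegrand (K (ξ t q - ξ t p)) (v t) (v t) (fun q => vertL (ξ t q)) p q := by
  rw [crossIntegrand_vertL (hS.diffξ ht)]; rfl

theorem integrand₃_mul_e3 (hS : IsSolution T κ Λ ξ v w a) (hκ : 0 < κ) (hT : 0 < T)
    (ht : t ∈ Icc 0 T) (p q : ℝ × ℝ) : integrand₃ T ξ v t p q * e3
      = crossIntegrand (DK (ξ t q - ξ t p) (v t q - v t p)) (v t) (ξ t)
        (fun q => vertL (ξ t q)) p q := by
  rw [crossIntegrand_vertL (hS.diffξ ht), hS.integrand₃_eq hκ hT ht]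

theorem integrable_integrand₂ (hS : IsSolution T κ Λ ξ v w a) (hκ : 0 < κ) (hT : 0 < T)
    (hB : Bounded T B ξ v w) (p : ℝ × ℝ) (ht : t ∈ Icc 0 T) : Integrable (integrand₂ ξ v t p) := by
  refine integrable_of_integrable_mul_e3 ?_
  simp only [hS.integrand₂_mul_e3 ht]
  exact hS.integrable_velocityTangent hκ hT hB p ht

theorem integrable_integrand₃ (hS : IsSolution T κ Λ ξ v w a) (hκ : 0 < κ) (hT : 0 < T)
    (hB : Bounded T B ξ v w) (p : ℝ × ℝ) (ht : t ∈ Icc 0 T) :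
    Integrable (integrand₃ T ξ v t p) := by
  refine integrable_of_integrable_mul_e3 ?_
  simp only [hS.integrand₃_mul_e3 hκ hT ht]
  exact hS.integrable_dK hκ hT hB p ht

theorem differentiableAt_piQ_α (hS : IsSolution T κ Λ ξ v w a) (hκ : 0 < κ)
    (hB : Bounded T B ξ v w) (p : ℝ × ℝ) (ht : t ∈ Icc 0 T) :
    HasDerivAt (fun s => piQ (ξ t) (s, p.2))
      (vertL (dα (ξ t) p) - dα (hilbert (ξ t) fun q => vertL (ξ t q)) p) p.1 := by
  obtain ⟨D, hD, -⟩ := (hS.flatSurface hκ hB ht).exists_hasDerivAt_hilbert_α p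
  simp only [piQ_eq]
  have e1 : dα (hilbert (ξ t) fun q => vertL (ξ t q)) p = D := hD.deriv
  rw [e1]
  exact (vertL.hasFDerivAt.comp_hasDerivAt p.1 (hS.diffξ ht p).hasDerivAt_dα).sub hD

theorem differentiableAt_piQ_β (hS : IsSolution T κ Λ ξ v w a) (hκ : 0 < κ)
    (hB : Bounded T B ξ v w) (p : ℝ × ℝ) (ht : t ∈ Icc 0 T) :
    HasDerivAt (fun s => piQ (ξ t) (p.1, s))
      (vertL (dβ (ξ t) p) - dβ (hilbert (ξ t) fun q => vertL (ξ t q)) p) p.2 := by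
  obtain ⟨D, hD, -⟩ := (hS.flatSurface hκ hB ht).exists_hasDerivAt_hilbert_β p
  simp only [piQ_eq]
  have e1 : dβ (hilbert (ξ t) fun q => vertL (ξ t q)) p = D := hD.deriv
  rw [e1]
  exact (vertL.hasFDerivAt.comp_hasDerivAt p.2 (hS.diffξ ht p).hasDerivAt_dβ).sub hD

theorem normalCrossGrad_piQ (hS : IsSolution T κ Λ ξ v w a) (hκ : 0 < κ)
    (hB : Bounded T B ξ v w) (p : ℝ × ℝ) (ht : t ∈ Icc 0 T) :
    a t p • normalCrossGrad (ξ t) (piQ (ξ t)) p = vertL (w t p) - w t p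
      - a t p • normalCrossGrad (ξ t) (hilbert (ξ t) fun q => vertL (ξ t q)) p := by
  have e1 : dα (piQ (ξ t)) p = _ := (hS.differentiableAt_piQ_α hκ hB p ht).deriv
  have e2 : dβ (piQ (ξ t)) p = _ := (hS.differentiableAt_piQ_β hκ hB p ht).deriv
  have hη := hS.flatSurface hκ hB ht
  rw [← hS.smul_field_mul_e3 hκ hB p ht, ← smul_sub, normalCrossGrad, e1, e2, normalCrossGrad,
    FlatSurface.field, dα_height hη.diff, dβ_height hη.diff, vertL_apply, vertL_apply]
  congr 1
  simp only [mul_sub, sub_mul, mul_smul_comm, smul_mul_assoc]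
  abel

/-- The equation for `π`. -/
theorem piTT_eq (hS : IsSolution T κ Λ ξ v w a) (hκ : 0 < κ) (hT : 0 < T)
    (hB : Bounded T B ξ v w) (p : ℝ × ℝ) (ht : t ∈ Icc 0 T) :
    piTT ξ v w t p - a t p • normalCrossGrad (ξ t) (piQ (ξ t)) p
      = (∫ q, integrand₁ ξ v t p q) - (∫ q, integrand₂ ξ v t p q) * e3
        - (∫ q, integrand₃ T ξ v t p q) * e3 := by
  have h1 := hS.hilbert_accel_eq hκ hT hB p ht
  have h2 := hS.accel_eq hκ hT hB p ht
  rw [hS.normalCrossGrad_piQ hκ hB p ht, hS.integral_integrand₁ hκ hT hB p ht,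
    ← integral_mul_e3 (hS.integrable_integrand₂ hκ hT hB p ht),
    ← integral_mul_e3 (hS.integrable_integrand₃ hκ hT hB p ht), piTT]
  simp only [hS.integrand₂_mul_e3 ht, hS.integrand₃_mul_e3 hκ hT ht]
  rw [← sub_eq_zero] at h2 ⊢
  rw [← h1, two_smul, ← sub_eq_zero, ← h2]
  abel

end IsSolution

/-! ### The orders of the terms -/

section Orders

variable {E : Type*} [NormedAddCommGroup E] [NormedSpace ℝ E] {κ Λ M c : ℝ}

theorem norm_sub_le_of_partials {g : ℝ × ℝ → E} (hg : Differentiable ℝ g)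
    (hα : ∀ q, ‖dα g q‖ ≤ M) (hβ : ∀ q, ‖dβ g q‖ ≤ M) (p q : ℝ × ℝ) :
    ‖g q - g p‖ ≤ 2 * M * ‖q - p‖ := by
  have hM : 0 ≤ M := (norm_nonneg _).trans (hα 0)
  refine Convex.norm_image_sub_le_of_norm_fderiv_le (𝕜 := ℝ) (s := univ) (fun x _ => hg x)
    (fun x _ => ?_) convex_univ (mem_univ p) (mem_univ q)
  refine ContinuousLinearMap.opNorm_le_bound _ (by positivity) fun y => ?_
  have e : y = y.1 • ((1 : ℝ), (0 : ℝ)) + y.2 • ((0 : ℝ), (1 : ℝ)) := by ext <;> simp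
  have e1 : fderiv ℝ g x y = y.1 • dα g x + y.2 • dβ g x := by
    conv_lhs => rw [e]
    rw [map_add, map_smul, map_smul, (hg x).hasFDerivAt.dα_eq, (hg x).hasFDerivAt.dβ_eq]
  rw [e1]
  refine (norm_add_le _ _).trans ?_
  rw [norm_smul, norm_smul]
  have h1 := norm_fst_le y
  have h2 := norm_snd_le y
  calc _ ≤ ‖y‖ * M + ‖y‖ * M := by
        gcongr
        · exact hα x
        · exact hβ x
    _ = _ := by ring

/-- The integral of `‖h‖⁻¹` over the unit ball. -/
def coreConst : ℝ := ∫ h in {h : ℝ × ℝ | ‖h‖ ≤ 1}, ‖h‖⁻¹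

theorem coreConst_nonneg : 0 ≤ coreConst := integral_nonneg fun _ => by positivity

/-- The size of a commutator integral. Near the diagonal the difference of `g` is estimated by
its gradient, and far away the gradient of `f` in `L²`. -/
theorem norm_integral_crossIntegrand_le {k g η f : ℝ × ℝ → ℍ[ℝ]} (p : ℝ × ℝ) (hc : 0 ≤ c)
    (hk : ∀ q ≠ p, ‖k q‖ ≤ c * (‖q - p‖ ^ 2)⁻¹) (hg : Differentiable ℝ g)
    (hgB : ∀ q, ‖g q‖ ≤ M) (hgα : ∀ q, ‖dα g q‖ ≤ M) (hgβ : ∀ q, ‖dβ g q‖ ≤ M)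
    (hηα : ∀ q, ‖dα η q‖ ≤ Λ) (hηβ : ∀ q, ‖dβ η q‖ ≤ Λ)
    (hfα : ∀ q, ‖dα f q‖ ≤ M) (hfβ : ∀ q, ‖dβ f q‖ ≤ M) (cα : Continuous (dα f))
    (cβ : Continuous (dβ f)) (hα : eLpNorm (dα f) 2 volume ≤ ENNReal.ofReal M)
    (hβ : eLpNorm (dβ f) 2 volume ≤ ENNReal.ofReal M) :
    ‖∫ q, crossIntegrand (k q) g η f p q‖
      ≤ 4 * (coreConst + tailConst 1) * (c * Λ * M ^ 2) := by
  have hM : 0 ≤ M := (norm_nonneg _).trans (hgB 0)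
  have hΛ : 0 ≤ Λ := (norm_nonneg _).trans (hηα 0)
  have bα : eLpNorm (fun h => dα f (p + h)) 2 volume ≤ ENNReal.ofReal M :=
    (eLpNorm_shift (c := fun _ => p) (f := fun _ => dα f) (s := 0) cα 2).trans_le hα
  have bβ : eLpNorm (fun h => dβ f (p + h)) 2 volume ≤ ENNReal.ofReal M :=
    (eLpNorm_shift (c := fun _ => p) (f := fun _ => dβ f) (s := 0) cβ 2).trans_le hβ
  have mα : MemLp (fun h => dα f (p + h)) 2 volume :=
    ⟨(cα.comp (continuous_const.add continuous_id)).aestronglyMeasurable,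
      bα.trans_lt ENNReal.ofReal_lt_top⟩
  have mβ : MemLp (fun h => dβ f (p + h)) 2 volume :=
    ⟨(cβ.comp (continuous_const.add continuous_id)).aestronglyMeasurable,
      bβ.trans_lt ENNReal.ofReal_lt_top⟩
  obtain ⟨iα, jα⟩ := integrableOn_inv_sq_mul hM mα bα one_pos
  obtain ⟨iβ, jβ⟩ := integrableOn_inv_sq_mul hM mβ bβ one_pos
  have i0 := (integrable_indicator_iff (measurableSet_norm_le 1)).2
    (integrableOn_inv_norm.const_mul (4 * (c * Λ * M ^ 2)))
  have i1 : Integrable ({h : ℝ × ℝ | 1 < ‖h‖}.indicator fun h => 2 * (c * Λ * M)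
      * ((‖h‖ ^ 2)⁻¹ * ‖dα f (p + h)‖ + (‖h‖ ^ 2)⁻¹ * ‖dβ f (p + h)‖)) :=
    (integrable_indicator_iff (measurableSet_lt_norm 1)).2
      ((iα.add iβ).const_mul (2 * (c * Λ * M)))
  rw [← integral_add_left_eq_self _ p]
  refine (norm_integral_le_of_norm_le (i0.add i1) ?_).trans ?_
  · filter_upwards [compl_mem_ae_iff.2 (measure_singleton (0 : ℝ × ℝ))] with h h0
    have h0' : h ≠ 0 := h0
    have hp : 0 < ‖h‖ := norm_pos_iff.2 h0'
    have hk' := hk (p + h) (by simpa using h0')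
    rw [add_sub_cancel_left] at hk'
    refine (norm_crossIntegrand_le _ _ _ _ _ _).trans ?_
    rw [Pi.add_apply]
    rcases le_or_gt ‖h‖ 1 with h1 | h1
    · rw [indicator_of_mem (show h ∈ {h : ℝ × ℝ | ‖h‖ ≤ 1} from h1),
        indicator_of_notMem (show h ∉ {h : ℝ × ℝ | 1 < ‖h‖} from not_lt.2 h1), add_zero]
      have hd : ‖g p - g (p + h)‖ ≤ 2 * M * ‖h‖ := by
        simpa using norm_sub_le_of_partials hg hgα hgβ (p + h) p
      calc _ ≤ c * (‖h‖ ^ 2)⁻¹ * (2 * M * ‖h‖ * (Λ * M + Λ * M)) := by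
            gcongr
            · exact hηβ _
            · exact hfα _
            · exact hηα _
            · exact hfβ _
        _ = _ := by field_simp; ring
    · rw [indicator_of_mem (show h ∈ {h : ℝ × ℝ | 1 < ‖h‖} from h1),
        indicator_of_notMem (show h ∉ {h : ℝ × ℝ | ‖h‖ ≤ 1} from not_le.2 h1), zero_add]
      have hd : ‖g p - g (p + h)‖ ≤ 2 * M := by
        refine (norm_sub_le _ _).trans ?_
        linarith [hgB p, hgB (p + h)]
      calc _ ≤ c * (‖h‖ ^ 2)⁻¹ * (2 * M * (Λ * ‖dα f (p + h)‖ + Λ * ‖dβ f (p + h)‖)) := by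
            gcongr
            · exact hηβ _
            · exact hηα _
        _ = _ := by ring
  · simp only [Pi.add_apply]
    rw [integral_add i0 i1,
      integral_indicator (measurableSet_norm_le 1), integral_indicator (measurableSet_lt_norm 1),
      integral_const_mul, integral_const_mul]
    have e : ∫ h in {h : ℝ × ℝ | 1 < ‖h‖}, ((‖h‖ ^ 2)⁻¹ * ‖dα f (p + h)‖
        + (‖h‖ ^ 2)⁻¹ * ‖dβ f (p + h)‖) ≤ tailConst 1 * M + tailConst 1 * M := by
      rw [integral_add iα iβ]
      exact add_le_add jα jβ
    calc _ ≤ 4 * (c * Λ * M ^ 2) * coreConst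
          + 2 * (c * Λ * M) * (tailConst 1 * M + tailConst 1 * M) := by
          gcongr
          exact le_rfl
      _ = _ := by ring

end Orders

section Defect

theorem cbar_sub_eq (σ : ℍ[ℝ]) : σ - cbar σ = ⟨2 * σ.re, 0, 0, 2 * σ.imK⟩ := by
  ext <;> (simp [cbar]; try ring)

theorem norm_sub_cbar_le (σ : ℍ[ℝ]) : ‖σ - cbar σ‖ ≤ 2 * (|σ.re| + |σ.imK|) := by
  refine abs_le_of_sq_le_sq' ?_ (by positivity) |>.2
  rw [norm_sq_eq, cbar_sub_eq]
  nlinarith [sq_abs σ.re, sq_abs σ.imK, mul_nonneg (abs_nonneg σ.re) (abs_nonneg σ.imK)]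

/-- The scalar and vertical parts of a product of vectors, when the vertical component of the first
and the horizontal components of the second factor are small. -/
theorem norm_mul_sub_cbar_le {k n : ℍ[ℝ]} (hk : k.re = 0) (hn : n.re = 0) {A A₃ N N₃ : ℝ}
    (hA : ‖k‖ ≤ A) (hA₃ : |k.imK| ≤ A₃) (hI : |n.imI| ≤ N) (hJ : |n.imJ| ≤ N) (hN₃ : ‖n‖ ≤ N₃) :
    ‖k * n - cbar (k * n)‖ ≤ 8 * A * N + 2 * A₃ * N₃ := by
  have h1 := (abs_imI_le k).trans hA
  have h2 := (abs_imJ_le k).trans hA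
  have h3 := (abs_imK_le n).trans hN₃
  have hA0 : 0 ≤ A := (norm_nonneg _).trans hA
  have hA30 : 0 ≤ A₃ := (abs_nonneg _).trans hA₃
  have a1 : |k.imI * n.imI| ≤ A * N := by rw [abs_mul]; gcongr
  have a2 : |k.imJ * n.imJ| ≤ A * N := by rw [abs_mul]; gcongr
  have a3 : |k.imK * n.imK| ≤ A₃ * N₃ := by rw [abs_mul]; gcongr
  have a4 : |k.imI * n.imJ| ≤ A * N := by rw [abs_mul]; gcongr
  have a5 : |k.imJ * n.imI| ≤ A * N := by rw [abs_mul]; gcongr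
  have e1 : |(k * n).re| ≤ 2 * (A * N) + A₃ * N₃ := by
    rw [Quaternion.re_mul, hk, abs_le]
    rw [abs_le] at a1 a2 a3
    constructor <;> linarith [a1.1, a1.2, a2.1, a2.2, a3.1, a3.2]
  have e2 : |(k * n).imK| ≤ 2 * (A * N) := by
    rw [Quaternion.imK_mul, hk, hn, abs_le]
    rw [abs_le] at a4 a5
    constructor <;> linarith [a4.1, a4.2, a5.1, a5.2]
  refine (norm_sub_cbar_le _).trans ?_
  linarith

end Defect

namespace IsSolution

variable {T κ Λ B M : ℝ} {ξ v w : ℝ → ℝ × ℝ → ℍ[ℝ]} {a : ℝ → ℝ × ℝ → ℝ} {t : ℝ}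

theorem Λ_nonneg (hS : IsSolution T κ Λ ξ v w a) (ht : t ∈ Icc 0 T) : 0 ≤ Λ :=
  (norm_nonneg _).trans (hS.tangent_α t ht 0)

theorem norm_K_le (hS : IsSolution T κ Λ ξ v w a) (hκ : 0 < κ) (ht : t ∈ Icc 0 T) {p q : ℝ × ℝ}
    (hpq : q ≠ p) : ‖K (ξ t q - ξ t p)‖ ≤ cK / κ ^ 2 * (‖q - p‖ ^ 2)⁻¹ := by
  have hp : 0 < ‖q - p‖ := norm_pos_iff.2 (sub_ne_zero.2 hpq)
  have h1 : κ * ‖q - p‖ ≤ ‖ξ t q - ξ t p‖ :=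
    le_trans (by gcongr; exact norm_le_pdist_sub q p) (hS.chordArc t ht q p)
  refine (WaterWave.norm_K_le (by positivity) h1).trans_eq ?_
  field_simp

theorem norm_DK_le (hS : IsSolution T κ Λ ξ v w a) (hκ : 0 < κ) (hT : 0 < T) (ht : t ∈ Icc 0 T)
    (hM : SizeBound (ξ t) (v t) M) {p q : ℝ × ℝ} (hpq : q ≠ p) :
    ‖DK (ξ t q - ξ t p) (v t q - v t p)‖ ≤ 8 * cK / κ ^ 3 * M * (‖q - p‖ ^ 2)⁻¹ := by
  have hc := cK_pos
  have hp : 0 < ‖q - p‖ := norm_pos_iff.2 (sub_ne_zero.2 hpq)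
  have h1 : κ * ‖q - p‖ ≤ ‖ξ t q - ξ t p‖ :=
    le_trans (by gcongr; exact norm_le_pdist_sub q p) (hS.chordArc t ht q p)
  have h2 := norm_sub_le_of_partials (hS.diffV hT ht) hM.vel_α hM.vel_β p q
  calc _ ≤ 4 * cK / ‖ξ t q - ξ t p‖ ^ 3 * ‖v t q - v t p‖ := WaterWave.norm_DK_le _ _
    _ ≤ 4 * cK / (κ * ‖q - p‖) ^ 3 * (2 * M * ‖q - p‖) := by gcongr
    _ = _ := by field_simp; ring

theorem continuous_dα_height (hS : IsSolution T κ Λ ξ v w a) (hT : 0 < T) (ht : t ∈ Icc 0 T) :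
    Continuous (dα (heightC (ξ t))) := by
  rw [heightC_eq, dα_clm _ (hS.diffξ ht)]
  exact heightL.continuous.comp (ContDiffOn.continuous_slice (continuousOn_dα hT hS.reg_one) ht)

theorem continuous_dβ_height (hS : IsSolution T κ Λ ξ v w a) (hT : 0 < T) (ht : t ∈ Icc 0 T) :
    Continuous (dβ (heightC (ξ t))) := by
  rw [heightC_eq, dβ_clm _ (hS.diffξ ht)]
  exact heightL.continuous.comp (ContDiffOn.continuous_slice (continuousOn_dβ hT hS.reg_one) ht)

theorem norm_dα_heightC (hS : IsSolution T κ Λ ξ v w a) (ht : t ∈ Icc 0 T) (q : ℝ × ℝ) :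
    ‖dα (heightC (ξ t)) q‖ = |dα (height (ξ t)) q| := by
  rw [heightC_eq, dα_clm _ (hS.diffξ ht), dα_height (hS.diffξ ht), norm_heightL]

theorem norm_dβ_heightC (hS : IsSolution T κ Λ ξ v w a) (ht : t ∈ Icc 0 T) (q : ℝ × ℝ) :
    ‖dβ (heightC (ξ t)) q‖ = |dβ (height (ξ t)) q| := by
  rw [heightC_eq, dβ_clm _ (hS.diffξ ht), dβ_height (hS.diffξ ht), norm_heightL]

/-- A commutator integral with density the height. -/
theorem norm_integral_height_le (hS : IsSolution T κ Λ ξ v w a) (hT : 0 < T)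
    (ht : t ∈ Icc 0 T) (hM : SizeBound (ξ t) (v t) M) {k η : ℝ × ℝ → ℍ[ℝ]} {c A : ℝ} (hc : 0 ≤ c)
    (p : ℝ × ℝ) (hk : ∀ q ≠ p, ‖k q‖ ≤ c * (‖q - p‖ ^ 2)⁻¹) (hηα : ∀ q, ‖dα η q‖ ≤ A)
    (hηβ : ∀ q, ‖dβ η q‖ ≤ A) : ‖∫ q, crossIntegrand (k q) (v t) η (heightC (ξ t)) p q‖
      ≤ 4 * (coreConst + tailConst 1) * (c * A * M ^ 2) :=
  norm_integral_crossIntegrand_le p hc hk (hS.diffV hT ht) hM.vel hM.vel_α hM.vel_β hηα hηβ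
    (fun q => (hS.norm_dα_heightC ht q).trans_le (hM.slope_α q))
    (fun q => (hS.norm_dβ_heightC ht q).trans_le (hM.slope_β q))
    (hS.continuous_dα_height hT ht) (hS.continuous_dβ_height hT ht)
    (le_trans (eLpNorm_mono fun q => (hS.norm_dα_heightC ht q).le) hM.slope_α_L2)
    (le_trans (eLpNorm_mono fun q => (hS.norm_dβ_heightC ht q).le) hM.slope_β_L2)

theorem norm_integral_integrand₁_le (hS : IsSolution T κ Λ ξ v w a) (hκ : 0 < κ) (hT : 0 < T)
    (ht : t ∈ Icc 0 T) (hM : SizeBound (ξ t) (v t) M) (p : ℝ × ℝ) :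
    ‖∫ q, integrand₁ ξ v t p q‖
      ≤ 4 * (coreConst + tailConst 1) * (cK / κ ^ 2 * Λ * M ^ 2) := by
  have hc := cK_pos
  have ecb : (fun r => cbar (v t r))
      = fun r => ((ContinuousLinearMap.mul ℝ ℍ[ℝ]).flip e3 ∘L ContinuousLinearMap.mul ℝ ℍ[ℝ] e3)
        (v t r) := rfl
  have eα : dα (fun r => cbar (v t r)) = fun r => cbar (dα (v t) r) := by
    rw [ecb, dα_clm _ (hS.diffV hT ht)]; rfl
  have eβ : dβ (fun r => cbar (v t r)) = fun r => cbar (dβ (v t) r) := by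
    rw [ecb, dβ_clm _ (hS.diffV hT ht)]; rfl
  have cα := ContDiffOn.continuous_slice (continuousOn_dα hT (hS.regV hT)) ht
  have cβ := ContDiffOn.continuous_slice (continuousOn_dβ hT (hS.regV hT)) ht
  refine norm_integral_crossIntegrand_le (k := fun q => K (ξ t q - ξ t p)) p (by positivity)
    (fun q hq => hS.norm_K_le hκ ht hq) (hS.diffV hT ht) hM.vel hM.vel_α hM.vel_β
    (hS.tangent_α t ht) (hS.tangent_β t ht) (fun q => ?_) (fun q => ?_) ?_ ?_ ?_ ?_
  · rw [eα, norm_cbar]; exact hM.vel_α q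
  · rw [eβ, norm_cbar]; exact hM.vel_β q
  · rw [eα]; exact (continuous_const.mul cα).mul continuous_const
  · rw [eβ]; exact (continuous_const.mul cβ).mul continuous_const
  · rw [eα]; exact (eLpNorm_mono fun q => (norm_cbar _).le).trans hM.vel_α_L2
  · rw [eβ]; exact (eLpNorm_mono fun q => (norm_cbar _).le).trans hM.vel_β_L2

theorem norm_integral_integrand₂_le (hS : IsSolution T κ Λ ξ v w a) (hκ : 0 < κ) (hT : 0 < T)
    (ht : t ∈ Icc 0 T) (hM : SizeBound (ξ t) (v t) M) (p : ℝ × ℝ) :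
    ‖(∫ q, integrand₂ ξ v t p q) * e3‖
      ≤ 4 * (coreConst + tailConst 1) * (cK / κ ^ 2 * M * M ^ 2) := by
  have hc := cK_pos
  rw [norm_mul, norm_e3, mul_one]
  exact hS.norm_integral_height_le hT ht hM (k := fun q => K (ξ t q - ξ t p)) (by positivity) p
    (fun q hq => hS.norm_K_le hκ ht hq) hM.vel_α hM.vel_β

theorem norm_integral_integrand₃_le (hS : IsSolution T κ Λ ξ v w a) (hκ : 0 < κ) (hT : 0 < T)
    (ht : t ∈ Icc 0 T) (hM : SizeBound (ξ t) (v t) M) (p : ℝ × ℝ) :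
    ‖(∫ q, integrand₃ T ξ v t p q) * e3‖
      ≤ 4 * (coreConst + tailConst 1) * (8 * cK / κ ^ 3 * M * Λ * M ^ 2) := by
  have hc := cK_pos
  have hM0 : 0 ≤ M := (norm_nonneg _).trans (hM.vel 0)
  rw [norm_mul, norm_e3, mul_one]
  simp only [hS.integrand₃_eq hκ hT ht]
  exact hS.norm_integral_height_le hT ht hM
    (k := fun q => DK (ξ t q - ξ t p) (v t q - v t p)) (by positivity) p
    (fun q hq => hS.norm_DK_le hκ hT ht hM hq) (hS.tangent_α t ht) (hS.tangent_β t ht)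

/-- The kernel of `𝔥 - 𝔥̄` is of first order: the normal is vertical and the chord horizontal, both
up to errors of the size of the slope. -/
theorem norm_defectKernel_le (hS : IsSolution T κ Λ ξ v w a) (hκ : 0 < κ)
    (ht : t ∈ Icc 0 T) (hM : SizeBound (ξ t) (v t) M) (p q : ℝ × ℝ) :
    ‖defectKernel (ξ t) p q‖ * pdist p q ^ 2
      ≤ (16 * cK * Λ / κ ^ 2 + 4 * cK * Λ ^ 2 / κ ^ 3) * M := by
  have hc := cK_pos
  have hM0 : 0 ≤ M := (norm_nonneg _).trans (hM.vel 0)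
  have hΛ := hS.Λ_nonneg ht
  have hη := hS.diffξ ht
  have hsymm : pdist p q = pdist q p := by
    unfold pdist; congr 1; ring
  rw [hsymm]
  have hnn : 0 ≤ pdist q p := Real.sqrt_nonneg _
  rcases hnn.eq_or_lt with h0 | h0
  · rw [← h0]; simp; positivity
  have h1 := hS.chordArc t ht q p
  have hx : 0 < κ * pdist q p := by positivity
  have hsα : ∀ q, |(dα (ξ t) q).imK| ≤ M := fun q => by
    have := hM.slope_α q; rwa [dα_height hη] at this
  have hsβ : ∀ q, |(dβ (ξ t) q).imK| ≤ M := fun q => by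
    have := hM.slope_β q; rwa [dβ_height hη] at this
  have dh : Differentiable ℝ (height (ξ t)) := by
    rw [height_eq]; exact (innerSL ℝ e3).differentiable.comp hη
  have hz : |(ξ t q - ξ t p).imK| ≤ 2 * M * pdist q p := by
    have := norm_sub_le_of_partials dh hM.slope_α hM.slope_β p q
    rw [Real.norm_eq_abs] at this
    refine this.trans ?_
    gcongr
    exact norm_le_pdist_sub q p
  have k3 : |(K (ξ t q - ξ t p)).imK| ≤ cK / (κ * pdist q p) ^ 3 * (2 * M * pdist q p) := by
    rw [K_eq, Quaternion.imK_smul, smul_eq_mul, abs_mul, abs_div, abs_neg, abs_of_pos hc,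
      abs_of_nonneg (by positivity)]
    gcongr
  have hm : ∀ {x y x' y' : ℝ}, |x| ≤ Λ → |y| ≤ M → |x'| ≤ M → |y'| ≤ Λ →
      |x * y - x' * y'| ≤ 2 * (Λ * M) := fun {x y x' y'} h1 h2 h3 h4 => by
    refine (abs_sub _ _).trans ?_
    rw [abs_mul, abs_mul]
    have := mul_le_mul h1 h2 (abs_nonneg _) hΛ
    have := mul_le_mul h3 h4 (abs_nonneg _) hM0
    linarith
  have tα := hS.tangent_α t ht q
  have tβ := hS.tangent_β t ht q
  have n1 : |(normal (ξ t) q).imI| ≤ 2 * (Λ * M) := by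
    rw [normal, cross_imI]
    exact hm ((abs_imJ_le _).trans tα) (hsβ q) (hsα q) ((abs_imJ_le _).trans tβ)
  have n2 : |(normal (ξ t) q).imJ| ≤ 2 * (Λ * M) := by
    rw [normal, cross_imJ, abs_sub_comm]
    exact hm ((abs_imI_le _).trans tα) (hsβ q) (hsα q) ((abs_imI_le _).trans tβ)
  have n3 : ‖normal (ξ t) q‖ ≤ Λ * Λ := (norm_cross_le _ _).trans (by gcongr)
  have kre : (K (ξ t q - ξ t p)).re = 0 := K_re _ (by simp [hS.isVector t ht])
  have key := norm_mul_sub_cbar_le kre (by simp [normal]) (WaterWave.norm_K_le hx h1) k3 n1 n2 n3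
  calc _ ≤ (8 * (cK / (κ * pdist q p) ^ 2) * (2 * (Λ * M))
        + 2 * (cK / (κ * pdist q p) ^ 3 * (2 * M * pdist q p)) * (Λ * Λ)) * pdist q p ^ 2 := by
        gcongr; exact key
    _ = _ := by field_simp; ring

theorem hasPV_hilbert_height (hS : IsSolution T κ Λ ξ v w a) (hκ : 0 < κ) (hT : 0 < T)
    (hB : Bounded T B ξ v w) (p : ℝ × ℝ) (ht : t ∈ Icc 0 T) :
    HasPV (hilbertIntegrand (ξ t) (fun q => heightC (ξ t) q * e3) p) p
      (hilbert (ξ t) (fun q => heightC (ξ t) q * e3) p) := by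
  rw [heightC_mul_e3]
  have h := hS.hasPV_hilbert hκ hT hB (hS.density_height hT hB p) ht
  exact h

theorem hasPV_hilbert_cbar (hS : IsSolution T κ Λ ξ v w a) (hκ : 0 < κ) (hT : 0 < T)
    (hB : Bounded T B ξ v w) (p : ℝ × ℝ) (ht : t ∈ Icc 0 T) :
    HasPV (hilbertIntegrand (ξ t) (fun q => cbar (v t q)) p) p
      (hilbert (ξ t) (fun q => cbar (v t q)) p) := by
  have h1 := (hS.analytic t ht p).sub
    ((hS.hasPV_hilbert hκ hT hB (hS.density_heightVel hT hB p) ht).const_smul 2)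
  have h2 : HasPV (hilbertIntegrand (ξ t) (fun q => cbar (v t q)) p) p _ := h1.congr fun q => by
    simp only [hilbertIntegrand]
    rw [cbar_eq_of_re (hS.vel_re hT q ht), mul_sub, mul_smul_comm]
  rwa [← h2.hilbert_eq] at h2

/-- Since `ξ_t = 𝔥 ξ_t`, conjugation shows that `𝔥̄` maps the conjugate velocity to minus itself,
and `I + 𝔥 = 𝔥 - 𝔥̄` on it. -/
theorem hasPV_defectKernel (hS : IsSolution T κ Λ ξ v w a) (hκ : 0 < κ) (hT : 0 < T)
    (hB : Bounded T B ξ v w) (p : ℝ × ℝ) (ht : t ∈ Icc 0 T) :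
    HasPV (fun q => defectKernel (ξ t) p q * cbar (v t q)) p
      (cbar (v t p) + hilbert (ξ t) (fun q => cbar (v t q)) p) := by
  have h1 : HasPV (fun q => cbar (hilbertIntegrand (ξ t) (v t) p q)) p (cbar (v t p)) :=
    ((hS.analytic t ht p).const_mul e3).mul_const e3
  refine (h1.add (hS.hasPV_hilbert_cbar hκ hT hB p ht)).congr fun q => ?_
  rw [defectKernel, sub_mul, cbar_mul_cbar, sub_neg_eq_add, add_comm]
  rfl

end IsSolution

end WaterWave

end

theorem mainTheorem3 (κ Λ : ℝ) (hκ : 0 < κ) :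
    ∃ C : ℝ, ∀ (T : ℝ) (ξ v w : ℝ → ℝ × ℝ → ℍ[ℝ]) (a : ℝ → ℝ × ℝ → ℝ), 0 < T →
      IsSolution T κ Λ ξ v w a →
      -- the equation for `π`, all of whose terms exist
      (∃ πt πtt : ℝ → ℝ × ℝ → ℍ[ℝ], ∀ t ∈ Icc 0 T, ∀ p : ℝ × ℝ,
        HasPV (hilbertIntegrand (ξ t) (fun q => heightC (ξ t) q * e3) p) p
          (hilbert (ξ t) (fun q => heightC (ξ t) q * e3) p) ∧
        DifferentiableAt ℝ (fun s => piQ (ξ t) (s, p.2)) p.1 ∧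
        DifferentiableAt ℝ (fun s => piQ (ξ t) (p.1, s)) p.2 ∧
        HasDerivWithinAt (fun s => piQ (ξ s) p) (πt t p) (Icc 0 T) t ∧
        HasDerivWithinAt (fun s => πt s p) (πtt t p) (Icc 0 T) t ∧
        Integrable (integrand₁ ξ v t p) ∧
        Integrable (integrand₂ ξ v t p) ∧
        Integrable (integrand₃ T ξ v t p) ∧
        πtt t p - a t p • normalCrossGrad (ξ t) (piQ (ξ t)) p =
          (∫ q, integrand₁ ξ v t p q) - (∫ q, integrand₂ ξ v t p q) * e3
            - (∫ q, integrand₃ T ξ v t p q) * e3) ∧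
      -- orders of the terms, in the size `M` of velocity and steepness at one time
      (∀ t ∈ Icc 0 T, ∀ M : ℝ, SizeBound (ξ t) (v t) M → ∀ p : ℝ × ℝ,
        ‖∫ q, integrand₁ ξ v t p q‖ ≤ C * M ^ 2 ∧
        ‖(∫ q, integrand₂ ξ v t p q) * e3‖ ≤ C * M ^ 3 ∧
        ‖(∫ q, integrand₃ T ξ v t p q) * e3‖ ≤ C * M ^ 3 ∧
        -- almost analyticity of `ξ̄_t` in the air: `(I + 𝔥) ξ̄_t` is an integral operator with a
        -- kernel of first order in `M`, applied to `ξ̄_t`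
        HasPV (hilbertIntegrand (ξ t) (fun q => cbar (v t q)) p) p
          (hilbert (ξ t) (fun q => cbar (v t q)) p) ∧
        HasPV (fun q => defectKernel (ξ t) p q * cbar (v t q)) p
          (cbar (v t p) + hilbert (ξ t) (fun q => cbar (v t q)) p) ∧
        ∀ q : ℝ × ℝ, ‖defectKernel (ξ t) p q‖ * pdist p q ^ 2 ≤ C * M) := by
  have hc := cK_pos
  have hI : 0 ≤ 4 * (coreConst + tailConst 1) := by
    linarith [coreConst_nonneg, tailConst_nonneg 1]
  obtain ⟨I, hI'⟩ : ∃ I, 4 * (coreConst + tailConst 1) = I := ⟨_, rfl⟩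
  rw [hI'] at hI
  -- `|Λ|` keeps the constant nonnegative; a solution exists only for `Λ ≥ 0`
  obtain ⟨C₁, hC₁⟩ : ∃ C₁, C₁ = I * (cK / κ ^ 2 * |Λ|) := ⟨_, rfl⟩
  obtain ⟨C₂, hC₂⟩ : ∃ C₂, C₂ = I * (cK / κ ^ 2) := ⟨_, rfl⟩
  obtain ⟨C₃, hC₃⟩ : ∃ C₃, C₃ = I * (8 * cK / κ ^ 3 * |Λ|) := ⟨_, rfl⟩
  obtain ⟨C₄, hC₄⟩ : ∃ C₄, C₄ = 16 * cK * |Λ| / κ ^ 2 + 4 * cK * |Λ| ^ 2 / κ ^ 3 := ⟨_, rfl⟩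
  have h₁ : 0 ≤ C₁ := by rw [hC₁]; positivity
  have h₂ : 0 ≤ C₂ := by rw [hC₂]; positivity
  have h₃ : 0 ≤ C₃ := by rw [hC₃]; positivity
  have h₄ : 0 ≤ C₄ := by rw [hC₄]; positivity
  refine ⟨C₁ + C₂ + C₃ + C₄, fun T ξ v w a hT hS => ?_⟩
  obtain ⟨B, hB⟩ := hS.decay
  have hB : IsSolution.Bounded T B ξ v w := hB
  refine ⟨⟨piT ξ v, piTT ξ v w, fun t ht p => ⟨?_, (hS.differentiableAt_piQ_α hκ hB p
    ht).differentiableAt, (hS.differentiableAt_piQ_β hκ hB p ht).differentiableAt,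
    hS.hasDerivWithinAt_piQ hκ hT hB p ht, hS.hasDerivWithinAt_piT hκ hT hB p ht,
    hS.integrable_integrand₁ hκ hT hB p ht, hS.integrable_integrand₂ hκ hT hB p ht,
    hS.integrable_integrand₃ hκ hT hB p ht, hS.piTT_eq hκ hT hB p ht⟩⟩, fun t ht M hM p => ?_⟩
  · exact hS.hasPV_hilbert_height hκ hT hB p ht
  have hM0 : 0 ≤ M := (norm_nonneg _).trans (hM.vel 0)
  have hΛ : |Λ| = Λ := abs_of_nonneg (hS.Λ_nonneg ht)
  rw [hΛ] at hC₁ hC₃ hC₄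
  have b₁ := hS.norm_integral_integrand₁_le hκ hT ht hM p
  have b₂ := hS.norm_integral_integrand₂_le hκ hT ht hM p
  have b₃ := hS.norm_integral_integrand₃_le hκ hT ht hM p
  rw [hI'] at b₁ b₂ b₃
  refine ⟨b₁.trans ?_, b₂.trans ?_, b₃.trans ?_, hS.hasPV_hilbert_cbar hκ hT hB p ht,
    hS.hasPV_defectKernel hκ hT hB p ht, fun q => (hS.norm_defectKernel_le hκ ht hM p q).trans ?_⟩
  · calc _ = C₁ * M ^ 2 := by rw [hC₁]; ring
      _ ≤ _ := by gcongr; linarith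
  · calc _ = C₂ * M ^ 3 := by rw [hC₂]; ring
      _ ≤ _ := by gcongr; linarith
  · calc _ = C₃ * M ^ 3 := by rw [hC₃]; ring
      _ ≤ _ := by gcongr; linarith
  · rw [← hC₄]
    gcongr
    linarith
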